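/- Let $F\subset \mathrm{Sym}^2(\mathbf R^n)$ be a closed set of symmetric matrices such that $A+P\in F$ whenever $A\in F$ and $P\ge 0$ (a subequation), $tF\subset F$ for all $t\ge 0$, $F$ is convex, and $F$ is invariant under $A\mapsto gAg^{t}$ for all $g$ in some subgroup $G\subset \mathrm O(n)$ acting transitively on the unit sphere. For a unit vector $e$ let $P_e$ and $P_{e^\perp}=I-P_e$ be the orthogonal projections onto the line of $e$ and its complement, and assume that the Riesz characteristic $p=\sup\{\bar p\in\mathbf R : P_{e^\perp}-(\bar p-1)P_e\in F \text{ for all unit } e\}$ is finite. An upper semicontinuous function $u:X\to[-\infty,\infty)$ on an open set $X\subset\mathbf R^n$ is $F$-subharmonic if $D^2_x\varphi\in F$ whenever $x\in X$ and $\varphi$ is $C^2$ near $x$ with $u\le\varphi$ near $x$ and $u(x)=\varphi(x)$. It is $F$-harmonic if $u$ is $F$-subharmonic and $-u$ is $\widetilde F$-subharmonic, where $\widetilde F=\mathrm{Sym}^2(\mathbf R^n)\setminus(-\mathrm{Int}\,F)$ (in particular $u$ is then finite and continuous). An $F$-subharmonic $u$ on $X$ is $F$-maximal on $X$ if for every $F$-subharmonic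 $v$ on $X$ and every compact $K\subset X$, $v\le u$ on $X\setminus K$ implies $v\le u$ on $X$. Let $u$ be $F$-subharmonic on a ball about $0$, and for $r>0$ set $u_r(x)=r^{p-2}u(rx)$ if $p>2$, $u_r(x)=r^{-(2-p)}\,[u(rx)-u(0)]$ if $p<2$, and $u_r(x)=u(rx)-\sup_{|y|\le r}u(y)$ if $p=2$. A tangent to $u$ at $0$ is a function $U(x)=\lim_{s\downarrow 0}\operatorname{ess\,sup}_{B_s(x)}\overline U$, where $\overline U=\lim_{j} u_{r_j}$ in $L^1_{\rm loc}(\mathbf R^n)$ for some sequence of positive numbers $r_j\to 0$. Then for every tangent $U$ to $u$ at $0$: (1) $U$ is $F$-maximal on $\mathbf R^n\setminus\{0\}$; (2) if $U$ is finite-valued and continuous on $\mathbf R^n\setminus\{0\}$, then $U$ is $F$-harmonic on $\mathbf R^n\setminus\{0\}$; (3) if $p<2$, then $U$ is continuous and $F$-harmonic on $\mathbf R^n\setminus\{0\}$. -/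

import Mathlib

open Set Filter Topology MeasureTheory

/-- Euclidean `n`-space. -/
abbrev Euc (n : ℕ) : Type := EuclideanSpace ℝ (Fin n)

/-- Real `n × n` matrices. -/
abbrev Mat (n : ℕ) : Type := Matrix (Fin n) (Fin n) ℝ

/-- The space of symmetric matrices, as a set of matrices. -/
def symMat (n : ℕ) : Set (Mat n) := {A | A.IsSymm}

/-- A (constant coefficient, pure second-order) subequation: a closed set of symmetric matrices
that is stable under the addition of positive semidefinite matrices. -/
structure IsSubequation {n : ℕ} (F : Set (Mat n)) : Prop where
  subset_sym : F ⊆ symMat n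
  closed : IsClosed F
  positivity : ∀ A ∈ F, ∀ P : Mat n, P.PosSemidef → A + P ∈ F

/-- The cone property. -/
def IsConeSet {n : ℕ} (F : Set (Mat n)) : Prop :=
  ∀ t : ℝ, 0 ≤ t → ∀ A ∈ F, t • A ∈ F

/-- Spherical transitivity: `F` is invariant (under `A ↦ g A gᵀ`) for all `g` in some subgroup of
`O(n)` that acts transitively on the unit sphere. -/
def IsSTInvariant {n : ℕ} (F : Set (Mat n)) : Prop :=
  ∃ G : Subgroup (Matrix.orthogonalGroup (Fin n) ℝ),
    (∀ x y : Euc n, ‖x‖ = 1 → ‖y‖ = 1 →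
      ∃ g ∈ G, Matrix.mulVec (g : Mat n) x.ofLp = y.ofLp) ∧
    ∀ g ∈ G, ∀ A ∈ F, (g : Mat n) * A * (g : Mat n).transpose ∈ F

/-- The matrix `e eᵀ`; for a unit vector `e`, the orthogonal projection onto the line of `e`. -/
def projLine {n : ℕ} (e : Euc n) : Mat n := Matrix.of fun i j => e i * e j

/-- The (increasing) Riesz characteristic
`sup {p : P_{e^⊥} - (p - 1) P_e ∈ F for all unit vectors e}`, as an extended real. -/
noncomputable def rieszChar {n : ℕ} (F : Set (Mat n)) : EReal :=
  sSup {q : EReal | ∃ p : ℝ, q = (p : EReal) ∧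
    ∀ e : Euc n, ‖e‖ = 1 → (1 - projLine e) - (p - 1) • projLine e ∈ F}

/-- The Hessian matrix of `φ` at `x`. -/
noncomputable def hessian {n : ℕ} (φ : Euc n → ℝ) (x : Euc n) : Mat n :=
  Matrix.of fun i j =>
    fderiv ℝ (fderiv ℝ φ) x (EuclideanSpace.single i 1) (EuclideanSpace.single j 1)

/-- `u` is `F`-subharmonic on `X` (intended for open `X`): it is upper semicontinuous on `X` with
values in `[-∞, ∞)`, and every `C²` function touching `u` from above at a point of `X` has its
Hessian at that point in `F`. -/
structure IsSubharmonicOn {n : ℕ} (F : Set (Mat n)) (X : Set (Euc n)) (u : Euc n → EReal) :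
    Prop where
  usc : UpperSemicontinuousOn u X
  ne_top : ∀ x ∈ X, u x ≠ ⊤
  viscosity : ∀ x ∈ X, ∀ φ : Euc n → ℝ, ContDiffAt ℝ 2 φ x → u x = (φ x : EReal) →
    (∀ᶠ y in 𝓝 x, u y ≤ (φ y : EReal)) → hessian φ x ∈ F

/-- The dual subequation, the complement of `-Int F`; interior and complement are taken in the
space of symmetric matrices. -/
def dualSubequation {n : ℕ} (F : Set (Mat n)) : Set (Mat n) :=
  {A | A ∈ symMat n ∧ ¬ (F ∈ 𝓝[symMat n] (-A))}

/-- `u` is `F`-harmonic on `X`: `u` is `F`-subharmonic and `-u` is subharmonic for the dual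
subequation. In particular such a `u` is finite and continuous on an open `X`. -/
def IsHarmonicOn {n : ℕ} (F : Set (Mat n)) (X : Set (Euc n)) (u : Euc n → EReal) : Prop :=
  IsSubharmonicOn F X u ∧ IsSubharmonicOn (dualSubequation F) X (fun x => -u x)

/-- `u` is `F`-maximal on `X`. -/
def IsMaximalOn {n : ℕ} (F : Set (Mat n)) (X : Set (Euc n)) (u : Euc n → EReal) : Prop :=
  IsSubharmonicOn F X u ∧
    ∀ v : Euc n → EReal, IsSubharmonicOn F X v →
      ∀ K : Set (Euc n), IsCompact K → K ⊆ X →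
        (∀ x ∈ X \ K, v x ≤ u x) → ∀ x ∈ X, v x ≤ u x

/-- `M(u, r) = sup_{|x| ≤ r} u`. -/
noncomputable def ballMax {n : ℕ} (u : Euc n → EReal) (r : ℝ) : EReal :=
  ⨆ x ∈ Metric.closedBall (0 : Euc n) r, u x

/-- The tangential `p`-flow `u_r` at the origin. -/
noncomputable def tangentialFlow {n : ℕ} (p : ℝ) (u : Euc n → EReal) (r : ℝ) (x : Euc n) :
    EReal :=
  if 2 < p then ((r ^ (p - 2) : ℝ) : EReal) * u (r • x)
  else if p < 2 then ((1 / r ^ (2 - p) : ℝ) : EReal) * (u (r • x) - u 0)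
  else u (r • x) - ballMax u r

/-- `f j → g` in `L¹_loc(ℝⁿ)`. `EReal.abs` takes the value `⊤` at `±∞`, so that a function that is
infinite on a set of positive measure is at infinite distance from `g`. -/
def TendstoL1Loc {n : ℕ} (f : ℕ → Euc n → EReal) (g : Euc n → ℝ) : Prop :=
  LocallyIntegrable g volume ∧
    ∀ R : ℝ, 0 < R →
      Tendsto (fun j => ∫⁻ x in Metric.closedBall (0 : Euc n) R, (f j x - (g x : EReal)).abs)
        atTop (𝓝 0)

/-- `U` is a tangent to `u` at the origin (for the flow of exponent `p`): for some sequence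
`r j → 0` of positive numbers the functions `u_{r j}` converge in `L¹_loc(ℝⁿ)`, and `U` is the
representative `U(x) = lim_{s → 0} ess sup_{B_s(x)} Ubar` of the limit `Ubar`. -/
def IsTangentAtZero {n : ℕ} (p : ℝ) (u U : Euc n → EReal) : Prop :=
  ∃ (r : ℕ → ℝ) (Ubar : Euc n → ℝ),
    (∀ j, 0 < r j) ∧ Tendsto r atTop (𝓝 0) ∧
    TendstoL1Loc (fun j => tangentialFlow p u (r j)) Ubar ∧
    ∀ x : Euc n,
      Tendsto (fun s : ℝ =>
          essSup (fun y => (Ubar y : EReal)) (volume.restrict (Metric.closedBall x s)))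
        (𝓝[>] 0) (𝓝 (U x))

/-! The crux is that F-subharmonic functions, averaged over spheres, are convex functions of the
Riesz kernel `rieszK p`, and that a tangent has affine averages.

Convexity. `P_{e^⊥} - (q-1)P_e` is outside the closed convex cone F for every q > p, so Hahn–Banach
gives a functional ℓ that is nonnegative on F and almost annihilates `rieszMat e p`, the direction
of the Hessian of the Riesz kernel (`RieszData.exists_functional`). F-subharmonic functions are then
subharmonic for the linear operator ℓ(D²·), which has a harmonic measure (`exists_harmonicMeasure`)
and hence mean value inequalities. Averaging over the stabilizer of F, a compact group transitive on
spheres, makes functions radial. At a point in direction e the inequality for ℓ then gives the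
convexity statement (`RieszData.orbitAvg_concave`, phrased for M - u ≥ 0 so that all integrals make
sense in [0, ∞]).

Affine averages. A subsequence of the flow converges fast enough to be handled almost everywhere,
and its limit is F-subharmonic (`IsFastSeq.isSubharmonicOn`). Difference quotients of averages
against the kernel are invariant under the flow and monotone in the radius. Along shrinking scales
they therefore converge to a single number, so the averages of the tangent are affine in the kernel
(`exists_orbitMean_eq`).

Maximality. If v competes with U, then w = max(U, v) has convex averages agreeing with the affine
averages of U near both edges of a shell, so they are no larger inside. As w ≥ U, the two agree
almost everywhere, and then everywhere by the mean value inequality (`IsFastSeq.isMaximalOn`).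

Harmonicity. A finite continuous maximal function is harmonic, since a failing lower test function
could be lifted slightly into a competitor (`IsMaximalOn.isHarmonicOn`). For p < 2, kernels of
exponent q in (p, 2) are finite at their pole and serve as barriers; they give continuity and show
that the set where U = -∞ is open, hence empty because U is finite almost everywhere. -/

open scoped ENNReal

/-! ### The stabilizer of F, the Riesz characteristic and polar functionals -/

variable {n : ℕ} {F : Set (Mat n)} {p : ℝ}

/-- Used for the Hahn–Banach separation of a matrix from F. -/
noncomputable instance instLCMat (n : ℕ) : LocallyConvexSpace ℝ (Mat n) :=
  inferInstanceAs (LocallyConvexSpace ℝ (Fin n → Fin n → ℝ))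

/-- The matrix `P_{e^⊥} - (q - 1) P_e`. -/
def rieszMat {n : ℕ} (e : Euc n) (q : ℝ) : Mat n := (1 - projLine e) - (q - 1) • projLine e

lemma rieszMat_eq {n : ℕ} (e : Euc n) (q : ℝ) : rieszMat e q = 1 - q • projLine e := by
  unfold rieszMat; module

lemma projLine_eq_vecMulVec {n : ℕ} (e : Euc n) :
    projLine e = Matrix.vecMulVec e.ofLp e.ofLp := by
  ext i j; simp [projLine, Matrix.vecMulVec_apply]

lemma posSemidef_projLine {n : ℕ} (e : Euc n) : (projLine e).PosSemidef := by
  rw [projLine_eq_vecMulVec]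
  simpa using Matrix.posSemidef_vecMulVec_self_star e.ofLp

/-- The stabilizer of `F` in the orthogonal group, as a set of matrices. -/
def stabSet {n : ℕ} (F : Set (Mat n)) : Set (Mat n) :=
  {g | g ∈ Matrix.orthogonalGroup (Fin n) ℝ ∧
    ∀ A ∈ F, g * A * g.transpose ∈ F ∧ g.transpose * A * g ∈ F}

/-- The given group need not be closed, so averaging is done later over the whole stabilizer, which
contains it and is compact. Inverses in the group supply the condition on the transpose. -/
lemma IsSTInvariant.exists_stab {n : ℕ} {F : Set (Mat n)} (h : IsSTInvariant F) (x y : Euc n)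
    (hx : ‖x‖ = 1) (hy : ‖y‖ = 1) :
    ∃ g ∈ stabSet F, Matrix.mulVec g x.ofLp = y.ofLp := by
  obtain ⟨G, hG, hF⟩ := h
  obtain ⟨g, hg, hxy⟩ := hG x y hx hy
  refine ⟨g, ⟨g.2, fun A hA => ⟨hF g hg A hA, ?_⟩⟩, hxy⟩
  have := hF g⁻¹ (G.inv_mem hg) A hA
  have e : ((g⁻¹ : Matrix.orthogonalGroup (Fin n) ℝ) : Mat n) = (g : Mat n).transpose := by
    rw [← Unitary.star_eq_inv]; rfl
  simpa [e] using this

lemma orthogonal_mul_transpose {n : ℕ} {g : Mat n}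
    (hg : g ∈ Matrix.orthogonalGroup (Fin n) ℝ) : g * g.transpose = 1 := by
  have := (Matrix.mem_orthogonalGroup_iff (Fin n) ℝ).1 hg
  simpa using this

lemma orthogonal_transpose_mul {n : ℕ} {g : Mat n}
    (hg : g ∈ Matrix.orthogonalGroup (Fin n) ℝ) : g.transpose * g = 1 := by
  have := (Matrix.mem_orthogonalGroup_iff' (Fin n) ℝ).1 hg
  simpa using this

lemma conj_rieszMat {n : ℕ} {g : Mat n} (hg : g ∈ Matrix.orthogonalGroup (Fin n) ℝ)
    {x y : Euc n} (h : Matrix.mulVec g x.ofLp = y.ofLp) (q : ℝ) :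
    g * rieszMat x q * g.transpose = rieszMat y q := by
  rw [rieszMat_eq, rieszMat_eq, mul_sub, sub_mul, mul_one, orthogonal_mul_transpose hg,
    projLine_eq_vecMulVec, projLine_eq_vecMulVec, mul_smul_comm, smul_mul_assoc,
    Matrix.mul_vecMulVec, Matrix.vecMulVec_mul, h, Matrix.vecMul_transpose, h]

/-- The data on `F` that the argument uses. -/
structure RieszData {n : ℕ} (F : Set (Mat n)) (p : ℝ) : Prop where
  sub : IsSubequation F
  cone : IsConeSet F
  st : IsSTInvariant F
  conv : Convex ℝ F
  pos_dim : 0 < n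
  nonempty : F.Nonempty
  riesz_mem : ∀ e : Euc n, ‖e‖ = 1 → rieszMat e p ∈ F
  riesz_notMem : ∀ q, p < q → ∀ e : Euc n, ‖e‖ = 1 → rieszMat e q ∉ F

lemma exists_unit_vector {n : ℕ} (hn : 0 < n) : ∃ e : Euc n, ‖e‖ = 1 :=
  ⟨EuclideanSpace.single ⟨0, hn⟩ 1, by simp⟩

/-- Positivity with `projLine e ≥ 0` makes the admissible exponents an interval unbounded below, and
closedness of F puts p itself in it. By transitivity, membership for a single e would imply it for
all, so every larger exponent fails at every e. In dimension 0 there are no unit vectors and the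
supremum would be infinite. -/
lemma RieszData.mk' {n : ℕ} {F : Set (Mat n)} (hF : IsSubequation F) (hcone : IsConeSet F)
    (hST : IsSTInvariant F) (hconv : Convex ℝ F) (p : ℝ) (hp : rieszChar F = (p : EReal)) :
    RieszData F p := by
  have hn : 0 < n := by
    rcases Nat.eq_zero_or_pos n with h | h
    · subst h
      exfalso
      have h1 : ((p + 1 : ℝ) : EReal) ≤ rieszChar F := by
        refine le_sSup ⟨p + 1, rfl, fun e he => ?_⟩
        rw [Subsingleton.elim e 0] at he; simp at he
      rw [hp, EReal.coe_le_coe_iff] at h1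
      linarith
    · exact h
  obtain ⟨e₀, he₀⟩ := exists_unit_vector hn
  have below : ∀ q < p, ∀ e : Euc n, ‖e‖ = 1 → rieszMat e q ∈ F := by
    intro q hq e he
    have : (q : EReal) < rieszChar F := by rw [hp]; exact_mod_cast hq
    obtain ⟨_, ⟨r, rfl, hr⟩, hqr⟩ := lt_sSup_iff.1 this
    have hqr' : q < r := by exact_mod_cast hqr
    have : rieszMat e q = rieszMat e r + (r - q) • projLine e := by
      rw [rieszMat_eq, rieszMat_eq]; module
    rw [this]
    exact hF.positivity _ (hr e he) _ ((posSemidef_projLine e).smul (by linarith))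
  refine ⟨hF, hcone, hST, hconv, hn, ⟨_, below (p - 1) (by linarith) e₀ he₀⟩, ?_, ?_⟩
  · intro e he
    have hc : Tendsto (fun q => rieszMat e q) (𝓝[<] p) (𝓝 (rieszMat e p)) := by
      have : Continuous fun q => rieszMat e q := by
        simp only [rieszMat_eq]; fun_prop
      exact this.continuousWithinAt
    exact hF.closed.mem_of_tendsto hc (eventually_mem_nhdsWithin.mono fun q hq => below q hq e he)
  · intro q hq e he hmem
    have h1 : (q : EReal) ≤ rieszChar F := by
      refine le_sSup ⟨q, rfl, fun e' he' => ?_⟩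
      obtain ⟨g, hg, hge⟩ := hST.exists_stab e e' he he'
      have := (hg.2 _ hmem).1
      rwa [conj_rieszMat hg.1 hge] at this
    rw [hp, EReal.coe_le_coe_iff] at h1
    linarith

lemma RieszData.zero_mem (h : RieszData F p) : (0 : Mat n) ∈ F := by
  obtain ⟨A, hA⟩ := h.nonempty
  simpa using h.cone 0 le_rfl A hA

lemma RieszData.psd_mem (h : RieszData F p) {P : Mat n} (hP : P.PosSemidef) : P ∈ F := by
  simpa using h.sub.positivity 0 h.zero_mem P hP

/-- At exponent 1 the Riesz matrix is the projection onto the complement of e, positive semidefinite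
by Cauchy–Schwarz and so a member of F. -/
lemma RieszData.one_le (h : RieszData F p) : 1 ≤ p := by
  by_contra hlt
  obtain ⟨e, he⟩ := exists_unit_vector h.pos_dim
  refine h.riesz_notMem 1 (by linarith) e he (h.psd_mem ?_)
  rw [rieszMat_eq, one_smul]
  refine Matrix.PosSemidef.of_dotProduct_mulVec_nonneg ?_ ?_
  · exact (Matrix.isHermitian_one).sub (posSemidef_projLine e).1
  · intro x
    have hcs := real_inner_mul_inner_self_le (WithLp.toLp 2 x : Euc n) e
    have e1 : inner ℝ (WithLp.toLp 2 x : Euc n) e = e.ofLp ⬝ᵥ x := by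
      simp [PiLp.inner_apply, dotProduct, mul_comm]
    have e2 : inner ℝ (WithLp.toLp 2 x : Euc n) (WithLp.toLp 2 x) = x ⬝ᵥ x := by
      rw [real_inner_self_eq_norm_sq, EuclideanSpace.real_norm_sq_eq]; simp [dotProduct, sq]
    rw [real_inner_self_eq_norm_sq e, he, e1, e2] at hcs
    rw [projLine_eq_vecMulVec]
    simp only [star_trivial, Matrix.sub_mulVec, Matrix.one_mulVec, Matrix.vecMulVec_mulVec,
      dotProduct_sub]
    have : x ⬝ᵥ (MulOpposite.op (e.ofLp ⬝ᵥ x) • e.ofLp) = (e.ofLp ⬝ᵥ x) * (e.ofLp ⬝ᵥ x) := by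
      simp [dotProduct_comm x]
    rw [this]; linarith

/-- A functional in the polar cone of `F` that nearly annihilates `P_{e^⊥} - (p - 1) P_e`. -/
lemma RieszData.exists_functional (h : RieszData F p) {δ : ℝ} (hδ : 0 < δ) (e : Euc n)
    (he : ‖e‖ = 1) :
    ∃ ℓ : Mat n →L[ℝ] ℝ, (∀ A ∈ F, 0 ≤ ℓ A) ∧ ℓ (projLine e) = 1 ∧ p ≤ ℓ 1 ∧ ℓ 1 < p + δ := by
  obtain ⟨f, c, hfx, hf⟩ := geometric_hahn_banach_point_closed h.conv h.sub.closed
    (h.riesz_notMem (p + δ) (by linarith) e he)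
  have hc : c < 0 := by simpa using hf 0 h.zero_mem
  -- A functional bounded below on a cone is nonnegative there: otherwise a multiple of A would
  -- reach the bound c.
  have hpos : ∀ A ∈ F, 0 ≤ f A := by
    intro A hA
    by_contra hneg
    push Not at hneg
    have := hf _ (h.cone (c / f A) (div_nonneg_of_nonpos hc.le hneg.le) A hA)
    simp only [map_smul, smul_eq_mul] at this
    rw [div_mul_cancel₀ _ hneg.ne] at this
    exact lt_irrefl _ this
  have h1 := hpos _ (h.riesz_mem e he)
  rw [rieszMat_eq] at h1 hfx
  simp only [map_sub, map_smul, smul_eq_mul] at h1 hfx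
  have h2 := hpos _ (h.psd_mem (posSemidef_projLine e))
  have h3 := hpos _ (h.psd_mem Matrix.PosSemidef.one)
  have hp := h.one_le
  have h4 : 0 < f (projLine e) := by
    rcases h2.lt_or_eq with h4 | h4
    · exact h4
    · rw [← h4] at hfx; simp at hfx; linarith
  -- After this normalisation, p ≤ ℓ 1 expresses ℓ ≥ 0 at `rieszMat e p`, and ℓ 1 < p + δ expresses
  -- ℓ < 0 at the separated matrix `rieszMat e (p + δ)`.
  refine ⟨(f (projLine e))⁻¹ • f, fun A hA => ?_, ?_, ?_, ?_⟩
  · simpa using mul_nonneg (inv_nonneg.2 h2) (hpos A hA)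
  · simp [h4.ne']
  · simp only [FunLike.coe_smul, Pi.smul_apply, smul_eq_mul]
    rw [inv_mul_eq_div, le_div_iff₀ h4]; linarith
  · simp only [FunLike.coe_smul, Pi.smul_apply, smul_eq_mul]
    rw [inv_mul_eq_div, div_lt_iff₀ h4]; linarith

/-! ### Calculus of Hessians -/

lemma hessian_bilin (φ : Euc n → ℝ) (x v w : Euc n) :
    fderiv ℝ (fderiv ℝ φ) x v w = v.ofLp ⬝ᵥ (hessian φ x).mulVec w.ofLp := by
  have hv : ∀ v : Euc n, v = ∑ i, v i • EuclideanSpace.single i (1 : ℝ) := by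
    intro v; ext j; simp [Finset.sum_apply, Pi.single_apply]
  conv_lhs => rw [hv v, hv w]
  simp only [map_sum, map_smul, FunLike.coe_sum, Finset.sum_apply,
    FunLike.coe_smul, Pi.smul_apply, smul_eq_mul, dotProduct, Matrix.mulVec, hessian,
    Matrix.of_apply]
  simp only [Finset.mul_sum]
  rw [Finset.sum_comm]
  refine Finset.sum_congr rfl fun i _ => ?_
  refine Finset.sum_congr rfl fun j _ => ?_
  ring

lemma hessian_eq_iff {φ : Euc n → ℝ} {x : Euc n} {A : Mat n}
    (h : ∀ v w : Euc n, fderiv ℝ (fderiv ℝ φ) x v w = v.ofLp ⬝ᵥ A.mulVec w.ofLp) :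
    hessian φ x = A := by
  ext i j
  simp [hessian, h]

lemma ContDiffAt.differentiableAt_fderiv_two {φ : Euc n → ℝ} {x : Euc n}
    (h : ContDiffAt ℝ 2 φ x) : DifferentiableAt ℝ (fderiv ℝ φ) x :=
  (h.fderiv_right (m := 1) (by norm_num)).differentiableAt (by norm_num)

lemma ContDiffAt.eventually_differentiableAt_two {φ : Euc n → ℝ} {x : Euc n}
    (h : ContDiffAt ℝ 2 φ x) : ∀ᶠ y in 𝓝 x, DifferentiableAt ℝ φ y :=
  (h.eventually (by simp)).mono fun _ hy => hy.differentiableAt (by norm_num)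

lemma hessian_isSymm {φ : Euc n → ℝ} {x : Euc n} (h : ContDiffAt ℝ 2 φ x) :
    (hessian φ x).IsSymm := by
  ext i j
  simpa [hessian] using (h.isSymmSndFDerivAt (by simp)).eq _ _

lemma continuousAt_hessian {φ : Euc n → ℝ} {x : Euc n} (h : ContDiffAt ℝ 2 φ x) :
    ContinuousAt (hessian φ) x := by
  have h1 : ContinuousAt (fderiv ℝ (fderiv ℝ φ)) x :=
    ((h.fderiv_right (m := 1) (by norm_num)).fderiv_right (m := 0) (by norm_num)).continuousAt
  unfold ContinuousAt hessian
  refine tendsto_pi_nhds.2 fun i => tendsto_pi_nhds.2 fun j => ?_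
  have h2 : ContinuousAt (fun y => fderiv ℝ (fderiv ℝ φ) y (EuclideanSpace.single i 1)
      (EuclideanSpace.single j 1)) x :=
    (h1.clm_apply continuousAt_const).clm_apply continuousAt_const
  exact h2

lemma hessian_add {φ ψ : Euc n → ℝ} {x : Euc n} (h : ContDiffAt ℝ 2 φ x)
    (h' : ContDiffAt ℝ 2 ψ x) :
    hessian (fun y => φ y + ψ y) x = hessian φ x + hessian ψ x := by
  have e : fderiv ℝ (fun y => φ y + ψ y) =ᶠ[𝓝 x] fun y => fderiv ℝ φ y + fderiv ℝ ψ y := by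
    filter_upwards [h.eventually_differentiableAt_two, h'.eventually_differentiableAt_two]
      with y hy hy'
    exact fderiv_fun_add hy hy'
  ext i j
  simp only [hessian, Matrix.of_apply, Matrix.add_apply]
  rw [e.fderiv_eq, fderiv_fun_add h.differentiableAt_fderiv_two h'.differentiableAt_fderiv_two]
  rfl

lemma hessian_const_mul {φ : Euc n → ℝ} {x : Euc n} (h : ContDiffAt ℝ 2 φ x) (c : ℝ) :
    hessian (fun y => c * φ y) x = c • hessian φ x := by
  have e : fderiv ℝ (fun y => c * φ y) =ᶠ[𝓝 x] fun y => c • fderiv ℝ φ y := by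
    filter_upwards [h.eventually_differentiableAt_two] with y hy
    exact fderiv_const_mul hy c
  ext i j
  simp only [hessian, Matrix.of_apply, Matrix.smul_apply]
  rw [e.fderiv_eq, fderiv_fun_const_smul h.differentiableAt_fderiv_two]
  rfl

lemma hessian_const (c : ℝ) (x : Euc n) : hessian (fun _ => c) x = 0 := by
  ext i j
  simp [hessian]

lemma hessian_add_const (φ : Euc n → ℝ) (c : ℝ) (x : Euc n) :
    hessian (fun y => φ y + c) x = hessian φ x := by
  have e : fderiv ℝ (fun y => φ y + c) = fderiv ℝ φ := by
    ext1 y; exact fderiv_add_const c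
  unfold hessian; rw [e]

lemma hessian_neg (φ : Euc n → ℝ) (x : Euc n) :
    hessian (fun y => -φ y) x = -hessian φ x := by
  have e : fderiv ℝ (fun y => -φ y) = fun y => -fderiv ℝ φ y := by
    ext y; simp [fderiv_fun_neg]
  ext i j
  simp [hessian, e, fderiv_fun_neg]

lemma fderiv_comp_affine (φ : Euc n → ℝ) (T : Euc n ≃L[ℝ] Euc n) (b y : Euc n) :
    fderiv ℝ (fun y => φ (T y + b)) y =
      (fderiv ℝ φ (T y + b)).comp (T : Euc n →L[ℝ] Euc n) := by
  have h1 := T.comp_right_fderiv (f := fun z => φ (z + b)) (x := y)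
  have h2 : fderiv ℝ (fun z => φ (z + b)) (T y) = fderiv ℝ φ (T y + b) := fderiv_comp_add_right b
  rw [h2] at h1
  exact h1

lemma hessian_comp_affine_bilin {φ : Euc n → ℝ} (T : Euc n ≃L[ℝ] Euc n) (b x v w : Euc n)
    (h : ContDiffAt ℝ 2 φ (T x + b)) :
    fderiv ℝ (fderiv ℝ (fun y => φ (T y + b))) x v w =
      fderiv ℝ (fderiv ℝ φ) (T x + b) (T v) (T w) := by
  have e : fderiv ℝ (fun y => φ (T y + b)) = fun y =>
      (fderiv ℝ φ (T y + b)).comp (T : Euc n →L[ℝ] Euc n) := by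
    ext1 y; exact fderiv_comp_affine φ T b y
  have h1 : HasFDerivAt (fun y => fderiv ℝ φ (T y + b))
      ((fderiv ℝ (fderiv ℝ φ) (T x + b)).comp (T : Euc n →L[ℝ] Euc n)) x := by
    have h2 : HasFDerivAt (fun y => T y + b) (T : Euc n →L[ℝ] Euc n) x :=
      T.hasFDerivAt.add_const b
    exact h.differentiableAt_fderiv_two.hasFDerivAt.comp x h2
  have h3 := h1.clm_comp (hasFDerivAt_const (T : Euc n →L[ℝ] Euc n) x)
  rw [e, h3.fderiv]
  simp

lemma contDiffAt_comp_affine {φ : Euc n → ℝ} (T : Euc n ≃L[ℝ] Euc n) (b x : Euc n)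
    (h : ContDiffAt ℝ 2 φ (T x + b)) : ContDiffAt ℝ 2 (fun y => φ (T y + b)) x := by
  have h2 : ContDiffAt ℝ 2 (fun y => T y + b) x := T.contDiff.contDiffAt.add contDiffAt_const
  exact h.comp x h2

lemma hessian_smul_add {φ : Euc n → ℝ} (c : ℝ) (hc : c ≠ 0) (b x : Euc n)
    (h : ContDiffAt ℝ 2 φ (c • x + b)) :
    hessian (fun y => φ (c • y + b)) x = c ^ 2 • hessian φ (c • x + b) := by
  refine hessian_eq_iff fun v w => ?_
  have := hessian_comp_affine_bilin (φ := φ)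
    (ContinuousLinearEquiv.smulLeft (Units.mk0 c hc) : Euc n ≃L[ℝ] Euc n) b x v w h
  simp only [ContinuousLinearEquiv.smulLeft_apply_apply, Units.smul_mk0] at this
  rw [this]
  simp only [map_smul, FunLike.coe_smul, Pi.smul_apply, smul_eq_mul, hessian_bilin,
    Matrix.smul_mulVec, dotProduct_smul]
  ring

/-- The Hessian of `k (|y - c|²)`. -/
lemma hessian_normSq {k k₁ : ℝ → ℝ} {k₂ : ℝ} {c x : Euc n}
    (hk : ∀ᶠ t in 𝓝 (‖x - c‖ ^ 2), HasDerivAt k (k₁ t) t)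
    (hk₁ : HasDerivAt k₁ k₂ (‖x - c‖ ^ 2)) :
    hessian (fun y => k (‖y - c‖ ^ 2)) x =
      (2 * k₁ (‖x - c‖ ^ 2)) • (1 : Mat n) + (4 * k₂) • projLine (x - c) := by
  have hsq : ∀ y : Euc n, HasFDerivAt (fun y : Euc n => ‖y - c‖ ^ 2) (2 • innerSL ℝ (y - c)) y := by
    intro y
    have := ((hasFDerivAt_id y).sub_const c).norm_sq
    simpa using this
  have hcont : ContinuousAt (fun y : Euc n => ‖y - c‖ ^ 2) x := by fun_prop
  have e : fderiv ℝ (fun y => k (‖y - c‖ ^ 2)) =ᶠ[𝓝 x] fun y =>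
      k₁ (‖y - c‖ ^ 2) • ((2 : ℕ) • innerSL ℝ (y - c)) := by
    filter_upwards [hcont.eventually hk] with y hy
    exact (hy.comp_hasFDerivAt y (hsq y)).fderiv
  have hin : HasFDerivAt (fun y : Euc n => (2 : ℕ) • innerSL ℝ (y - c))
      ((2 : ℕ) • (innerSL ℝ : Euc n →L[ℝ] Euc n →L[ℝ] ℝ)) x := by
    have h1 : HasFDerivAt (fun y : Euc n => innerSL ℝ (y - c))
      (innerSL ℝ : Euc n →L[ℝ] Euc n →L[ℝ] ℝ) x := by
      have := (innerSL ℝ : Euc n →L[ℝ] Euc n →L[ℝ] ℝ).hasFDerivAt (x := x - c)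
      exact this.comp x (hasFDerivAt_sub_const c)
    exact h1.const_smul (2 : ℕ)
  have hd := (hk₁.comp_hasFDerivAt x (hsq x)).smul hin
  refine hessian_eq_iff fun v w => ?_
  rw [e.fderiv_eq]
  have e2 : fderiv ℝ (fun y : Euc n => k₁ (‖y - c‖ ^ 2) • ((2 : ℕ) • innerSL ℝ (y - c))) x = _ :=
    hd.fderiv
  rw [e2]
  have hi : ∀ a b : Euc n, inner ℝ a b = a.ofLp ⬝ᵥ b.ofLp := by
    intro a b; simp [PiLp.inner_apply, dotProduct, mul_comm]
  simp only [Matrix.add_mulVec, Matrix.smul_mulVec, Matrix.one_mulVec, projLine_eq_vecMulVec,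
    Matrix.vecMulVec_mulVec, dotProduct_add]
  have e3 : v.ofLp ⬝ᵥ (MulOpposite.op ((x - c).ofLp ⬝ᵥ w.ofLp) • (x - c).ofLp) =
      ((x - c).ofLp ⬝ᵥ w.ofLp) * ((x - c).ofLp ⬝ᵥ v.ofLp) := by
    rw [dotProduct_comm v.ofLp]; simp [mul_comm]
  rw [dotProduct_smul, dotProduct_smul, e3]
  have hi' : (innerSL ℝ v) w = v.ofLp ⬝ᵥ w.ofLp := hi v w
  simp [hi]
  rw [hi']
  ring

lemma contDiffAt_normSq {k : ℝ → ℝ} {c x : Euc n} (hk : ContDiffAt ℝ 2 k (‖x - c‖ ^ 2)) :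
    ContDiffAt ℝ 2 (fun y => k (‖y - c‖ ^ 2)) x := by
  have : ContDiffAt ℝ 2 (fun y : Euc n => ‖y - c‖ ^ 2) x :=
    ((contDiff_id.sub contDiff_const).norm_sq ℝ).contDiffAt
  exact hk.comp x this

lemma hessian_quadratic (ε : ℝ) (c x : Euc n) :
    hessian (fun y => ε * ‖y - c‖ ^ 2) x = (2 * ε) • (1 : Mat n) := by
  have := hessian_normSq (k := fun t => ε * t) (k₁ := fun _ => ε) (k₂ := 0) (c := c) (x := x)
    (Eventually.of_forall fun t => by simpa using (hasDerivAt_id t).const_mul ε)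
    (hasDerivAt_const _ _)
  simpa using this

lemma contDiffAt_quadratic (ε : ℝ) (c x : Euc n) :
    ContDiffAt ℝ 2 (fun y => ε * ‖y - c‖ ^ 2) x :=
  contDiffAt_normSq (k := fun t => ε * t) (by fun_prop)

/-- Second order necessary condition at a local minimum. -/
lemma posSemidef_hessian_of_isLocalMin {φ : Euc n → ℝ} {x : Euc n} (h : ContDiffAt ℝ 2 φ x)
    (hmin : IsLocalMin φ x) : (hessian φ x).PosSemidef := by
  refine Matrix.PosSemidef.of_dotProduct_mulVec_nonneg ?_ ?_
  · have := hessian_isSymm h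
    exact Matrix.isHermitian_iff_isSymm.2 this
  intro v'
  obtain ⟨v, rfl⟩ : ∃ v : Euc n, v.ofLp = v' := ⟨WithLp.toLp 2 v', rfl⟩
  simp only [star_trivial]
  rw [← hessian_bilin]
  set q := fderiv ℝ (fderiv ℝ φ) x v v with hq
  by_contra hneg
  push Not at hneg
  let γ : ℝ → Euc n := fun t => x + t • v
  have hγ : ∀ t, HasDerivAt γ v t := fun t => by
    have := ((hasDerivAt_id t).smul_const v).const_add x
    rwa [one_smul] at this
  have hγ0 : γ 0 = x := by simp [γ]
  have hγc : Tendsto γ (𝓝 0) (𝓝 x) := by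
    have := (hγ 0).continuousAt.tendsto
    rwa [hγ0] at this
  -- If q < 0 then f''(0) = q/2 - q > 0, so f has a local minimum at 0. This says φ(γ t) - φ(x) ≤ q
  -- t²/4, which is negative for t ≠ 0 and contradicts the minimality of φ at x.
  let f : ℝ → ℝ := fun t => (q / 4) * t ^ 2 - φ (γ t)
  have hfd : ∀ᶠ t in 𝓝 (0 : ℝ), HasDerivAt f (q / 2 * t - fderiv ℝ φ (γ t) v) t := by
    filter_upwards [hγc.eventually h.eventually_differentiableAt_two] with t ht
    have h1 : HasDerivAt (fun t : ℝ => (q / 4) * t ^ 2) (q / 2 * t) t := by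
      exact ((hasDerivAt_pow 2 t).const_mul (q / 4)).congr_deriv (by push_cast; ring)
    exact h1.sub (ht.hasFDerivAt.comp_hasDerivAt t (hγ t))
  have hf0 : deriv f 0 = 0 := by
    rw [hfd.self_of_nhds.deriv, hγ0, hmin.fderiv_eq_zero]; simp
  have hf2 : deriv (deriv f) 0 = - q / 2 := by
    have e : deriv f =ᶠ[𝓝 0] fun t => q / 2 * t - fderiv ℝ φ (γ t) v :=
      hfd.mono fun t ht => ht.deriv
    rw [e.deriv_eq]
    have h1 : HasDerivAt (fun t : ℝ => q / 2 * t) (q / 2) 0 := by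
      simpa using (hasDerivAt_id (0 : ℝ)).const_mul (q / 2)
    have h2 : HasDerivAt (fun t => fderiv ℝ φ (γ t) v) q 0 := by
      have h3 : HasFDerivAt (fderiv ℝ φ) (fderiv ℝ (fderiv ℝ φ) x) (γ 0) := by
        rw [hγ0]; exact h.differentiableAt_fderiv_two.hasFDerivAt
      have h4 := h3.comp_hasDerivAt (0 : ℝ) (hγ 0)
      have := h4.clm_apply (hasDerivAt_const (0 : ℝ) v)
      simpa [hq] using this
    exact (h1.sub h2).deriv.trans (by ring)
  have hloc := isLocalMin_of_deriv_deriv_pos (f := f) (x₀ := 0) (by rw [hf2]; linarith) hf0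
    hfd.self_of_nhds.continuousAt
  have hm2 : ∀ᶠ t in 𝓝 (0 : ℝ), φ x ≤ φ (γ t) := hγc.eventually hmin
  have hev : ∀ᶠ t in 𝓝 (0 : ℝ), t = 0 := by
    filter_upwards [hloc, hm2] with t h1 h2
    simp only [f, hγ0] at h1
    by_contra ht
    have : 0 < t ^ 2 := by positivity
    nlinarith
  obtain ⟨ε, hε, hb⟩ := Metric.eventually_nhds_iff.1 hev
  have := hb (y := ε / 2) (by simp [abs_of_pos hε]; linarith)
  linarith

/-! ### Operations on subharmonic functions -/

lemma IsSubharmonicOn.mono {X Y : Set (Euc n)} {u : Euc n → EReal} (h : IsSubharmonicOn F X u)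
    (hY : Y ⊆ X) : IsSubharmonicOn F Y u :=
  ⟨h.usc.mono hY, fun x hx => h.ne_top x (hY hx), fun x hx => h.viscosity x (hY hx)⟩

lemma IsSubharmonicOn.mono_set {F' : Set (Mat n)} {X : Set (Euc n)} {u : Euc n → EReal}
    (h : IsSubharmonicOn F X u) (hF : F ⊆ F') : IsSubharmonicOn F' X u :=
  ⟨h.usc, h.ne_top, fun x hx φ h1 h2 h3 => hF (h.viscosity x hx φ h1 h2 h3)⟩

lemma IsSubharmonicOn.sup {X : Set (Euc n)} {u v : Euc n → EReal}
    (hu : IsSubharmonicOn F X u) (hv : IsSubharmonicOn F X v) :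
    IsSubharmonicOn F X (fun x => max (u x) (v x)) := by
  refine ⟨hu.usc.sup hv.usc, fun x hx => ?_, fun x hx φ h1 h2 h3 => ?_⟩
  · rcases max_choice (u x) (v x) with h | h <;> rw [h]
    exacts [hu.ne_top x hx, hv.ne_top x hx]
  · rcases max_choice (u x) (v x) with h | h
    · exact hu.viscosity x hx φ h1 (h ▸ h2) (h3.mono fun y hy => (le_max_left _ _).trans hy)
    · exact hv.viscosity x hx φ h1 (h ▸ h2) (h3.mono fun y hy => (le_max_right _ _).trans hy)

/-- Subharmonicity is a local property. -/
lemma IsSubharmonicOn.of_locally {X : Set (Euc n)} {u : Euc n → EReal}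
    (h : ∀ x ∈ X, ∃ w : Euc n → EReal, ∃ V ∈ 𝓝 x, IsSubharmonicOn F V w ∧ u =ᶠ[𝓝 x] w) :
    IsSubharmonicOn F X u := by
  refine ⟨fun x hx => ?_, fun x hx => ?_, fun x hx φ h1 h2 h3 => ?_⟩ <;>
    obtain ⟨w, V, hV, hw, huw⟩ := h x hx
  · have h1 : UpperSemicontinuousAt w x := by
      have := hw.usc x (mem_of_mem_nhds hV)
      intro y hy
      have := this y hy
      rwa [nhdsWithin_eq_nhds.2 hV] at this
    refine UpperSemicontinuousAt.upperSemicontinuousWithinAt _ ?_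
    intro y hy
    rw [huw.self_of_nhds] at hy
    filter_upwards [h1 y hy, huw] with z hz hz'
    rwa [hz']
  · rw [huw.self_of_nhds]; exact hw.ne_top x (mem_of_mem_nhds hV)
  · refine hw.viscosity x (mem_of_mem_nhds hV) φ h1 (huw.self_of_nhds ▸ h2) ?_
    filter_upwards [h3, huw] with z hz hz'
    rwa [← hz']

/-- A test function for the composite becomes one for u after composition with the inverse affine
map; `hT` is the invariance of F under the induced action on Hessians. -/
lemma IsSubharmonicOn.comp_affine {X : Set (Euc n)} {u : Euc n → EReal}
    (hu : IsSubharmonicOn F X u) (T : Euc n ≃L[ℝ] Euc n) (b : Euc n)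
    (hT : ∀ (ψ : Euc n → ℝ) (x : Euc n), ContDiffAt ℝ 2 ψ (T x + b) →
      hessian ψ (T x + b) ∈ F → hessian (fun y => ψ (T y + b)) x ∈ F) :
    IsSubharmonicOn F ((fun y => T y + b) ⁻¹' X) (fun y => u (T y + b)) := by
  have hc : Continuous fun y => T y + b := by fun_prop
  refine ⟨?_, fun x hx => hu.ne_top _ hx, fun x hx φ h1 h2 h3 => ?_⟩
  · intro x hx y hy
    have := hu.usc _ hx y hy
    exact (hc.continuousWithinAt.tendsto_nhdsWithin (fun z hz => hz)).eventually this
  · have e : ∀ y, T.symm (T y + b) + -T.symm b = y := fun y => by simp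
    have e' : ∀ z, T (T.symm z + -T.symm b) + b = z := fun y => by simp
    have hψ : ContDiffAt ℝ 2 (fun z => φ (T.symm z + -T.symm b)) (T x + b) :=
      contDiffAt_comp_affine T.symm _ _ (by rwa [e])
    have := hT (fun z => φ (T.symm z + -T.symm b)) x hψ (hu.viscosity _ hx _ hψ (by simpa [e] using h2) ?_)
    · simpa [e] using this
    · have hc' : ContinuousAt (fun z => T.symm z + -T.symm b) (T x + b) := by fun_prop
      have h4 := hc'.tendsto
      rw [e] at h4
      filter_upwards [h4.eventually h3] with z hz
      rwa [e'] at hz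

lemma IsSubharmonicOn.comp_smul_add {X : Set (Euc n)} {u : Euc n → EReal} (hF : IsConeSet F)
    (hu : IsSubharmonicOn F X u) {c : ℝ} (hc : c ≠ 0) (b : Euc n) :
    IsSubharmonicOn F ((fun y => c • y + b) ⁻¹' X) (fun y => u (c • y + b)) := by
  refine hu.comp_affine (ContinuousLinearEquiv.smulLeft (Units.mk0 c hc) : Euc n ≃L[ℝ] Euc n) b ?_
  intro ψ x h1 h2
  have := hessian_smul_add c hc b x h1
  change hessian (fun y => ψ (c • y + b)) x ∈ F
  rw [this]
  exact hF _ (by positivity) _ h2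

/-- The linear map of a matrix on Euclidean space. -/
noncomputable abbrev rot (g : Mat n) : Euc n →L[ℝ] Euc n :=
  Matrix.toEuclideanCLM (n := Fin n) (𝕜 := ℝ) g

lemma rot_apply (g : Mat n) (x : Euc n) : (rot g x).ofLp = g.mulVec x.ofLp := by
  simp [rot, Matrix.ofLp_toEuclideanCLM]

lemma rot_mul (g h : Mat n) (x : Euc n) : rot (g * h) x = rot g (rot h x) := by
  simp [rot]

lemma rot_one (x : Euc n) : rot (1 : Mat n) x = x := by
  simp [rot]

/-- The linear equivalence of an orthogonal matrix. -/
noncomputable def rotEquiv {g : Mat n} (hg : g ∈ Matrix.orthogonalGroup (Fin n) ℝ) :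
    Euc n ≃L[ℝ] Euc n :=
  ContinuousLinearEquiv.equivOfInverse (rot g) (rot g.transpose)
    (fun x => by rw [← rot_mul, orthogonal_transpose_mul hg, rot_one])
    (fun x => by rw [← rot_mul, orthogonal_mul_transpose hg, rot_one])

lemma rotEquiv_apply {g : Mat n} (hg : g ∈ Matrix.orthogonalGroup (Fin n) ℝ) (x : Euc n) :
    rotEquiv hg x = rot g x := rfl

lemma norm_rot {g : Mat n} (hg : g ∈ Matrix.orthogonalGroup (Fin n) ℝ) (x : Euc n) :
    ‖rot g x‖ = ‖x‖ := by
  have : ‖rot g x‖ ^ 2 = ‖x‖ ^ 2 := by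
    rw [EuclideanSpace.real_norm_sq_eq, EuclideanSpace.real_norm_sq_eq]
    have h : ∀ y : Euc n, ∑ i, y i ^ 2 = y.ofLp ⬝ᵥ y.ofLp := fun y => by simp [dotProduct, sq]
    rw [h, h, rot_apply, Matrix.dotProduct_mulVec, Matrix.vecMul_mulVec,
      orthogonal_transpose_mul hg, Matrix.vecMul_one]
  exact (pow_left_inj₀ (norm_nonneg _) (norm_nonneg _) two_ne_zero).1 this

lemma IsSubharmonicOn.comp_rot_add {X : Set (Euc n)} {u : Euc n → EReal}
    (hu : IsSubharmonicOn F X u) {g : Mat n} (hg : g ∈ stabSet F) (b : Euc n) :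
    IsSubharmonicOn F ((fun y => rot g y + b) ⁻¹' X) (fun y => u (rot g y + b)) := by
  have hgo : g ∈ Matrix.orthogonalGroup (Fin n) ℝ := hg.1
  refine hu.comp_affine (rotEquiv hgo) b ?_
  intro ψ x h1 h2
  have : hessian (fun y => ψ (rotEquiv hgo y + b)) x =
      g.transpose * hessian ψ (rotEquiv hgo x + b) * g := by
    refine hessian_eq_iff fun v w => ?_
    rw [hessian_comp_affine_bilin _ _ _ _ _ h1, hessian_bilin, rotEquiv_apply hgo v,
      rotEquiv_apply hgo w, rot_apply, rot_apply, ← Matrix.mulVec_mulVec, ← Matrix.mulVec_mulVec,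
      Matrix.dotProduct_mulVec v.ofLp, Matrix.vecMul_transpose]
  rw [this]
  exact (hg.2 _ h2).2

lemma EReal.mul_add_le_iff {a b : ℝ} (ha : 0 < a) (x : EReal) (y : ℝ) :
    (a : EReal) * x + b ≤ y ↔ x ≤ ((y - b) / a : ℝ) := by
  induction x with
  | bot => simp [EReal.coe_mul_bot_of_pos ha]
  | top => simp [EReal.coe_mul_top_of_pos ha, -EReal.coe_sub]
  | coe x =>
    norm_cast
    rw [le_div_iff₀ ha]
    constructor <;> intro h <;> linarith

lemma IsSubharmonicOn.mul_add_const {X : Set (Euc n)} {u : Euc n → EReal} (hF : IsConeSet F)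
    (hu : IsSubharmonicOn F X u) {a : ℝ} (ha : 0 < a) (b : ℝ) :
    IsSubharmonicOn F X (fun y => (a : EReal) * u y + b) := by
  refine ⟨?_, fun x hx => ?_, fun x hx φ h1 h2 h3 => ?_⟩
  · intro x hx
    have hm : Monotone fun t : EReal => (a : EReal) * t + b := fun s t hst => by
      exact add_le_add_left (mul_le_mul_of_nonneg_left hst (EReal.coe_nonneg.2 ha.le)) _
    have hc : Continuous fun t : EReal => (a : EReal) * t + b := by
      have h1 : Continuous fun t : EReal => (a : EReal) * t :=
        continuous_iff_continuousAt.2 fun t => EReal.Tendsto.const_mul tendsto_id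
          (Or.inl (EReal.coe_ne_bot a)) (Or.inl (EReal.coe_ne_top a))
      rw [continuous_iff_continuousAt]
      intro t
      have h2 : ContinuousAt (fun q : EReal × EReal => q.1 + q.2) ((a : EReal) * t, (b : EReal)) :=
        EReal.continuousAt_add (by simp) (by simp)
      exact h2.comp (f := fun t : EReal => ((a : EReal) * t, (b : EReal)))
        (h1.continuousAt.prodMk continuousAt_const)
    exact hc.continuousAt.comp_upperSemicontinuousWithinAt (hu.usc x hx) hm
  · have := hu.ne_top x hx
    induction h : u x with
    | bot => simp [EReal.coe_mul_bot_of_pos ha]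
    | top => exact absurd h this
    | coe t => norm_cast; exact EReal.coe_ne_top _
  · have h4 : ContDiffAt ℝ 2 (fun y => a⁻¹ * (φ y + -b)) x :=
      contDiffAt_const.mul (h1.add contDiffAt_const)
    have e : ∀ y, a⁻¹ * (φ y + -b) = (φ y - b) / a := fun y => by ring
    have h5 := hu.viscosity x hx (fun y => a⁻¹ * (φ y + -b)) h4 ?_ ?_
    · rw [hessian_const_mul (h1.add contDiffAt_const), hessian_add_const] at h5
      have := hF a ha.le _ h5
      rwa [smul_smul, mul_inv_cancel₀ ha.ne', one_smul] at this
    · induction h : u x with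
      | bot => rw [h] at h2; simp [EReal.coe_mul_bot_of_pos ha] at h2
      | top => exact absurd h (hu.ne_top x hx)
      | coe t =>
        rw [h] at h2
        norm_cast at h2 ⊢
        rw [← h2]; field_simp; ring
    · filter_upwards [h3] with y hy
      rw [e]
      exact (EReal.mul_add_le_iff ha _ _).1 hy

/-- A `C²` function with Hessian in `F` is subharmonic. -/
lemma isSubharmonicOn_of_hessian_mem (hF : IsSubequation F) {X : Set (Euc n)} {f : Euc n → ℝ}
    (hf : ∀ x ∈ X, ContDiffAt ℝ 2 f x) (hH : ∀ x ∈ X, hessian f x ∈ F) :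
    IsSubharmonicOn F X (fun x => (f x : EReal)) := by
  refine ⟨fun x hx => ?_, fun x _ => EReal.coe_ne_top _, fun x hx φ h1 h2 h3 => ?_⟩
  · have : ContinuousAt (fun x => (f x : EReal)) x :=
      continuous_coe_real_ereal.continuousAt.comp (hf x hx).continuousAt
    exact this.upperSemicontinuousAt.upperSemicontinuousWithinAt _
  · have hd : ContDiffAt ℝ 2 (fun y => -f y) x := (hf x hx).neg
    have hmin : IsLocalMin (fun y => φ y + -f y) x := by
      filter_upwards [h3] with y hy
      have h2' : f x = φ x := by exact_mod_cast h2
      have hy' : f y ≤ φ y := by exact_mod_cast hy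
      linarith
    have := posSemidef_hessian_of_isLocalMin (h1.add hd) hmin
    rw [hessian_add h1 hd, hessian_neg] at this
    simpa using hF.positivity _ (hH x hx) _ this

/-! ### Comparison principle for the linear operator ℓ(D²·) -/

/-- The half-space of symmetric matrices on which `ℓ` is nonnegative. -/
def halfSpace (ℓ : Mat n →L[ℝ] ℝ) : Set (Mat n) := {A | A.IsSymm ∧ 0 ≤ ℓ A}

lemma isSubequation_halfSpace {ℓ : Mat n →L[ℝ] ℝ} (hℓ : ∀ P : Mat n, P.PosSemidef → 0 ≤ ℓ P) :
    IsSubequation (halfSpace ℓ) := by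
  refine ⟨fun A hA => hA.1, ?_, fun A hA P hP => ⟨hA.1.add (Matrix.isHermitian_iff_isSymm.1 hP.1), ?_⟩⟩
  · have h1 : IsClosed {A : Mat n | A.transpose = A} :=
      isClosed_eq (by fun_prop) continuous_id
    exact h1.inter (isClosed_le continuous_const ℓ.continuous)
  · rw [map_add]; exact add_nonneg hA.2 (hℓ P hP)

lemma isConeSet_halfSpace (ℓ : Mat n →L[ℝ] ℝ) : IsConeSet (halfSpace ℓ) :=
  fun t ht A hA => ⟨hA.1.smul t, by simpa using mul_nonneg ht hA.2⟩

/-- On a compact set, a translate of `ψ` touches an upper semicontinuous function from above. -/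
lemma exists_touching {C : Set (Euc n)} (hC : IsCompact C) {u : Euc n → EReal}
    (husc : UpperSemicontinuousOn u C) (hne : ∀ x ∈ C, u x ≠ ⊤) {ψ : Euc n → ℝ}
    (hψ : ContinuousOn ψ C) {x₁ : Euc n} (hx₁ : x₁ ∈ C) (hbot : u x₁ ≠ ⊥) :
    ∃ y ∈ C, ∃ t : ℝ, u y = t ∧ ∀ z ∈ C, u z ≤ ((ψ z + (t - ψ y) : ℝ) : EReal) := by
  -- The contact point is a maximum point of u - ψ; finiteness of u there follows from comparison
  -- with x₁.
  have husc' : UpperSemicontinuousOn (fun y => u y + ((-ψ y : ℝ) : EReal)) C := by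
    have h2 : UpperSemicontinuousOn (fun y => ((-ψ y : ℝ) : EReal)) C :=
      (continuous_coe_real_ereal.comp_continuousOn hψ.neg).upperSemicontinuousOn
    exact husc.add' h2 fun y hy => EReal.continuousAt_add (by simp) (by simp)
  obtain ⟨y, hy, hmax⟩ := husc'.exists_isMaxOn ⟨x₁, hx₁⟩ hC
  obtain ⟨t, ht⟩ : ∃ t : ℝ, u y = t := by
    induction huy : u y with
    | bot =>
      have := hmax hx₁
      simp only [huy, EReal.bot_add, Set.mem_ofPred_eq, le_bot_iff, EReal.add_eq_bot_iff] at this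
      rcases this with h | h
      · exact absurd h hbot
      · exact absurd h (EReal.coe_ne_bot _)
    | top => exact absurd huy (hne y hy)
    | coe t => exact ⟨t, rfl⟩
  refine ⟨y, hy, t, ht, fun z hz => ?_⟩
  have := hmax hz
  simp only [Set.mem_ofPred_eq, ht] at this
  induction huz : u z with
  | bot => simp
  | top => exact absurd huz (hne z hz)
  | coe s => rw [huz] at this; norm_cast at this ⊢; linarith

/-- Comparison principle on the unit ball for the operator `φ ↦ ℓ (D²φ)`. -/
lemma comparison_unitBall {ℓ : Mat n →L[ℝ] ℝ} (h1 : 0 < ℓ 1) {X : Set (Euc n)}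
    (hX : Metric.closedBall 0 1 ⊆ X) {u : Euc n → EReal}
    (hu : IsSubharmonicOn (halfSpace ℓ) X u) {h : Euc n → ℝ} (hh : ContDiff ℝ 2 h)
    (hℓ : ∀ x ∈ Metric.ball (0 : Euc n) 1, ℓ (hessian h x) ≤ 0)
    (hs : ∀ x ∈ Metric.sphere (0 : Euc n) 1, u x ≤ h x) :
    ∀ x ∈ Metric.closedBall (0 : Euc n) 1, u x ≤ h x := by
  suffices key : ∀ ε > 0, ∀ x ∈ Metric.closedBall (0 : Euc n) 1, u x ≤ ((h x + ε : ℝ) : EReal) by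
    intro x hx
    refine EReal.le_of_forall_lt_iff_le.1 fun z hz => ?_
    have hz' : h x < z := by exact_mod_cast hz
    simpa using key (z - h x) (by linarith) x hx
  intro ε hε x₁ hx₁
  by_contra hlt
  push Not at hlt
  -- the test function `h + ε - ε |x|²`
  let ψ : Euc n → ℝ := fun y => h y + ((-ε) * ‖y - 0‖ ^ 2 + ε)
  have hψ2 : ContDiff ℝ 2 ψ :=
    hh.add (((contDiff_const.mul ((contDiff_id.sub contDiff_const).norm_sq ℝ))).add contDiff_const)
  have hψ1 : ψ x₁ ≤ h x₁ + ε := by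
    simp only [ψ]; nlinarith [sq_nonneg ‖x₁ - 0‖]
  obtain ⟨y, hy, t, ht, hmax⟩ := exists_touching (isCompact_closedBall (0 : Euc n) 1)
    (hu.usc.mono hX) (fun x hx => hu.ne_top x (hX hx)) hψ2.continuous.continuousOn hx₁
    (ne_bot_of_gt hlt)
  have hpos' : 0 < t - ψ y := by
    have := hlt.trans_le (hmax x₁ hx₁)
    have := EReal.coe_lt_coe_iff.1 this
    linarith
  -- On the sphere the perturbation vanishes and ψ = h ≥ u, so contact at a positive height is
  -- interior. There ℓ(D²ψ) ≤ -2ε ℓ(1) < 0, which is incompatible with the viscosity condition.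
  have hyball : y ∈ Metric.ball (0 : Euc n) 1 := by
    rw [mem_ball_zero_iff]
    refine lt_of_le_of_ne (mem_closedBall_zero_iff.1 hy) fun hy1 => ?_
    have := hs y (mem_sphere_zero_iff_norm.2 hy1)
    rw [ht] at this
    have : t ≤ h y := by exact_mod_cast this
    simp only [ψ, sub_zero, hy1] at hpos'
    linarith
  have hH := hu.viscosity y (hX hy) (fun z => ψ z + (t - ψ y)) (hψ2.contDiffAt.add contDiffAt_const)
    (by rw [ht]; congr 1; ring) ?_
  · rw [hessian_add_const] at hH
    have e : hessian ψ y = hessian h y + (2 * -ε) • 1 := by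
      have e1 := hessian_add (φ := h) (ψ := fun y => (-ε) * ‖y - 0‖ ^ 2 + ε) (x := y) hh.contDiffAt
        ((contDiffAt_quadratic (-ε) 0 y).add contDiffAt_const)
      rw [hessian_add_const, hessian_quadratic] at e1
      exact e1
    have := hH.2
    rw [e, map_add, map_smul, smul_eq_mul] at this
    nlinarith [hℓ y hyball, mul_pos hε h1]
  · filter_upwards [Metric.isOpen_ball.mem_nhds hyball] with z hz
    exact hmax z (Metric.ball_subset_closedBall hz)

/-! ### The Dirichlet problem with polynomial data -/

/-- A polynomial as a function on Euclidean space. -/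
noncomputable def polyFun (P : MvPolynomial (Fin n) ℝ) (x : Euc n) : ℝ :=
  MvPolynomial.eval x.ofLp P

lemma hasFDerivAt_polyFun (P : MvPolynomial (Fin n) ℝ) (x : Euc n) :
    HasFDerivAt (polyFun P) (∑ i, polyFun (MvPolynomial.pderiv i P) x •
      (EuclideanSpace.proj i : Euc n →L[ℝ] ℝ)) x := by
  induction P using MvPolynomial.induction_on with
  | C a =>
    have : polyFun (MvPolynomial.C a : MvPolynomial (Fin n) ℝ) = fun _ => a := by
      ext; simp [polyFun]
    rw [this]
    simpa [polyFun] using hasFDerivAt_const a x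
  | add P Q hP hQ =>
    have h := hP.add hQ
    have e : polyFun (P + Q) = polyFun P + polyFun Q := by
      ext; simp [polyFun]
    rw [e]
    refine h.congr_fderiv ?_
    simp [polyFun, add_smul, Finset.sum_add_distrib]
  | mul_X P j hP =>
    have hX : HasFDerivAt (fun y : Euc n => y j) (EuclideanSpace.proj j : Euc n →L[ℝ] ℝ) x :=
      (EuclideanSpace.proj j : Euc n →L[ℝ] ℝ).hasFDerivAt
    have h := hP.mul hX
    have e : polyFun (P * MvPolynomial.X j) = fun y => polyFun P y * y j := by
      ext; simp [polyFun]
    rw [e]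
    refine h.congr_fderiv ?_
    ext v
    simp only [polyFun, MvPolynomial.pderiv_mul, map_add, map_mul, MvPolynomial.eval_X, add_smul,
      Finset.sum_add_distrib, FunLike.coe_add, FunLike.coe_smul, FunLike.coe_sum, Pi.add_apply,
      Pi.smul_apply, Finset.sum_apply, MvPolynomial.pderiv_X, Finset.smul_sum, smul_eq_mul,
      PiLp.proj_apply, Pi.single_apply]
    rw [add_comm]
    congr 1
    · refine Finset.sum_congr rfl fun i _ => ?_
      ring
    · rw [Finset.sum_eq_single j]
      · simp
      · intro i _ hij; simp [Ne.symm hij]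
      · simp

lemma contDiff_polyFun (P : MvPolynomial (Fin n) ℝ) : ContDiff ℝ 2 (polyFun P) := by
  induction P using MvPolynomial.induction_on with
  | C a =>
    have : polyFun (MvPolynomial.C a : MvPolynomial (Fin n) ℝ) = fun _ => a := by
      ext; simp [polyFun]
    rw [this]; exact contDiff_const
  | add P Q hP hQ =>
    have e : polyFun (P + Q) = fun y => polyFun P y + polyFun Q y := by
      ext; simp [polyFun]
    rw [e]; exact hP.add hQ
  | mul_X P j hP =>
    have e : polyFun (P * MvPolynomial.X j) = fun y => polyFun P y * y j := by
      ext; simp [polyFun]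
    rw [e]
    exact hP.mul (EuclideanSpace.proj j : Euc n →L[ℝ] ℝ).contDiff

lemma hessian_polyFun (P : MvPolynomial (Fin n) ℝ) (x : Euc n) :
    hessian (polyFun P) x =
      Matrix.of fun i j => polyFun (MvPolynomial.pderiv i (MvPolynomial.pderiv j P)) x := by
  have e : fderiv ℝ (polyFun P) = fun x => ∑ i, polyFun (MvPolynomial.pderiv i P) x •
      (EuclideanSpace.proj i : Euc n →L[ℝ] ℝ) := by
    ext1 y; exact (hasFDerivAt_polyFun P y).fderiv
  have h : HasFDerivAt (fun x => ∑ i, polyFun (MvPolynomial.pderiv i P) x •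
      (EuclideanSpace.proj i : Euc n →L[ℝ] ℝ))
      (∑ i, (∑ j, polyFun (MvPolynomial.pderiv j (MvPolynomial.pderiv i P)) x •
      (EuclideanSpace.proj j : Euc n →L[ℝ] ℝ)).smulRight
        (EuclideanSpace.proj i : Euc n →L[ℝ] ℝ)) x := by
    refine HasFDerivAt.fun_sum fun i _ => ?_
    exact (hasFDerivAt_polyFun (MvPolynomial.pderiv i P) x).smul_const
      (EuclideanSpace.proj i : Euc n →L[ℝ] ℝ)
  ext i j
  simp only [hessian, Matrix.of_apply]
  rw [e, h.fderiv]
  simp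

/-- The operator `φ ↦ ℓ (D²φ)` on polynomials. -/
noncomputable def polyOp (ℓ : Mat n →L[ℝ] ℝ) :
    MvPolynomial (Fin n) ℝ →ₗ[ℝ] MvPolynomial (Fin n) ℝ :=
  ∑ i, ∑ j, ℓ (Matrix.single i j 1) •
    ((MvPolynomial.pderiv i).toLinearMap ∘ₗ (MvPolynomial.pderiv j).toLinearMap)

lemma map_hessian_polyFun (ℓ : Mat n →L[ℝ] ℝ) (P : MvPolynomial (Fin n) ℝ) (x : Euc n) :
    ℓ (hessian (polyFun P) x) = polyFun (polyOp ℓ P) x := by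
  rw [hessian_polyFun, Matrix.matrix_eq_sum_single (Matrix.of _)]
  simp only [map_sum, polyFun, polyOp, LinearMap.coe_sum, Finset.sum_apply, LinearMap.smul_apply,
    LinearMap.comp_apply, MvPolynomial.smul_eval]
  refine Finset.sum_congr rfl fun i _ => Finset.sum_congr rfl fun j _ => ?_
  have : (Matrix.single i j ((Matrix.of fun i j => MvPolynomial.eval x.ofLp
      (MvPolynomial.pderiv i (MvPolynomial.pderiv j P))) i j) : Mat n) =
      MvPolynomial.eval x.ofLp (MvPolynomial.pderiv i (MvPolynomial.pderiv j P)) •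
        Matrix.single i j (1 : ℝ) := by
    rw [Matrix.smul_single]; simp
  rw [this, map_smul, smul_eq_mul, mul_comm]
  rfl

lemma totalDegree_pderiv_le (i : Fin n) (P : MvPolynomial (Fin n) ℝ) :
    (MvPolynomial.pderiv i P).totalDegree ≤ P.totalDegree - 1 := by
  refine Finset.sup_le fun m hm => ?_
  have h1 : m + Finsupp.single i 1 ∈ P.support := by
    rw [MvPolynomial.mem_support_iff, MvPolynomial.coeff_pderiv] at hm
    rw [MvPolynomial.mem_support_iff]
    exact left_ne_zero_of_mul hm
  have h2 := MvPolynomial.le_totalDegree h1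
  rw [Finsupp.sum_add_index' (by simp) (by simp)] at h2
  simp at h2
  omega

lemma totalDegree_polyOp_le (ℓ : Mat n →L[ℝ] ℝ) (P : MvPolynomial (Fin n) ℝ) :
    (polyOp ℓ P).totalDegree ≤ P.totalDegree - 2 := by
  simp only [polyOp, LinearMap.coe_sum, Finset.sum_apply, LinearMap.smul_apply]
  refine MvPolynomial.totalDegree_finsetSum_le fun i _ =>
    MvPolynomial.totalDegree_finsetSum_le fun j _ => (MvPolynomial.totalDegree_smul_le _ _).trans ?_
  have h1 := totalDegree_pderiv_le i (MvPolynomial.pderiv j P)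
  have h2 := totalDegree_pderiv_le j P
  change (MvPolynomial.pderiv i (MvPolynomial.pderiv j P)).totalDegree ≤ _
  omega

/-- The polynomial `1 - |x|²`. -/
noncomputable def ballPoly (n : ℕ) : MvPolynomial (Fin n) ℝ :=
  1 - ∑ i, MvPolynomial.X i ^ 2

lemma polyFun_ballPoly (x : Euc n) : polyFun (ballPoly n) x = 1 - ‖x‖ ^ 2 := by
  simp [polyFun, ballPoly, EuclideanSpace.real_norm_sq_eq]

lemma totalDegree_ballPoly_le : (ballPoly n).totalDegree ≤ 2 := by
  refine (MvPolynomial.totalDegree_sub _ _).trans (max_le (by simp) ?_)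
  refine MvPolynomial.totalDegree_finsetSum_le fun i _ => ?_
  refine (MvPolynomial.totalDegree_pow _ _).trans (by simp)

/-- Maximum principle for polynomial solutions. -/
lemma polyFun_le_of_sphere {ℓ : Mat n →L[ℝ] ℝ} (hℓ : ∀ P : Mat n, P.PosSemidef → 0 ≤ ℓ P)
    (h1 : 0 < ℓ 1) {H : MvPolynomial (Fin n) ℝ} (hH : polyOp ℓ H = 0) {c : ℝ}
    (hs : ∀ x ∈ Metric.sphere (0 : Euc n) 1, polyFun H x ≤ c) :
    ∀ x ∈ Metric.closedBall (0 : Euc n) 1, polyFun H x ≤ c := by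
  intro x hx
  have hsub : IsSubharmonicOn (halfSpace ℓ) univ (fun x => (polyFun H x : EReal)) := by
    refine isSubharmonicOn_of_hessian_mem (isSubequation_halfSpace hℓ)
      (fun x _ => (contDiff_polyFun H).contDiffAt) fun x _ =>
        ⟨hessian_isSymm (contDiff_polyFun H).contDiffAt, ?_⟩
    rw [map_hessian_polyFun, hH]; simp [polyFun]
  have := comparison_unitBall h1 (subset_univ _) hsub (h := fun _ => c) contDiff_const
    (fun x _ => by rw [hessian_const]; simp) (fun x hx => by exact_mod_cast hs x hx) x hx
  exact_mod_cast this

lemma polyFun_ge_of_sphere {ℓ : Mat n →L[ℝ] ℝ} (hℓ : ∀ P : Mat n, P.PosSemidef → 0 ≤ ℓ P)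
    (h1 : 0 < ℓ 1) {H : MvPolynomial (Fin n) ℝ} (hH : polyOp ℓ H = 0) {c : ℝ}
    (hs : ∀ x ∈ Metric.sphere (0 : Euc n) 1, c ≤ polyFun H x) :
    ∀ x ∈ Metric.closedBall (0 : Euc n) 1, c ≤ polyFun H x := by
  intro x hx
  have e : ∀ y : Euc n, polyFun (-H) y = - polyFun H y := fun y => by simp [polyFun]
  have := polyFun_le_of_sphere hℓ h1 (H := -H) (by simp [hH]) (c := -c)
    (fun y hy => by rw [e]; linarith [hs y hy]) x hx
  rw [e] at this; linarith

/-- The ball contains the box (0, 1/(n+1))^n, a product of infinite sets, and a polynomial vanishing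
on such a product is zero. -/
lemma eq_zero_of_polyFun_ball {P : MvPolynomial (Fin n) ℝ}
    (h : ∀ x ∈ Metric.ball (0 : Euc n) 1, polyFun P x = 0) : P = 0 := by
  refine MvPolynomial.funext_set (fun _ => Ioo (0 : ℝ) (1 / (n + 1)))
    (fun _ => Ioo_infinite (by positivity)) fun x hx => ?_
  have hx' : ∀ i, x i ∈ Ioo (0 : ℝ) (1 / (n + 1)) := fun i => hx i (mem_univ i)
  rw [map_zero]
  refine h (WithLp.toLp 2 x) ?_
  rw [mem_ball_zero_iff]
  have : ‖(WithLp.toLp 2 x : Euc n)‖ ^ 2 < 1 := by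
    rw [EuclideanSpace.real_norm_sq_eq]
    calc ∑ i, (x i) ^ 2 ≤ ∑ _i : Fin n, (1 / ((n : ℝ) + 1)) := by
          refine Finset.sum_le_sum fun i _ => ?_
          have h1 := (hx' i).1
          have h2 := (hx' i).2
          have h3 : 1 / ((n : ℝ) + 1) ≤ 1 := by
            rw [div_le_one (by positivity)]; linarith [(Nat.cast_nonneg n : (0 : ℝ) ≤ n)]
          nlinarith
      _ = n / ((n : ℝ) + 1) := by simp; ring
      _ < 1 := by rw [div_lt_one (by positivity)]; linarith
  nlinarith [norm_nonneg (WithLp.toLp 2 x : Euc n)]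

/-- The Dirichlet problem on the unit ball with polynomial data has a polynomial solution. -/
lemma exists_harmonic_extension {ℓ : Mat n →L[ℝ] ℝ} (hℓ : ∀ P : Mat n, P.PosSemidef → 0 ≤ ℓ P)
    (h1 : 0 < ℓ 1) (P : MvPolynomial (Fin n) ℝ) :
    ∃ H : MvPolynomial (Fin n) ℝ, polyOp ℓ H = 0 ∧
      ∀ x ∈ Metric.sphere (0 : Euc n) 1, polyFun H x = polyFun P x := by
  -- The operator lowers the degree by two, so Q ↦ L((1 - |x|²)Q) preserves the finite-dimensional
  -- space V. The maximum principle makes this map injective, hence surjective; solving L((1 -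
  -- |x|²)Q) = L P, the solution sought is P - (1 - |x|²)Q.
  let V := MvPolynomial.restrictTotalDegree (Fin n) ℝ P.totalDegree
  let T : MvPolynomial (Fin n) ℝ →ₗ[ℝ] MvPolynomial (Fin n) ℝ :=
    polyOp ℓ ∘ₗ LinearMap.mulLeft ℝ (ballPoly n)
  have hT : ∀ Q ∈ V, T Q ∈ V := by
    intro Q hQ
    rw [MvPolynomial.mem_restrictTotalDegree] at hQ ⊢
    have h2 := totalDegree_polyOp_le ℓ (ballPoly n * Q)
    have h3 := MvPolynomial.totalDegree_mul (ballPoly n) Q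
    have h4 := totalDegree_ballPoly_le (n := n)
    simp only [T, LinearMap.comp_apply, LinearMap.mulLeft_apply]
    omega
  have hmul : ∀ Q : MvPolynomial (Fin n) ℝ, ∀ x : Euc n,
      polyFun (ballPoly n * Q) x = (1 - ‖x‖ ^ 2) * polyFun Q x := by
    intro Q x
    rw [← polyFun_ballPoly]; simp [polyFun]
  have hinj : Function.Injective (T.restrict hT) := by
    rw [← LinearMap.ker_eq_bot, LinearMap.ker_eq_bot']
    rintro ⟨Q, hQ⟩ hQ0
    have hQ1 : polyOp ℓ (ballPoly n * Q) = 0 := congrArg Subtype.val hQ0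
    have hsph : ∀ x ∈ Metric.sphere (0 : Euc n) 1, polyFun (ballPoly n * Q) x = 0 := by
      intro x hx
      rw [hmul, mem_sphere_zero_iff_norm.1 hx]; simp
    ext1
    refine eq_zero_of_polyFun_ball fun x hx => ?_
    have h2 := polyFun_le_of_sphere hℓ h1 hQ1 (fun x hx => (hsph x hx).le) x
      (Metric.ball_subset_closedBall hx)
    have h3 := polyFun_ge_of_sphere hℓ h1 hQ1 (fun x hx => (hsph x hx).ge) x
      (Metric.ball_subset_closedBall hx)
    have h4 := le_antisymm h2 h3
    rw [hmul] at h4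
    rcases mul_eq_zero.1 h4 with h5 | h5
    · have := mem_ball_zero_iff.1 hx
      nlinarith [norm_nonneg x]
    · exact h5
  have hsurj := LinearMap.injective_iff_surjective.1 hinj
  have hP : polyOp ℓ P ∈ V := by
    rw [MvPolynomial.mem_restrictTotalDegree]
    have := totalDegree_polyOp_le ℓ P
    omega
  obtain ⟨⟨Q, _⟩, hQ⟩ := hsurj ⟨polyOp ℓ P, hP⟩
  have hQ' : polyOp ℓ (ballPoly n * Q) = polyOp ℓ P := congrArg Subtype.val hQ
  refine ⟨P - ballPoly n * Q, by rw [map_sub, hQ', sub_self], fun x hx => ?_⟩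
  have : polyFun (P - ballPoly n * Q) x = polyFun P x - polyFun (ballPoly n * Q) x := by
    simp [polyFun]
  rw [this, hmul, mem_sphere_zero_iff_norm.1 hx]; simp

/-! ### Harmonic measure at the centre of the unit ball -/

open scoped CompactlySupported in
/-- The measure on the unit sphere that represents the value at the centre of the solutions of
`ℓ (D²h) = 0`. -/
theorem exists_harmonicMeasure {ℓ : Mat n →L[ℝ] ℝ} (hℓ : ∀ P : Mat n, P.PosSemidef → 0 ≤ ℓ P)
    (h1 : 0 < ℓ 1) :
    ∃ μ : Measure (Euc n), IsProbabilityMeasure μ ∧ (∀ᵐ y ∂μ, y ∈ Metric.sphere (0 : Euc n) 1) ∧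
      ∀ H : MvPolynomial (Fin n) ℝ, polyOp ℓ H = 0 → ∫ y, polyFun H y ∂μ = polyFun H 0 := by
  let S := Metric.sphere (0 : Euc n) 1
  have h0 : (0 : Euc n) ∈ Metric.closedBall (0 : Euc n) 1 := by simp
  let res : LinearMap.ker (polyOp ℓ) →ₗ[ℝ] C(S, ℝ) :=
    { toFun := fun H => ⟨fun y => polyFun H.1 y,
        (contDiff_polyFun H.1).continuous.comp continuous_subtype_val⟩
      map_add' := fun H K => by ext y; simp [polyFun]
      map_smul' := fun c H => by ext y; simp [polyFun] }
  let ev : LinearMap.ker (polyOp ℓ) →ₗ[ℝ] ℝ :=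
    { toFun := fun H => polyFun H.1 0
      map_add' := fun H K => by simp [polyFun]
      map_smul' := fun c H => by simp [polyFun] }
  have hinj : Function.Injective res := by
    rw [← LinearMap.ker_eq_bot, LinearMap.ker_eq_bot']
    rintro ⟨H, hH⟩ hH0
    have hs : ∀ x ∈ S, polyFun H x = 0 := fun x hx => DFunLike.congr_fun hH0 ⟨x, hx⟩
    ext1
    refine eq_zero_of_polyFun_ball fun x hx => le_antisymm ?_ ?_
    · exact polyFun_le_of_sphere hℓ h1 hH (fun x hx => (hs x hx).le) x
        (Metric.ball_subset_closedBall hx)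
    · exact polyFun_ge_of_sphere hℓ h1 hH (fun x hx => (hs x hx).ge) x
        (Metric.ball_subset_closedBall hx)
  -- Polynomial solutions are determined by their boundary values, so evaluation at the centre is a
  -- functional on these values. It is positive by the maximum principle.
  let f : C(S, ℝ) →ₗ.[ℝ] ℝ :=
    { domain := LinearMap.range res
      toFun := ev ∘ₗ (LinearEquiv.ofInjective res hinj).symm.toLinearMap }
  have hf : ∀ H (hH : res H ∈ f.domain), f ⟨res H, hH⟩ = polyFun H.1 0 := by
    intro H hH
    have : (LinearEquiv.ofInjective res hinj).symm ⟨res H, hH⟩ = H := by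
      rw [LinearEquiv.symm_apply_eq]; rfl
    change ev ((LinearEquiv.ofInjective res hinj).symm ⟨res H, hH⟩) = _
    rw [this]; rfl
  have hnonneg : ∀ x : f.domain, (x : C(S, ℝ)) ∈ PointedCone.positive ℝ C(S, ℝ) → 0 ≤ f x := by
    rintro ⟨_, ⟨⟨H, hH⟩, rfl⟩⟩ hx
    have hx' : ∀ y : S, 0 ≤ polyFun H y := fun y => hx y
    refine le_of_le_of_eq ?_ (hf ⟨H, hH⟩ ⟨_, rfl⟩).symm
    exact polyFun_ge_of_sphere hℓ h1 hH (fun x hx => hx' ⟨x, hx⟩) 0 h0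
  -- Constants are solutions and dominate every continuous function, which is the cofinality needed
  -- to extend the functional positively to C(S).
  have hdense : ∀ y, ∃ x : f.domain, (x : C(S, ℝ)) + y ∈ PointedCone.positive ℝ C(S, ℝ) := by
    intro y
    have hk : polyOp ℓ (MvPolynomial.C ‖y‖ : MvPolynomial (Fin n) ℝ) = 0 := by
      simp [polyOp]
    refine ⟨⟨res ⟨MvPolynomial.C ‖y‖, hk⟩, ⟨_, rfl⟩⟩, fun x => ?_⟩
    have h3 : -‖y‖ ≤ y x := (abs_le.1 (y.norm_coe_le_norm x)).1
    have h4 : (0 : ℝ) ≤ polyFun (MvPolynomial.C ‖y‖ : MvPolynomial (Fin n) ℝ) x + y x := by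
      simp only [polyFun, MvPolynomial.eval_C]
      linarith
    exact h4
  obtain ⟨g, hgf, hgpos⟩ := riesz_extension (PointedCone.positive ℝ C(S, ℝ)) f hnonneg hdense
  let Λ₀ : C_c(S, ℝ) →ₗ[ℝ] ℝ :=
    { toFun := fun φ => g φ.toContinuousMap
      map_add' := fun φ ψ => g.map_add _ _
      map_smul' := fun c φ => g.map_smul _ _ }
  let Λ : C_c(S, ℝ) →ₚ[ℝ] ℝ := PositiveLinearMap.mk₀ Λ₀ fun φ hφ => hgpos _ fun x => hφ x
  let ν := RealRMK.rieszMeasure Λ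
  have hν : ∀ φ : C(S, ℝ), ∫ x, φ x ∂ν = g φ := fun φ =>
    RealRMK.integral_rieszMeasure Λ (CompactlySupportedContinuousMap.continuousMapEquiv φ)
  have hH : ∀ H : MvPolynomial (Fin n) ℝ, polyOp ℓ H = 0 →
      ∫ y : S, polyFun H y ∂ν = polyFun H 0 := by
    intro H hH
    have e1 := hν (res ⟨H, hH⟩)
    have e2 := (hgf ⟨res ⟨H, hH⟩, ⟨_, rfl⟩⟩).trans (hf ⟨H, hH⟩ ⟨_, rfl⟩)
    exact e1.trans e2
  have hprob : IsProbabilityMeasure ν := by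
    have hone := hH 1 (by simp [polyOp])
    simp only [polyFun, map_one, integral_const, smul_eq_mul, mul_one] at hone
    refine ⟨?_⟩
    rw [measureReal_def] at hone
    rw [← ENNReal.toReal_eq_one_iff]; exact hone
  refine ⟨ν.map Subtype.val, Measure.isProbabilityMeasure_map measurable_subtype_coe.aemeasurable,
    ?_, fun H hH' => ?_⟩
  · have hm : MeasurableSet {y : Euc n | y ∈ Metric.sphere (0 : Euc n) 1} :=
      Metric.isClosed_sphere.measurableSet
    exact (ae_map_iff measurable_subtype_coe.aemeasurable hm).2
      (Eventually.of_forall fun y => y.2)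
  · rw [integral_map measurable_subtype_coe.aemeasurable
      (contDiff_polyFun H).continuous.aestronglyMeasurable]
    exact hH H hH'

/-- A lower semicontinuous function is an increasing limit of bounded continuous functions. -/
lemma LowerSemicontinuous.exists_seq_continuous {α : Type*} [PseudoEMetricSpace α]
    {v : α → ℝ≥0∞} (hv : LowerSemicontinuous v) :
    ∃ f : ℕ → α → ℝ≥0∞, (∀ k, Continuous (f k)) ∧ (∀ k x, f k x ≤ k) ∧ Monotone f ∧
      ∀ x, ⨆ k, f k x = v x := by
  -- Inf-convolutions of the truncations min(v, k): each is k-Lipschitz and bounded by k.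
  let f : ℕ → α → ℝ≥0∞ := fun k x => ⨅ y, (min (v y) k + k * edist x y)
  refine ⟨f, fun k => ?_, fun k x => ?_, fun k l hkl x => ?_, fun x => le_antisymm ?_ ?_⟩
  · refine continuous_of_le_add_edist (k : ℝ≥0∞) (by simp) fun x y => ?_
    rw [ENNReal.iInf_add]
    refine le_iInf fun z => (iInf_le _ z).trans ?_
    rw [add_assoc, ← mul_add]
    gcongr
    rw [add_comm]; exact edist_triangle x y z
  · refine (iInf_le _ x).trans ?_
    simp
  · refine iInf_mono fun y => ?_
    gcongr
  · refine iSup_le fun k => (iInf_le _ x).trans ?_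
    simp
  · refine le_of_forall_lt fun t ht => ?_
    obtain ⟨t', htt', ht'⟩ := exists_between ht
    refine lt_of_lt_of_le htt' ?_
    have ht'top : t' ≠ ⊤ := ne_top_of_lt ht'
    obtain ⟨δ, hδ, hb⟩ := EMetric.mem_nhds_iff.1 (hv x t' ht')
    obtain ⟨k₁, hk₁⟩ := ENNReal.exists_nat_gt ht'top
    obtain ⟨k₂, hk₂⟩ := ENNReal.exists_nat_mul_gt hδ.ne' ht'top
    refine le_trans ?_ (le_iSup _ (max k₁ k₂))
    refine le_iInf fun y => ?_
    by_cases hy : edist x y < δ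
    · have h1 : t' < v y := hb (by rwa [Metric.mem_eball, edist_comm])
      refine le_trans (le_min h1.le ?_) le_self_add
      exact hk₁.le.trans (by exact_mod_cast le_max_left _ _)
    · push Not at hy
      refine le_trans ?_ le_add_self
      calc t' ≤ k₂ * δ := hk₂.le
        _ ≤ _ := by gcongr; exact le_max_right _ _

/-! ### Mean value inequality with respect to harmonic measure -/

/-- The nonnegative function `M - u` on `Ω`, extended by `0`. -/
noncomputable def pot (Ω : Set (Euc n)) (M : ℝ) (u : Euc n → EReal) : Euc n → ℝ≥0∞ :=
  Ω.indicator fun x => ((M : EReal) - u x).toENNReal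

lemma pot_of_mem {Ω : Set (Euc n)} {M : ℝ} {u : Euc n → EReal} {x : Euc n} (hx : x ∈ Ω) :
    pot Ω M u x = ((M : EReal) - u x).toENNReal := indicator_of_mem hx _

lemma le_pot_iff {Ω : Set (Euc n)} {M : ℝ} {u : Euc n → EReal} {x : Euc n} (hx : x ∈ Ω)
    (hM : u x ≤ M) (c : ℝ) :
    ENNReal.ofReal c ≤ pot Ω M u x ↔ u x ≤ ((M - c : ℝ) : EReal) := by
  rw [pot_of_mem hx]
  induction h : u x with
  | bot => simp
  | top => rw [h] at hM; simp at hM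
  | coe t =>
    have ht : t ≤ M := by rw [h] at hM; exact_mod_cast hM
    rw [← EReal.coe_sub, EReal.real_coe_toENNReal, ENNReal.ofReal_le_ofReal_iff (by linarith),
      EReal.coe_le_coe_iff]
    constructor <;> intro h <;> linarith

lemma pot_coe {Ω : Set (Euc n)} {M t : ℝ} {u : Euc n → EReal} {x : Euc n} (hx : x ∈ Ω)
    (h : u x = t) : pot Ω M u x = ENNReal.ofReal (M - t) := by
  rw [pot_of_mem hx, h, ← EReal.coe_sub, EReal.real_coe_toENNReal]

lemma pot_anti {Ω : Set (Euc n)} {M : ℝ} {u w : Euc n → EReal} {x : Euc n}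
    (h : x ∈ Ω → u x ≤ w x) : pot Ω M w x ≤ pot Ω M u x := by
  by_cases hx : x ∈ Ω
  · rw [pot_of_mem hx, pot_of_mem hx]
    exact EReal.toENNReal_le_toENNReal (EReal.sub_le_sub le_rfl (h hx))
  · simp [pot, hx]

lemma lowerSemicontinuous_pot {Ω : Set (Euc n)} (hΩ : IsOpen Ω) (M : ℝ) {u : Euc n → EReal}
    (hu : UpperSemicontinuousOn u Ω) : LowerSemicontinuous (pot Ω M u) := by
  intro x
  by_cases hx : x ∈ Ω
  · have hc : Continuous fun t : EReal => ((M : EReal) - t).toENNReal := by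
      refine EReal.continuous_toENNReal.comp ?_
      have h1 : Continuous fun t : EReal => (M : EReal) + -t := by
        rw [continuous_iff_continuousAt]
        intro t
        have h2 : ContinuousAt (fun q : EReal × EReal => q.1 + q.2) ((M : EReal), -t) :=
          EReal.continuousAt_add (by simp) (by simp)
        exact h2.comp (f := fun t : EReal => ((M : EReal), -t))
          (continuousAt_const.prodMk continuous_neg.continuousAt)
      exact h1
    have ha : Antitone fun t : EReal => ((M : EReal) - t).toENNReal := fun s t hst =>
      EReal.toENNReal_le_toENNReal (EReal.sub_le_sub le_rfl hst)
    have h3 := hc.continuousAt.comp_upperSemicontinuousWithinAt_antitone (hu x hx) ha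
    intro y hy
    rw [pot_of_mem hx] at hy
    have h4 := h3 y hy
    rw [nhdsWithin_eq_nhds.2 (hΩ.mem_nhds hx)] at h4
    filter_upwards [h4, hΩ.mem_nhds hx] with z hz hz'
    rwa [pot_of_mem hz']
  · intro y hy
    simp [pot, hx] at hy

lemma pot_comp (Ω : Set (Euc n)) (M : ℝ) (u : Euc n → EReal) (f : Euc n → Euc n) (y : Euc n) :
    pot Ω M u (f y) = pot (f ⁻¹' Ω) M (fun z => u (f z)) y := by
  by_cases h : f y ∈ Ω
  · rw [pot_of_mem h, pot_of_mem (Ω := f ⁻¹' Ω) h]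
  · have h' : y ∉ f ⁻¹' Ω := h
    simp [pot, h, h']

/-- A harmonic measure for the operator `φ ↦ ℓ (D²φ)` on the unit ball. -/
structure IsHarmonicMeasure (ℓ : Mat n →L[ℝ] ℝ) (μ : Measure (Euc n)) : Prop where
  nonneg : ∀ P : Mat n, P.PosSemidef → 0 ≤ ℓ P
  pos : 0 < ℓ 1
  prob : IsProbabilityMeasure μ
  sphere : ∀ᵐ y ∂μ, y ∈ Metric.sphere (0 : Euc n) 1
  repr : ∀ H : MvPolynomial (Fin n) ℝ, polyOp ℓ H = 0 → ∫ y, polyFun H y ∂μ = polyFun H 0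

/-- Polynomial functions are dense in the continuous functions on the sphere. -/
lemma exists_polyFun_near {φ : Euc n → ℝ} (hφ : Continuous φ) {ε : ℝ} (hε : 0 < ε) :
    ∃ P : MvPolynomial (Fin n) ℝ, ∀ x ∈ Metric.sphere (0 : Euc n) 1, |polyFun P x - φ x| < ε := by
  let Φ : MvPolynomial (Fin n) ℝ →ₐ[ℝ] C(Euc n, ℝ) :=
    MvPolynomial.aeval fun i => ⟨fun x => x i, by fun_prop⟩
  have hΦ : ∀ P x, Φ P x = polyFun P x := by
    intro P x
    let E : C(Euc n, ℝ) →ₐ[ℝ] ℝ := ContinuousMap.evalAlgHom ℝ ℝ x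
    have : E.comp Φ = MvPolynomial.aeval x.ofLp := by
      ext i; simp [E, Φ]
    have := AlgHom.congr_fun this P
    simpa [E, polyFun, MvPolynomial.coe_aeval_eq_eval] using this
  have hsep : Φ.range.SeparatesPoints := by
    intro x y hxy
    obtain ⟨i, hi⟩ : ∃ i, x i ≠ y i := by
      by_contra! h
      exact hxy (by ext i; exact h i)
    refine ⟨Φ (MvPolynomial.X i), ⟨Φ (MvPolynomial.X i), ⟨_, rfl⟩, rfl⟩, ?_⟩
    simpa [hΦ, polyFun] using hi
  obtain ⟨g, ⟨P, rfl⟩, hg⟩ :=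
    ContinuousMap.exists_mem_subalgebra_near_continuous_of_isCompact_of_separatesPoints hsep
      ⟨φ, hφ⟩ (isCompact_sphere (0 : Euc n) 1) hε
  refine ⟨P, fun x hx => ?_⟩
  have := hg x hx
  change ‖Φ P x - φ x‖ < ε at this
  rwa [hΦ] at this

lemma IsHarmonicMeasure.integrable_polyFun {ℓ : Mat n →L[ℝ] ℝ} {μ : Measure (Euc n)}
    (hμ : IsHarmonicMeasure ℓ μ) (P : MvPolynomial (Fin n) ℝ) : Integrable (polyFun P) μ := by
  have := hμ.prob
  obtain ⟨C, hC⟩ := (isCompact_sphere (0 : Euc n) 1).exists_bound_of_continuousOn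
    (contDiff_polyFun P).continuous.continuousOn
  exact Integrable.of_bound (contDiff_polyFun P).continuous.aestronglyMeasurable C
    (hμ.sphere.mono fun y hy => hC y hy)

/-- Super-mean value inequality for `M - u` on the unit ball. -/
lemma IsHarmonicMeasure.lintegral_pot_le_unit {ℓ : Mat n →L[ℝ] ℝ} {μ : Measure (Euc n)}
    (hμ : IsHarmonicMeasure ℓ μ) {Ω : Set (Euc n)} (hΩ : IsOpen Ω)
    (hball : Metric.closedBall 0 1 ⊆ Ω) {u : Euc n → EReal}
    (hu : IsSubharmonicOn (halfSpace ℓ) Ω u) {M : ℝ} (hM : ∀ x ∈ Ω, u x ≤ M) :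
    ∫⁻ y, pot Ω M u y ∂μ ≤ pot Ω M u 0 := by
  have := hμ.prob
  have h0 : (0 : Euc n) ∈ Ω := hball (by simp)
  -- By monotone convergence it suffices to treat bounded continuous functions below M - u.
  obtain ⟨f, hfc, hfk, hfm, hfs⟩ := (lowerSemicontinuous_pot hΩ M hu.usc).exists_seq_continuous
  simp_rw [← hfs]
  rw [lintegral_iSup (fun k => (hfc k).measurable) hfm, hfs]
  refine iSup_le fun k => ?_
  let φ : Euc n → ℝ := fun y => (f k y).toReal
  have hft : ∀ y, f k y ≠ ⊤ := fun y => ne_top_of_le_ne_top (by simp) (hfk k y)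
  have hφc : Continuous φ := by
    rw [continuous_iff_continuousAt]
    intro y
    exact (ENNReal.tendsto_toReal (hft y)).comp (hfc k).continuousAt
  have hφ0 : ∀ y, 0 ≤ φ y := fun y => ENNReal.toReal_nonneg
  have hφi : Integrable φ μ := by
    refine Integrable.of_bound hφc.aestronglyMeasurable (k : ℝ) (Eventually.of_forall fun y => ?_)
    rw [Real.norm_of_nonneg (hφ0 y)]
    simpa using ENNReal.toReal_mono (by simp) (hfk k y)
  have e : ∫⁻ y, f k y ∂μ = ENNReal.ofReal (∫ y, φ y ∂μ) := by
    rw [ofReal_integral_eq_lintegral_ofReal hφi (Eventually.of_forall hφ0)]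
    refine lintegral_congr fun y => ?_
    rw [ENNReal.ofReal_toReal (hft y)]
  rw [e, le_pot_iff h0 (hM 0 h0)]
  refine EReal.le_of_forall_lt_iff_le.1 fun z hz => ?_
  have hz' : M - ∫ y, φ y ∂μ < z := by exact_mod_cast hz
  -- The value ε is spent twice: once in M + ε - H ≥ u on the sphere, which comparison carries to
  -- the centre, and once in H(0) ≥ ∫ φ - ε.
  set ε := (z - (M - ∫ y, φ y ∂μ)) / 2 with hε
  have hεpos : 0 < ε := by rw [hε]; linarith
  obtain ⟨P, hP⟩ := exists_polyFun_near hφc hεpos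
  obtain ⟨H, hH, hHP⟩ := exists_harmonic_extension hμ.nonneg hμ.pos P
  have hHφ : ∀ x ∈ Metric.sphere (0 : Euc n) 1, |polyFun H x - φ x| < ε := fun x hx => by
    rw [hHP x hx]; exact hP x hx
  have hint : ∫ y, φ y ∂μ - ε ≤ polyFun H 0 := by
    rw [← hμ.repr H hH]
    have : ∫ y, (φ y - ε) ∂μ ≤ ∫ y, polyFun H y ∂μ := by
      refine integral_mono_ae (hφi.sub (integrable_const _)) (hμ.integrable_polyFun H) ?_
      filter_upwards [hμ.sphere] with y hy
      have := (abs_lt.1 (hHφ y hy)).1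
      linarith
    rw [integral_sub hφi (integrable_const _)] at this
    simpa using this
  have hcmp := comparison_unitBall hμ.pos hball hu
    (h := fun y => (-1) * polyFun H y + (M + ε))
    ((contDiff_const.mul (contDiff_polyFun H)).add contDiff_const)
    (fun x _ => by
      rw [hessian_add_const, hessian_const_mul (contDiff_polyFun H).contDiffAt, map_smul,
        map_hessian_polyFun, hH]
      simp [polyFun])
    (fun x hx => by
      have h1 : ENNReal.ofReal (φ x) ≤ pot Ω M u x := by
        rw [ENNReal.ofReal_toReal (hft x), ← hfs x]
        exact le_iSup (fun k => f k x) k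
      have hxΩ := hball (Metric.sphere_subset_closedBall hx)
      rw [le_pot_iff hxΩ (hM x hxΩ)] at h1
      refine h1.trans ?_
      have := (abs_lt.1 (hHφ x hx)).2
      exact EReal.coe_le_coe_iff.2 (by linarith)) 0 (by simp)
  refine hcmp.trans ?_
  exact EReal.coe_le_coe_iff.2 (by linarith)

lemma IsHarmonicMeasure.lintegral_pot_le {ℓ : Mat n →L[ℝ] ℝ} {μ : Measure (Euc n)}
    (hμ : IsHarmonicMeasure ℓ μ) {Ω : Set (Euc n)} (hΩ : IsOpen Ω) {x : Euc n} {s : ℝ} (hs : 0 < s)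
    (hball : Metric.closedBall x s ⊆ Ω) {u : Euc n → EReal}
    (hu : IsSubharmonicOn (halfSpace ℓ) Ω u) {M : ℝ} (hM : ∀ x ∈ Ω, u x ≤ M) :
    ∫⁻ y, pot Ω M u (s • y + x) ∂μ ≤ pot Ω M u x := by
  have h := hμ.lintegral_pot_le_unit (Ω := (fun y => s • y + x) ⁻¹' Ω)
    (hΩ.preimage (by fun_prop)) ?_ (hu.comp_smul_add (isConeSet_halfSpace ℓ) hs.ne' x)
    (M := M) (fun y hy => hM _ hy)
  · simp_rw [← pot_comp Ω M u (fun y => s • y + x)] at h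
    simpa using h
  · intro y hy
    refine hball ?_
    rw [mem_closedBall_zero_iff] at hy
    rw [mem_closedBall_iff_norm, add_sub_cancel_right, norm_smul, Real.norm_of_nonneg hs.le]
    nlinarith

/-! ### Averaging over the stabilizer -/

lemma isCompact_stabSet (hF : IsClosed F) : IsCompact (stabSet F) := by
  have hK : IsCompact (univ.pi fun _ : Fin n => univ.pi fun _ : Fin n => Icc (-1 : ℝ) 1) :=
    isCompact_univ_pi fun _ => isCompact_univ_pi fun _ => isCompact_Icc
  have hcl : IsClosed (stabSet F) := by
    have h1 : IsClosed {g : Mat n | g * star g = 1} := isClosed_eq (by fun_prop) continuous_const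
    have h2 : ∀ A ∈ F, IsClosed {g : Mat n | g * A * g.transpose ∈ F ∧ g.transpose * A * g ∈ F} :=
      fun A _ => (hF.preimage (f := fun g : Mat n => g * A * g.transpose) (by fun_prop)).inter
        (hF.preimage (f := fun g : Mat n => g.transpose * A * g) (by fun_prop))
    have e : stabSet F = {g : Mat n | g * star g = 1} ∩
        ⋂ A ∈ F, {g : Mat n | g * A * g.transpose ∈ F ∧ g.transpose * A * g ∈ F} := by
      ext g
      simp only [stabSet, mem_inter_iff, mem_iInter]
      exact and_congr (Matrix.mem_orthogonalGroup_iff (Fin n) ℝ) Iff.rfl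
    rw [e]
    exact h1.inter (isClosed_biInter h2)
  refine IsCompact.of_isClosed_subset (X := Mat n) hK hcl fun g hg i _ j _ => ?_
  have := entry_norm_bound_of_unitary (𝕜 := ℝ) hg.1 i j
  exact abs_le.1 this

lemma stabSet_mul {g h : Mat n} (hg : g ∈ stabSet F) (hh : h ∈ stabSet F) :
    g * h ∈ stabSet F := by
  refine ⟨mul_mem hg.1 hh.1, fun A hA => ⟨?_, ?_⟩⟩
  · have := (hg.2 _ (hh.2 A hA).1).1
    simpa [Matrix.mul_assoc] using this
  · have := (hh.2 _ (hg.2 A hA).2).2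
    simpa [Matrix.mul_assoc] using this

lemma stabSet_transpose {g : Mat n} (hg : g ∈ stabSet F) : g.transpose ∈ stabSet F := by
  refine ⟨?_, fun A hA => ⟨?_, ?_⟩⟩
  · exact Unitary.star_mem hg.1
  · simpa using (hg.2 A hA).2
  · simpa using (hg.2 A hA).1

/-- The stabilizer of `F` as a subgroup of the orthogonal group. -/
def stabGroup (F : Set (Mat n)) : Subgroup (Matrix.orthogonalGroup (Fin n) ℝ) where
  carrier := {g | (g : Mat n) ∈ stabSet F}
  mul_mem' hg hh := stabSet_mul hg hh
  one_mem' := by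
    refine ⟨one_mem _, fun A hA => ?_⟩
    simpa using hA
  inv_mem' {g} hg := by
    have e : ((g⁻¹ : Matrix.orthogonalGroup (Fin n) ℝ) : Mat n) = (g : Mat n).transpose := by
      rw [← Unitary.star_eq_inv]; rfl
    change ((g⁻¹ : Matrix.orthogonalGroup (Fin n) ℝ) : Mat n) ∈ stabSet F
    rw [e]; exact stabSet_transpose hg

lemma continuous_rot : Continuous (fun g : Mat n => rot g) := by
  have : Continuous ((Matrix.toEuclideanCLM (n := Fin n) (𝕜 := ℝ)).toAlgEquiv.toLinearMap) :=
    LinearMap.continuous_of_finiteDimensional _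
  exact this

/-- An invariant probability measure on the stabilizer of `F`, as a measure on linear maps. -/
structure IsStabMeasure (F : Set (Mat n)) (m : Measure (Euc n →L[ℝ] Euc n)) : Prop where
  prob : IsProbabilityMeasure m
  mem : ∀ᵐ T ∂m, ∃ g ∈ stabSet F, T = rot g
  inv : ∀ g ∈ stabSet F, m.map (fun T => T.comp (rot g)) = m

/-- The Haar probability measure of the compact stabilizer, pushed forward by g ↦ `rot g⁻¹`. The
inversion turns left invariance into invariance under composition on the right, which is what makes
averages constant on orbits. -/
theorem exists_isStabMeasure (hF : IsClosed F) : ∃ m, IsStabMeasure F m := by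
  let H := stabGroup F
  let ι : H → Mat n := fun g => (g.1 : Mat n)
  have hι : IsEmbedding ι := IsEmbedding.subtypeVal.comp IsEmbedding.subtypeVal
  have hcpt : CompactSpace H := by
    refine ⟨hι.isCompact_iff.2 ?_⟩
    have : ι '' univ = stabSet F := by
      rw [image_univ]
      ext g
      constructor
      · rintro ⟨h, rfl⟩; exact h.2
      · intro hg; exact ⟨⟨⟨g, hg.1⟩, hg⟩, rfl⟩
    rw [this]; exact isCompact_stabSet hF
  let _ : MeasurableSpace H := borel H
  have : BorelSpace H := ⟨rfl⟩
  let ν : Measure H := Measure.haarMeasure ⊤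
  have hν : IsProbabilityMeasure ν := ⟨by
    have := Measure.haarMeasure_self (K₀ := (⊤ : TopologicalSpace.PositiveCompacts H))
    simpa using this⟩
  have hcont : Continuous fun g : H => rot (ι g⁻¹) :=
    continuous_rot.comp (hι.continuous.comp continuous_inv)
  refine ⟨ν.map fun g => rot (ι g⁻¹), Measure.isProbabilityMeasure_map hcont.measurable.aemeasurable,
    ?_, fun g hg => ?_⟩
  · have hcl : IsClosed {T : Euc n →L[ℝ] Euc n | ∃ g ∈ stabSet F, T = rot g} := by
      have := ((isCompact_stabSet hF).image continuous_rot).isClosed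
      convert this using 1
      ext T; simp [eq_comm]
    exact (ae_map_iff hcont.measurable.aemeasurable hcl.measurableSet).2
      (Eventually.of_forall fun g => ⟨_, g⁻¹.2, rfl⟩)
  · let h : H := ⟨⟨g, hg.1⟩, hg⟩
    have hc2 : Continuous fun T : Euc n →L[ℝ] Euc n => T.comp (rot g) := by fun_prop
    rw [Measure.map_map hc2.measurable hcont.measurable]
    have e : ((fun T : Euc n →L[ℝ] Euc n => T.comp (rot g)) ∘ fun g => rot (ι g⁻¹)) =
        (fun g => rot (ι g⁻¹)) ∘ fun k : H => h⁻¹ * k := by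
      ext k x
      simp only [Function.comp_apply, mul_inv_rev, inv_inv, ContinuousLinearMap.comp_apply]
      have : ι (k⁻¹ * h) = ι k⁻¹ * g := rfl
      rw [this, rot_mul]
    rw [e, ← Measure.map_map hcont.measurable (by fun_prop), map_mul_left_eq_self]

/-- The action of linear maps on Euclidean space. -/
def act (q : Euc n × (Euc n →L[ℝ] Euc n)) : Euc n := q.2 q.1

lemma continuous_act : Continuous (act (n := n)) := by
  unfold act; fun_prop

lemma measurePreserving_rot {g : Mat n} (hg : g ∈ Matrix.orthogonalGroup (Fin n) ℝ) :
    MeasurePreserving (fun x : Euc n => rot g x) volume volume := by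
  let e : Euc n ≃ₗᵢ[ℝ] Euc n := ⟨(rotEquiv hg).toLinearEquiv, fun x => norm_rot hg x⟩
  exact e.measurePreserving

instance : SecondCountableTopology (Euc n →L[ℝ] Euc n) :=
  have : ProperSpace (Euc n →L[ℝ] Euc n) := FiniteDimensional.proper ℝ _
  inferInstance

/-- Each rotation preserves Lebesgue measure, so Fubini applies. This one fact transfers integrals,
integrability and null sets between functions and their restrictions to almost every orbit. -/
lemma IsStabMeasure.measurePreserving_act {m : Measure (Euc n →L[ℝ] Euc n)}
    (hm : IsStabMeasure F m) : MeasurePreserving (act (n := n)) (volume.prod m) volume := by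
  have := hm.prob
  refine ⟨continuous_act.measurable, ?_⟩
  ext s hs
  rw [Measure.map_apply continuous_act.measurable hs,
    Measure.prod_apply_symm (continuous_act.measurable hs)]
  have : ∀ᵐ T ∂m, volume ((fun x => (x, T)) ⁻¹' (act ⁻¹' s)) = volume s := by
    filter_upwards [hm.mem] with T hT
    obtain ⟨g, hg, rfl⟩ := hT
    exact (measurePreserving_rot hg.1).measure_preimage hs.nullMeasurableSet
  rw [lintegral_congr_ae this]; simp

/-- The average of a function over the orbits of the stabilizer. -/
noncomputable def orbitAvg (m : Measure (Euc n →L[ℝ] Euc n)) (v : Euc n → ℝ≥0∞) (x : Euc n) :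
    ℝ≥0∞ := ∫⁻ T, v (T x) ∂m

lemma IsStabMeasure.orbitAvg_rot {m : Measure (Euc n →L[ℝ] Euc n)} (hm : IsStabMeasure F m)
    {v : Euc n → ℝ≥0∞} (hv : Measurable v) {g : Mat n} (hg : g ∈ stabSet F) (x : Euc n) :
    orbitAvg m v (rot g x) = orbitAvg m v x := by
  unfold orbitAvg
  conv_rhs => rw [← hm.inv g hg]
  rw [lintegral_map (by fun_prop) (by fun_prop)]
  simp

lemma exists_stab_rot (hST : IsSTInvariant F) {x y : Euc n} (h : ‖x‖ = ‖y‖) :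
    ∃ g ∈ stabSet F, rot g x = y := by
  rcases eq_or_ne x 0 with rfl | hx
  · have : y = 0 := by rw [norm_zero] at h; exact norm_eq_zero.1 h.symm
    subst this
    exact ⟨_, (stabGroup F).one_mem, by simp⟩
  · have hx0 : ‖x‖ ≠ 0 := norm_ne_zero_iff.2 hx
    have hy0 : ‖y‖ ≠ 0 := h ▸ hx0
    obtain ⟨g, hg, hgx⟩ := hST.exists_stab (‖x‖⁻¹ • x) (‖y‖⁻¹ • y)
      (by rw [norm_smul]; simp [hx0]) (by rw [norm_smul]; simp [hy0])
    refine ⟨g, hg, ?_⟩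
    have e : rot g (‖x‖⁻¹ • x) = ‖y‖⁻¹ • y := by
      ext i; rw [rot_apply, hgx]
    rw [map_smul, h] at e
    exact smul_right_injective _ (inv_ne_zero hy0) e

lemma IsStabMeasure.orbitAvg_radial {m : Measure (Euc n →L[ℝ] Euc n)} (hm : IsStabMeasure F m)
    (hST : IsSTInvariant F) {v : Euc n → ℝ≥0∞} (hv : Measurable v) {x y : Euc n}
    (h : ‖x‖ = ‖y‖) : orbitAvg m v x = orbitAvg m v y := by
  obtain ⟨g, hg, rfl⟩ := exists_stab_rot hST h
  exact (hm.orbitAvg_rot hv hg x).symm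

lemma IsStabMeasure.lintegral_orbitAvg {m : Measure (Euc n →L[ℝ] Euc n)} (hm : IsStabMeasure F m)
    {v : Euc n → ℝ≥0∞} (hv : AEMeasurable v) : ∫⁻ x, orbitAvg m v x = ∫⁻ x, v x := by
  have := hm.prob
  have h := hm.measurePreserving_act
  have e : ∫⁻ x, v x = ∫⁻ q, v (act q) ∂(volume.prod m) := by
    conv_lhs => rw [← h.map_eq]
    exact lintegral_map' (by rwa [h.map_eq]) h.measurable.aemeasurable
  rw [e]
  exact (lintegral_prod _ (hv.comp_quasiMeasurePreserving h.quasiMeasurePreserving)).symm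

/-- Averages of bounded continuous functions are continuous by dominated convergence; the average of
v is a supremum of such averages. -/
lemma LowerSemicontinuous.orbitAvg {m : Measure (Euc n →L[ℝ] Euc n)} [IsFiniteMeasure m]
    {v : Euc n → ℝ≥0∞} (hv : LowerSemicontinuous v) : LowerSemicontinuous (orbitAvg m v) := by
  obtain ⟨f, hfc, hfk, hfm, hfs⟩ := hv.exists_seq_continuous
  have e : _root_.orbitAvg m v = fun x => ⨆ k, ∫⁻ T, f k (T x) ∂m := by
    ext x
    unfold _root_.orbitAvg
    simp_rw [← hfs]
    exact lintegral_iSup (fun k => ((hfc k).comp (by fun_prop)).measurable)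
      fun k l hkl T => hfm hkl (T x)
  rw [e]
  refine lowerSemicontinuous_iSup fun k => Continuous.lowerSemicontinuous ?_
  rw [continuous_iff_continuousAt]
  intro x
  refine tendsto_lintegral_filter_of_dominated_convergence (fun _ => (k : ℝ≥0∞))
    (Eventually.of_forall fun y => ((hfc k).comp (by fun_prop)).measurable)
    (Eventually.of_forall fun y => Eventually.of_forall fun T => hfk k _) ?_
    (Eventually.of_forall fun T => ((hfc k).comp T.continuous).continuousAt)
  simp [ENNReal.mul_eq_top]

/-! ### Mean value inequalities for F-subharmonic functions -/

lemma RieszData.exists_harmonicMeasure (h : RieszData F p) {δ : ℝ} (hδ : 0 < δ) (e : Euc n)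
    (he : ‖e‖ = 1) :
    ∃ (ℓ : Mat n →L[ℝ] ℝ) (μ : Measure (Euc n)), IsHarmonicMeasure ℓ μ ∧ F ⊆ halfSpace ℓ ∧
      ℓ (projLine e) = 1 ∧ p ≤ ℓ 1 ∧ ℓ 1 < p + δ := by
  obtain ⟨ℓ, h1, h2, h3, h4⟩ := h.exists_functional hδ e he
  have hnn : ∀ P : Mat n, P.PosSemidef → 0 ≤ ℓ P := fun P hP => h1 P (h.psd_mem hP)
  have hpos : 0 < ℓ 1 := by linarith [h.one_le]
  obtain ⟨μ, hμ1, hμ2, hμ3⟩ := _root_.exists_harmonicMeasure hnn hpos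
  exact ⟨ℓ, μ, ⟨hnn, hpos, hμ1, hμ2, hμ3⟩, fun A hA => ⟨h.sub.subset_sym hA, h1 A hA⟩, h2, h3, h4⟩

/-- The orbit averages of `M - u` satisfy the super-mean value inequality. -/
lemma lintegral_orbitAvg_pot_le {m : Measure (Euc n →L[ℝ] Euc n)} (hm : IsStabMeasure F m)
    {ℓ : Mat n →L[ℝ] ℝ} {μ : Measure (Euc n)} (hμ : IsHarmonicMeasure ℓ μ) (hFℓ : F ⊆ halfSpace ℓ)
    {Ω : Set (Euc n)} (hΩ : IsOpen Ω) {u : Euc n → EReal} (hu : IsSubharmonicOn F Ω u) {M : ℝ}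
    (hM : ∀ x ∈ Ω, u x ≤ M) {x : Euc n} {s : ℝ} (hs : 0 < s)
    (hball : ∀ g ∈ stabSet F, Metric.closedBall (rot g x) s ⊆ Ω) :
    ∫⁻ y, orbitAvg m (pot Ω M u) (s • y + x) ∂μ ≤ orbitAvg m (pot Ω M u) x := by
  have := hm.prob
  have := hμ.prob
  have hv := (lowerSemicontinuous_pot hΩ M hu.usc).measurable
  unfold orbitAvg
  -- With the integrals exchanged, the inequality is applied to each rotated function u ∘ g. It is
  -- F-subharmonic, hence subharmonic for ℓ, although ℓ need not be invariant under g.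
  rw [lintegral_lintegral_swap]
  · refine lintegral_mono_ae ?_
    filter_upwards [hm.mem] with T hT
    obtain ⟨g, hg, rfl⟩ := hT
    have hsub := hu.comp_rot_add hg 0
    simp only [add_zero] at hsub
    have hc : Continuous fun y : Euc n => rot g y := (rot g).continuous
    have := hμ.lintegral_pot_le (hΩ.preimage hc) hs (x := x) ?_ (hsub.mono_set hFℓ) (M := M)
      (fun y hy => hM _ hy)
    · simp_rw [← pot_comp Ω M u (fun y => rot g y)] at this
      exact this
    · intro y hy
      refine hball g hg ?_
      rw [mem_closedBall_iff_norm] at hy ⊢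
      rwa [← map_sub, norm_rot hg.1]
  · have hc : Continuous fun q : Euc n × (Euc n →L[ℝ] Euc n) => q.2 (s • q.1 + x) := by fun_prop
    exact (hv.comp hc.measurable).aemeasurable

/-- Super-mean value inequality over balls. -/
lemma RieszData.setLIntegral_pot_le (h : RieszData F p) {m : Measure (Euc n →L[ℝ] Euc n)}
    (hm : IsStabMeasure F m) {Ω : Set (Euc n)} (hΩ : IsOpen Ω) {u : Euc n → EReal}
    (hu : IsSubharmonicOn F Ω u) {M : ℝ} (hM : ∀ x ∈ Ω, u x ≤ M) {x : Euc n} {s : ℝ}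
    (hball : Metric.closedBall x s ⊆ Ω) :
    ∫⁻ z in Metric.closedBall x s, pot Ω M u z ≤ volume (Metric.closedBall x s) * pot Ω M u x := by
  have := hm.prob
  let Ω' : Set (Euc n) := (fun y => y + x) ⁻¹' Ω
  have hΩ' : IsOpen Ω' := hΩ.preimage (by fun_prop)
  have hu' : IsSubharmonicOn F Ω' (fun y => u (y + x)) := by
    simpa only [one_smul] using hu.comp_smul_add h.cone one_ne_zero x
  set V : Euc n → ℝ≥0∞ := pot Ω' M (fun y => u (y + x)) with hVdef
  have hV : ∀ y, pot Ω M u (y + x) = V y := fun y => pot_comp Ω M u (fun y => y + x) y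
  have hVm : Measurable V := (lowerSemicontinuous_pot hΩ' M hu'.usc).measurable
  have hball' : Metric.closedBall 0 s ⊆ Ω' := by
    intro y hy
    refine hball ?_
    rw [mem_closedBall_zero_iff] at hy
    rwa [mem_closedBall_iff_norm, add_sub_cancel_right]
  -- The average is constant on the sphere through z, so its integral against the dilated harmonic
  -- measure is that constant, whatever ℓ is. Integrating over the ball then recovers the integral
  -- of V, since averaging preserves Lebesgue integrals.
  have hrad : ∀ z ∈ Metric.closedBall (0 : Euc n) s, orbitAvg m V z ≤ V 0 := by
    intro z hz
    rcases eq_or_ne z 0 with rfl | hz0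
    · simp [orbitAvg]
    have hz0' : 0 < ‖z‖ := norm_pos_iff.2 hz0
    obtain ⟨e, he⟩ := exists_unit_vector h.pos_dim
    obtain ⟨ℓ, μ, hμ, hFℓ, -⟩ := h.exists_harmonicMeasure one_pos e he
    have := hμ.prob
    have h1 := lintegral_orbitAvg_pot_le hm hμ hFℓ hΩ' hu' (M := M) (fun y hy => hM _ hy)
      (x := 0) hz0' (fun g _ => by
        rw [map_zero]
        exact (Metric.closedBall_subset_closedBall (mem_closedBall_zero_iff.1 hz)).trans hball')
    have h2 : ∀ᵐ y ∂μ, orbitAvg m V (‖z‖ • y + 0) = orbitAvg m V z := by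
      filter_upwards [hμ.sphere] with y hy
      refine hm.orbitAvg_radial h.st hVm ?_
      rw [add_zero, norm_smul, norm_norm, mem_sphere_zero_iff_norm.1 hy, mul_one]
    rw [lintegral_congr_ae h2] at h1
    simpa [orbitAvg] using h1
  let B : Set (Euc n) := Metric.closedBall 0 s
  have hB : MeasurableSet B := Metric.isClosed_closedBall.measurableSet
  have hpre : (fun y => y + x) ⁻¹' Metric.closedBall x s = B := by
    ext y; simp [B]
  have hmp : MeasurePreserving (fun y : Euc n => y + x) volume volume :=
    measurePreserving_add_right volume x
  have e1 : ∫⁻ z in Metric.closedBall x s, pot Ω M u z = ∫⁻ z, B.indicator V z := by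
    rw [lintegral_indicator hB, ← hpre,
      ← hmp.setLIntegral_comp_preimage Metric.isClosed_closedBall.measurableSet
        (lowerSemicontinuous_pot hΩ M hu.usc).measurable]
    simp_rw [hV]
  have e2 : volume (Metric.closedBall x s) = volume B := by
    rw [← hpre, hmp.measure_preimage Metric.isClosed_closedBall.measurableSet.nullMeasurableSet]
  have e3 : pot Ω M u x = V 0 := by rw [← hV, zero_add]
  rw [e1, e2, e3, ← hm.lintegral_orbitAvg (hVm.indicator hB).aemeasurable]
  have e4 : ∀ z, orbitAvg m (B.indicator V) z ≤ B.indicator (fun _ => V 0) z := by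
    intro z
    by_cases hz : z ∈ B
    · rw [indicator_of_mem hz]
      refine le_trans (lintegral_mono fun T => ?_) (hrad z hz)
      exact indicator_le_self _ _ _
    · rw [indicator_of_notMem hz]
      refine le_of_eq ?_
      unfold orbitAvg
      rw [lintegral_eq_zero_iff' (by
        exact ((hVm.indicator hB).comp (by fun_prop)).aemeasurable)]
      filter_upwards [hm.mem] with T hT
      obtain ⟨g, hg, rfl⟩ := hT
      refine indicator_of_notMem ?_ _
      simp only [B, mem_closedBall_zero_iff] at hz ⊢
      rwa [norm_rot hg.1]
  refine (lintegral_mono e4).trans ?_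
  rw [lintegral_indicator hB, setLIntegral_const, mul_comm]

/-! ### Riesz kernels and the concavity of orbit averages -/

/-- A primitive of `t ^ (-p/2)`. -/
noncomputable def kap (p t : ℝ) : ℝ :=
  if p = 2 then Real.log t else t ^ (1 - p / 2) / (1 - p / 2)

/-- The increasing Riesz kernel, as a function of the radius. -/
noncomputable def rieszK (p r : ℝ) : ℝ := kap p (r ^ 2)

lemma hasDerivAt_kap (p : ℝ) {t : ℝ} (ht : 0 < t) : HasDerivAt (kap p) (t ^ (-(p / 2))) t := by
  unfold kap
  split_ifs with h
  · subst h
    have := Real.hasDerivAt_log ht.ne'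
    simpa [Real.rpow_neg_one] using this
  · have hne : 1 - p / 2 ≠ 0 := fun h' => h (by linarith)
    have := (Real.hasDerivAt_rpow_const (p := 1 - p / 2) (Or.inl ht.ne')).div_const (1 - p / 2)
    refine this.congr_deriv ?_
    rw [mul_div_assoc, mul_div_cancel₀ _ hne]
    congr 1; ring

lemma contDiffAt_kap (p : ℝ) {t : ℝ} (ht : 0 < t) : ContDiffAt ℝ 2 (kap p) t := by
  unfold kap
  split_ifs with h
  · exact Real.contDiffAt_log.2 ht.ne'
  · exact (Real.contDiffAt_rpow_const_of_ne ht.ne').div_const _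

lemma rieszK_strictMonoOn (p : ℝ) : StrictMonoOn (rieszK p) (Ioi 0) := by
  have h : StrictMonoOn (kap p) (Ioi 0) := by
    refine strictMonoOn_of_deriv_pos (convex_Ioi 0)
      (fun t ht => (hasDerivAt_kap p ht).continuousAt.continuousWithinAt) fun t ht => ?_
    rw [interior_Ioi] at ht
    rw [(hasDerivAt_kap p ht).deriv]
    exact Real.rpow_pos_of_pos ht _
  intro x hx y hy hxy
  have hx' : 0 < x := hx
  exact h (pow_pos hx' 2) (pow_pos (hx'.trans hxy) 2) (by gcongr)

/-- Stated for differences so as to include the logarithm. The factor r^(2-p) is inverse to the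
factor r^(p-2) of the tangential flow, which makes difference quotients against the kernel
flow-invariant. -/
lemma rieszK_scale (p : ℝ) {r s t : ℝ} (hr : 0 < r) (hs : 0 < s) (ht : 0 < t) :
    rieszK p (r * s) - rieszK p (r * t) = r ^ (2 - p) * (rieszK p s - rieszK p t) := by
  unfold rieszK kap
  split_ifs with h
  · subst h
    rw [mul_pow, mul_pow, Real.log_mul (by positivity) (by positivity),
      Real.log_mul (by positivity) (by positivity)]
    simp
  · have e : r ^ (2 - p) = (r ^ 2) ^ (1 - p / 2) := by
      rw [← Real.rpow_natCast_mul hr.le]; congr 1; push_cast; ring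
    rw [mul_pow, mul_pow, Real.mul_rpow (by positivity) (by positivity),
      Real.mul_rpow (by positivity) (by positivity), e]
    ring

lemma projLine_smul (c : ℝ) (e : Euc n) : projLine (c • e) = c ^ 2 • projLine e := by
  ext i j; simp [projLine]; ring

/-- The orbit averages of `M - u` are concave functions of the Riesz kernel. -/
theorem RieszData.orbitAvg_concave (h : RieszData F p) {m : Measure (Euc n →L[ℝ] Euc n)}
    (hm : IsStabMeasure F m) {r₁ r₂ : ℝ} (hr₁ : 0 ≤ r₁) {u : Euc n → EReal} {M : ℝ}
    (hu : IsSubharmonicOn F {x | r₁ < ‖x‖ ∧ ‖x‖ < r₂} u)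
    (hM : ∀ x ∈ {x : Euc n | r₁ < ‖x‖ ∧ ‖x‖ < r₂}, u x ≤ M) {α β : ℝ} {a b x : Euc n}
    (ha : r₁ < ‖a‖) (hax : ‖a‖ < ‖x‖) (hxb : ‖x‖ < ‖b‖) (hb : ‖b‖ < r₂)
    (hva : ENNReal.ofReal (α * rieszK p ‖a‖ + β) ≤
      orbitAvg m (pot {x | r₁ < ‖x‖ ∧ ‖x‖ < r₂} M u) a)
    (hvb : ENNReal.ofReal (α * rieszK p ‖b‖ + β) ≤
      orbitAvg m (pot {x | r₁ < ‖x‖ ∧ ‖x‖ < r₂} M u) b) :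
    ENNReal.ofReal (α * rieszK p ‖x‖ + β) ≤
      orbitAvg m (pot {x | r₁ < ‖x‖ ∧ ‖x‖ < r₂} M u) x := by
  have := hm.prob
  set Ω : Set (Euc n) := {x | r₁ < ‖x‖ ∧ ‖x‖ < r₂} with hΩdef
  have hΩ : IsOpen Ω := (isOpen_lt continuous_const continuous_norm).inter
    (isOpen_lt continuous_norm continuous_const)
  have hlsc := lowerSemicontinuous_pot hΩ M hu.usc
  set v : Euc n → ℝ≥0∞ := orbitAvg m (pot Ω M u) with hv
  have hvlsc : LowerSemicontinuous v := hlsc.orbitAvg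
  by_contra hlt
  push Not at hlt
  have hvxt : v x ≠ ⊤ := ne_top_of_lt hlt
  have hlt' : (v x).toReal < α * rieszK p ‖x‖ + β := by
    rw [← ENNReal.ofReal_toReal hvxt] at hlt
    exact (ENNReal.ofReal_lt_ofReal_iff_of_nonneg ENNReal.toReal_nonneg).1 hlt
  have ha0 : 0 < ‖a‖ := hr₁.trans_lt ha
  -- the strictly convex perturbation
  obtain ⟨ε, hε, hεx⟩ : ∃ ε > 0, (v x).toReal <
      α * rieszK p ‖x‖ + β + ε * (‖x‖ ^ 2 - ‖b‖ ^ 2) := by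
    have hc : Tendsto (fun ε : ℝ => α * rieszK p ‖x‖ + β + ε * (‖x‖ ^ 2 - ‖b‖ ^ 2)) (𝓝[>] 0)
        (𝓝 (α * rieszK p ‖x‖ + β + 0 * (‖x‖ ^ 2 - ‖b‖ ^ 2))) := by
      refine Tendsto.mono_left ?_ nhdsWithin_le_nhds
      exact Continuous.tendsto (by fun_prop) 0
    rw [zero_mul, add_zero] at hc
    obtain ⟨ε, h1, h2⟩ := ((hc.eventually (lt_mem_nhds hlt')).and self_mem_nhdsWithin).exists
    exact ⟨ε, h2, h1⟩
  let k : ℝ → ℝ := fun t => α * kap p t + ε * t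
  let ψ : Euc n → ℝ := fun z => k (‖z - 0‖ ^ 2) + (β - ε * ‖b‖ ^ 2)
  have hψ : ∀ z, ψ z = α * rieszK p ‖z‖ + β + ε * (‖z‖ ^ 2 - ‖b‖ ^ 2) := fun z => by
    simp only [ψ, k, rieszK, sub_zero]; ring
  have hkd : ∀ z : Euc n, 0 < ‖z‖ → ContDiffAt ℝ 2 (fun z => k (‖z - 0‖ ^ 2)) z := by
    intro z hz
    refine contDiffAt_normSq ?_
    have : 0 < ‖z - 0‖ ^ 2 := by rw [sub_zero]; positivity
    exact (contDiffAt_const.mul (contDiffAt_kap p this)).add (contDiffAt_const.mul contDiffAt_id)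
  have hψd : ∀ z : Euc n, 0 < ‖z‖ → ContDiffAt ℝ 2 ψ z := fun z hz =>
    (hkd z hz).add contDiffAt_const
  let C : Set (Euc n) := {z | ‖a‖ ≤ ‖z‖ ∧ ‖z‖ ≤ ‖b‖}
  have hC : IsCompact C := by
    refine (isCompact_closedBall (0 : Euc n) ‖b‖).of_isClosed_subset
      ((isClosed_le continuous_const continuous_norm).inter
        (isClosed_le continuous_norm continuous_const)) fun z hz => ?_
    exact mem_closedBall_zero_iff.2 hz.2
  have hxC : x ∈ C := ⟨hax.le, hxb.le⟩
  have husc : UpperSemicontinuousOn (fun z => -((v z : ℝ≥0∞) : EReal)) C := by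
    have h1 : LowerSemicontinuous fun z => ((v z : ℝ≥0∞) : EReal) :=
      continuous_coe_ennreal_ereal.comp_lowerSemicontinuous hvlsc
        EReal.coe_ennreal_strictMono.monotone
    exact (continuous_neg.comp_lowerSemicontinuous_antitone h1
      (fun s t hst => EReal.neg_le_neg_iff.2 hst)).upperSemicontinuousOn _
  -- A minimum point y of v - ψ on the closed shell, found as a maximum point for the upper
  -- semicontinuous -v. The minimum value is -d, and d > 0 by the choice of ε.
  obtain ⟨y, hyC, t, hyt, hmax⟩ := exists_touching hC husc
    (fun z _ => by simp [EReal.neg_eq_top_iff]) (ψ := fun z => -ψ z)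
    (fun z hz => (hψd z (ha0.trans_le hz.1)).continuousAt.neg.continuousWithinAt) hxC
    (by simpa [EReal.neg_eq_bot_iff] using hvxt)
  have hvyt : v y ≠ ⊤ := by
    intro h'; rw [h'] at hyt; simp at hyt
  have hvy : (v y).toReal = -t := by
    rw [← ENNReal.ofReal_toReal hvyt, EReal.coe_ennreal_ofReal,
      max_eq_left ENNReal.toReal_nonneg] at hyt
    have : -(v y).toReal = t := by exact_mod_cast hyt
    linarith
  set d := t + ψ y with hd
  have hge : ∀ z ∈ C, ENNReal.ofReal (ψ z - d) ≤ v z := by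
    intro z hz
    have h1 := hmax z hz
    rcases eq_or_ne (v z) ⊤ with h2 | h2
    · rw [h2]; exact le_top
    · rw [← ENNReal.ofReal_toReal h2, EReal.coe_ennreal_ofReal,
        max_eq_left ENNReal.toReal_nonneg] at h1
      have h3 : -(v z).toReal ≤ -ψ z + (t - -ψ y) := by exact_mod_cast h1
      rw [← ENNReal.ofReal_toReal h2]
      exact ENNReal.ofReal_le_ofReal (by rw [hd]; linarith)
  have hdpos : 0 < d := by
    have h1 := hge x hxC
    rw [← ENNReal.ofReal_toReal hvxt, ENNReal.ofReal_le_ofReal_iff ENNReal.toReal_nonneg, hψ] at h1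
    linarith
  have hyeq : ψ y - d = (v y).toReal := by rw [hd, hvy]; ring
  -- Subtracting ε‖b‖² keeps ψ at or below the affine function throughout the shell, so v ≥ ψ at the
  -- radii of a and b. As v is radial, y has neither of these radii.
  have hbdry : ∀ w : Euc n, ‖w‖ = ‖y‖ → w ∈ C → ‖w‖ ≤ ‖b‖ →
      ENNReal.ofReal (α * rieszK p ‖w‖ + β) ≤ v w → False := by
    intro w hwy _ hwb hle
    have e1 : v w = v y := hm.orbitAvg_radial h.st hlsc.measurable hwy
    have e2 : ψ w = ψ y := by rw [hψ, hψ, hwy]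
    rw [e1, ← ENNReal.ofReal_toReal hvyt, ENNReal.ofReal_le_ofReal_iff ENNReal.toReal_nonneg] at hle
    have e3 := hψ w
    have : ‖w‖ ^ 2 ≤ ‖b‖ ^ 2 := by gcongr
    nlinarith
  have hya : ‖a‖ < ‖y‖ := lt_of_le_of_ne hyC.1 fun h' =>
    hbdry a h' ⟨le_rfl, (hax.trans hxb).le⟩ (hax.trans hxb).le hva
  have hyb : ‖y‖ < ‖b‖ := lt_of_le_of_ne hyC.2 fun h' =>
    hbdry b h'.symm ⟨(hax.trans hxb).le, le_rfl⟩ le_rfl hvb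
  have hy0 : 0 < ‖y‖ := ha0.trans hya
  -- the harmonic measure adapted to the direction of `y`
  set q : ℝ := (‖y‖ ^ 2) ^ (-(p / 2)) with hq
  have hqpos : 0 < q := Real.rpow_pos_of_pos (by positivity) _
  set e : Euc n := ‖y‖⁻¹ • y with he
  have he1 : ‖e‖ = 1 := by rw [he, norm_smul]; simp [hy0.ne']
  have hye : y = ‖y‖ • e := by rw [he, smul_smul, mul_inv_cancel₀ hy0.ne', one_smul]
  -- At y, ℓ(D²f) = 2αq(ℓ 1 - p) + ε ℓ 1. This δ keeps the first term at least -ε/2, whereas ℓ 1 ≥ p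
  -- ≥ 1, so f is strictly subharmonic for ℓ.
  obtain ⟨ℓ, μ, hμ, hFℓ, hℓe, hℓp, hℓδ⟩ := h.exists_harmonicMeasure
    (δ := ε / (4 * (|α| * q + 1))) (by positivity) e he1
  have := hμ.prob
  -- Lowering ψ - d by half the available convexity leaves f(y) = v(y) and a gap of ε/2 times the
  -- squared distance between f and v elsewhere.
  let f : Euc n → ℝ := fun z => k (‖z - 0‖ ^ 2) + ((-(ε / 2)) * ‖z - y‖ ^ 2 + (β - ε * ‖b‖ ^ 2 - d))
  have hfψ : ∀ z, f z = ψ z - d - ε / 2 * ‖z - y‖ ^ 2 := fun z => by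
    simp only [f, ψ]; ring
  have hfd : ∀ z : Euc n, 0 < ‖z‖ → ContDiffAt ℝ 2 f z := fun z hz =>
    (hkd z hz).add ((contDiffAt_quadratic _ _ _).add contDiffAt_const)
  have hHess : 0 < ℓ (hessian f y) := by
    have h1 : hessian (fun z => k (‖z - 0‖ ^ 2)) y =
        (2 * (α * q + ε)) • (1 : Mat n) +
          (4 * (α * (-(p / 2) * (‖y‖ ^ 2) ^ (-(p / 2) - 1)))) • projLine (y - 0) := by
      have hy2 : 0 < ‖y - 0‖ ^ 2 := by rw [sub_zero]; positivity
      have := hessian_normSq (k := k) (k₁ := fun t => α * t ^ (-(p / 2)) + ε)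
        (k₂ := α * (-(p / 2) * (‖y - 0‖ ^ 2) ^ (-(p / 2) - 1))) (c := 0) (x := y) ?_ ?_
      · rw [this]; simp only [sub_zero]; rfl
      · filter_upwards [lt_mem_nhds hy2] with t ht
        exact (((hasDerivAt_kap p ht).const_mul α).add ((hasDerivAt_id t).const_mul ε)).congr_deriv
          (by simp)
      · exact ((Real.hasDerivAt_rpow_const (Or.inl hy2.ne')).const_mul α).add_const ε
    have h2 : hessian f y = _ := hessian_add (hkd y hy0)
      ((contDiffAt_quadratic (-(ε / 2)) y y).add contDiffAt_const)
    rw [hessian_add_const, hessian_quadratic, h1, sub_zero] at h2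
    have h3 : projLine y = ‖y‖ ^ 2 • projLine e := by
      conv_lhs => rw [hye]
      exact projLine_smul _ _
    have h4 : (‖y‖ ^ 2) ^ (-(p / 2) - 1) * ‖y‖ ^ 2 = q := by
      rw [Real.rpow_sub_one (by positivity), div_mul_cancel₀ _ (by positivity)]
    rw [h2, h3]
    simp only [map_add, map_smul, smul_eq_mul, hℓe, mul_one]
    have h5 : 4 * (α * (-(p / 2) * (‖y‖ ^ 2) ^ (-(p / 2) - 1))) * ‖y‖ ^ 2 = -2 * p * α * q := by
      rw [← h4]; ring
    rw [h5]
    have h6 : |α| * q * (ℓ 1 - p) ≤ ε / 4 := by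
      have h7 : (|α| * q + 1) * (ℓ 1 - p) ≤ ε / 4 := by
        have : ℓ 1 - p ≤ ε / (4 * (|α| * q + 1)) := by linarith
        calc (|α| * q + 1) * (ℓ 1 - p) ≤ (|α| * q + 1) * (ε / (4 * (|α| * q + 1))) := by gcongr
          _ = ε / 4 := by field_simp
      nlinarith
    have h8 : -(|α| * q * (ℓ 1 - p)) ≤ α * q * (ℓ 1 - p) := by
      have : -|α| ≤ α := neg_abs_le α
      have h9 : 0 ≤ q * (ℓ 1 - p) := mul_nonneg hqpos.le (by linarith)
      nlinarith
    have h10 := h.one_le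
    nlinarith
  -- a ball around `y` on which everything takes place
  obtain ⟨ρ₀, hρ₀, hball⟩ : ∃ ρ₀ > 0, Metric.ball y ρ₀ ⊆
      {z | ‖a‖ < ‖z‖ ∧ ‖z‖ < ‖b‖ ∧ 0 < ℓ (hessian f z) ∧ f z < f y + 1} := by
    refine Metric.mem_nhds_iff.1 ?_
    filter_upwards [continuous_norm.continuousAt.eventually (lt_mem_nhds hya),
      continuous_norm.continuousAt.eventually (gt_mem_nhds hyb),
      (ℓ.continuous.continuousAt.comp (continuousAt_hessian (hfd y hy0))).eventually
        (lt_mem_nhds hHess),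
      (hfd y hy0).continuousAt.eventually (gt_mem_nhds (lt_add_one (f y)))] with z h1 h2 h3 h4
    exact ⟨h1, h2, h3, h4⟩
  have hfsub : IsSubharmonicOn (halfSpace ℓ) (Metric.ball y ρ₀) (fun z => (f z : EReal)) :=
    isSubharmonicOn_of_hessian_mem (isSubequation_halfSpace hμ.nonneg)
      (fun z hz => hfd z (ha0.trans (hball hz).1))
      (fun z hz => ⟨hessian_isSymm (hfd z (ha0.trans (hball hz).1)), (hball hz).2.2.1.le⟩)
  set N : ℝ := f y + 1 with hN
  have hfy : f y = (v y).toReal := by rw [hfψ, hyeq]; simp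
  have hfy0 : 0 ≤ f y := by rw [hfy]; exact ENNReal.toReal_nonneg
  set s := ρ₀ / 2 with hs
  have hspos : 0 < s := by rw [hs]; linarith
  have hcb : Metric.closedBall y s ⊆ Metric.ball y ρ₀ :=
    Metric.closedBall_subset_ball (by rw [hs]; linarith)
  have hm1 := hμ.lintegral_pot_le Metric.isOpen_ball hspos hcb hfsub (M := N)
    (fun z hz => EReal.coe_le_coe_iff.2 (hball hz).2.2.2.le)
  have hm2 := lintegral_orbitAvg_pot_le hm hμ hFℓ hΩ hu hM (x := y) hspos (fun g hg z hz => by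
    obtain ⟨w, rfl⟩ : ∃ w, z = rot g w := ⟨rot g.transpose z, by
      rw [← rot_mul, orthogonal_mul_transpose hg.1, rot_one]⟩
    rw [mem_closedBall_iff_norm, ← map_sub, norm_rot hg.1, ← mem_closedBall_iff_norm] at hz
    have := hball (hcb hz)
    rw [hΩdef, mem_ofPred_eq, norm_rot hg.1]
    exact ⟨ha.trans this.1, this.2.1.trans hb⟩)
  rw [← hv] at hm2
  -- On the sphere of radius s about y the sum of N - f and v is at least N + εs²/2. The mean value
  -- inequalities `hm1` and `hm2` bound its integral by the value at y, which is exactly N.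
  have hsum : ENNReal.ofReal (N + ε / 2 * s ^ 2) ≤
      ∫⁻ z, (pot (Metric.ball y ρ₀) N (fun z => (f z : EReal)) (s • z + y) + v (s • z + y)) ∂μ := by
    have : ∀ᵐ z ∂μ, ENNReal.ofReal (N + ε / 2 * s ^ 2) ≤
        pot (Metric.ball y ρ₀) N (fun z => (f z : EReal)) (s • z + y) + v (s • z + y) := by
      filter_upwards [hμ.sphere] with z hz
      have hzn : ‖s • z + y - y‖ = s := by
        rw [add_sub_cancel_right, norm_smul, mem_sphere_zero_iff_norm.1 hz, mul_one,
          Real.norm_of_nonneg hspos.le]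
      have hzb : s • z + y ∈ Metric.ball y ρ₀ := hcb (by rw [mem_closedBall_iff_norm, hzn])
      have hzC : s • z + y ∈ C := ⟨(hball hzb).1.le, (hball hzb).2.1.le⟩
      rw [pot_coe hzb rfl]
      refine le_trans ?_ (add_le_add_right (hge _ hzC) _)
      refine le_trans (ENNReal.ofReal_le_ofReal ?_) ENNReal.ofReal_add_le
      rw [hfψ, hzn]; linarith
    calc ENNReal.ofReal (N + ε / 2 * s ^ 2)
        = ∫⁻ _, ENNReal.ofReal (N + ε / 2 * s ^ 2) ∂μ := by simp
      _ ≤ _ := lintegral_mono_ae this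
  have hvm : Measurable fun z => v (s • z + y) := hvlsc.measurable.comp (by fun_prop)
  rw [lintegral_add_right _ hvm] at hsum
  have hfin := hsum.trans (add_le_add hm1 hm2)
  rw [pot_coe (Metric.mem_ball_self hρ₀) rfl, ← ENNReal.ofReal_toReal hvyt, ← hfy,
    ← ENNReal.ofReal_add (by rw [hN]; linarith) hfy0,
    ENNReal.ofReal_le_ofReal_iff (by rw [hN]; linarith)] at hfin
  have : 0 < ε / 2 * s ^ 2 := by positivity
  linarith

/-! ### Rapidly converging sequences of subharmonic functions -/

lemma exists_real_bound {C : Set (Euc n)} (hC : IsCompact C) {u : Euc n → EReal}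
    (hu : UpperSemicontinuousOn u C) (hne : ∀ x ∈ C, u x ≠ ⊤) : ∃ M : ℝ, ∀ x ∈ C, u x ≤ M := by
  rcases C.eq_empty_or_nonempty with rfl | hCne
  · exact ⟨0, by simp⟩
  obtain ⟨y, hy, hmax⟩ := hu.exists_isMaxOn hCne hC
  obtain ⟨M, hM, -⟩ := EReal.lt_iff_exists_real_btwn.1 (lt_top_iff_ne_top.2 (hne y hy))
  exact ⟨M, fun x hx => (hmax hx).trans hM.le⟩

lemma EReal.abs_sub_coe (x : EReal) (c : ℝ) :
    (x - c).abs = if x = ⊥ ∨ x = ⊤ then ⊤ else ENNReal.ofReal |x.toReal - c| := by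
  induction x with
  | bot => simp
  | top => simp
  | coe t => simp [← EReal.coe_sub, EReal.abs_def]

lemma ofReal_sub_le_toENNReal_add_abs {x : EReal} {M : ℝ} (c : ℝ) :
    ENNReal.ofReal (M - c) ≤ ((M : EReal) - x).toENNReal + (x - c).abs := by
  induction x with
  | bot => simp
  | top => simp
  | coe t =>
    rw [← EReal.coe_sub, ← EReal.coe_sub, EReal.real_coe_toENNReal, EReal.abs_def]
    refine le_trans (ENNReal.ofReal_le_ofReal ?_) ENNReal.ofReal_add_le
    linarith [le_abs_self (t - c)]

lemma aemeasurable_of_upperSemicontinuousOn {u : Euc n → EReal} {X : Set (Euc n)} (hX : IsOpen X)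
    (hu : UpperSemicontinuousOn u X) : AEMeasurable u (volume.restrict X) := by
  refine aemeasurable_restrict_of_measurable_subtype hX.measurableSet ?_
  have : UpperSemicontinuous fun x : X => u x := upperSemicontinuousOn_iff_restrict.2 hu
  exact this.measurable

/-- A sequence of `F`-subharmonic functions on growing balls that converges rapidly in `L¹_loc`. -/
structure IsFastSeq (F : Set (Mat n)) (uk : ℕ → Euc n → EReal) (Ubar : Euc n → ℝ) : Prop where
  loc : LocallyIntegrable Ubar volume
  sub : ∀ k : ℕ, IsSubharmonicOn F (Metric.ball 0 (k + 1)) (uk k)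
  close : ∀ k : ℕ, ∫⁻ x in Metric.closedBall (0 : Euc n) k, (uk k x - (Ubar x : EReal)).abs ≤
    (2⁻¹ : ℝ≥0∞) ^ k

/-- The error functions of a fast sequence. -/
noncomputable def seqErr (uk : ℕ → Euc n → EReal) (Ubar : Euc n → ℝ) (k : ℕ) : Euc n → ℝ≥0∞ :=
  (Metric.closedBall (0 : Euc n) k).indicator fun x => (uk k x - (Ubar x : EReal)).abs

variable {uk : ℕ → Euc n → EReal} {Ubar : Euc n → ℝ}

lemma IsFastSeq.aemeasurable_seqErr (h : IsFastSeq F uk Ubar) (k : ℕ) :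
    AEMeasurable (seqErr uk Ubar k) := by
  rw [seqErr, aemeasurable_indicator_iff Metric.isClosed_closedBall.measurableSet]
  have h1 : AEMeasurable (uk k) (volume.restrict (Metric.closedBall (0 : Euc n) k)) :=
    (aemeasurable_of_upperSemicontinuousOn Metric.isOpen_ball (h.sub k).usc).mono_set
      (Metric.closedBall_subset_ball (by linarith))
  have h2 : AEMeasurable Ubar (volume.restrict (Metric.closedBall (0 : Euc n) k)) :=
    h.loc.aestronglyMeasurable.aemeasurable.restrict
  have hm : Measurable fun q : EReal × ℝ => if q.1 = ⊥ ∨ q.1 = ⊤ then (⊤ : ℝ≥0∞) else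
      ENNReal.ofReal |q.1.toReal - q.2| := by
    refine Measurable.ite ?_ measurable_const ?_
    · exact ((measurableSet_singleton (⊥ : EReal)).preimage measurable_fst).union
        ((measurableSet_singleton (⊤ : EReal)).preimage measurable_fst)
    · have : Measurable fun q : EReal × ℝ => q.1.toReal - q.2 :=
        (measurable_fst.ereal_toReal).sub measurable_snd
      exact (continuous_abs.measurable.comp this).ennreal_ofReal
  simp_rw [EReal.abs_sub_coe]
  exact hm.comp_aemeasurable (h1.prodMk h2)

lemma IsFastSeq.lintegral_seqErr_le (h : IsFastSeq F uk Ubar) (k : ℕ) :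
    ∫⁻ x, seqErr uk Ubar k x ≤ (2⁻¹ : ℝ≥0∞) ^ k := by
  rw [seqErr, lintegral_indicator Metric.isClosed_closedBall.measurableSet]
  exact h.close k

lemma tsum_two_inv_pow_ne_top : ∑' k : ℕ, (2⁻¹ : ℝ≥0∞) ^ k ≠ ⊤ := by
  rw [ENNReal.tsum_geometric, ENNReal.one_sub_inv_two]
  simp

/-- The integrals of the errors are summable, so the sum of the errors is finite almost everywhere
and its terms tend to zero. -/
lemma IsFastSeq.ae_tendsto_seqErr (h : IsFastSeq F uk Ubar) :
    ∀ᵐ x, Tendsto (fun k => seqErr uk Ubar k x) atTop (𝓝 0) := by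
  have h1 : ∫⁻ x, ∑' k, seqErr uk Ubar k x ≠ ⊤ := by
    rw [lintegral_tsum h.aemeasurable_seqErr]
    exact ne_top_of_le_ne_top tsum_two_inv_pow_ne_top
      (ENNReal.tsum_le_tsum h.lintegral_seqErr_le)
  filter_upwards [ae_lt_top' (AEMeasurable.tsum h.aemeasurable_seqErr) h1] with x hx
  exact ENNReal.tendsto_atTop_zero_of_tsum_ne_top hx.ne

lemma seqErr_of_mem {k : ℕ} {x : Euc n} (hx : ‖x‖ ≤ k) :
    seqErr uk Ubar k x = (uk k x - (Ubar x : EReal)).abs :=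
  indicator_of_mem (mem_closedBall_zero_iff.2 hx) _

lemma eventually_norm_le (x : Euc n) (s : ℝ) : ∀ᶠ k : ℕ in atTop, ‖x‖ + s ≤ k :=
  tendsto_natCast_atTop_atTop.eventually_ge_atTop _

lemma IsFastSeq.ae_tendsto (h : IsFastSeq F uk Ubar) :
    ∀ᵐ x, Tendsto (fun k => uk k x) atTop (𝓝 (Ubar x : EReal)) := by
  filter_upwards [h.ae_tendsto_seqErr] with x hx
  rw [tendsto_order]
  have key : ∀ ε : ℝ, 0 < ε → ∀ᶠ k in atTop, ∃ t : ℝ, uk k x = t ∧ |t - Ubar x| < ε := by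
    intro ε hε
    filter_upwards [hx.eventually (gt_mem_nhds (ENNReal.ofReal_pos.2 hε)), eventually_norm_le x 0]
      with k hk hk2
    rw [seqErr_of_mem (by linarith), EReal.abs_sub_coe] at hk
    split_ifs at hk with hc
    · simp at hk
    · push Not at hc
      refine ⟨(uk k x).toReal, (EReal.coe_toReal hc.2 hc.1).symm, ?_⟩
      exact (ENNReal.ofReal_lt_ofReal_iff hε).1 hk
  constructor
  · intro a ha
    obtain ⟨c, hac, hc⟩ := EReal.lt_iff_exists_real_btwn.1 ha
    have hc' : c < Ubar x := by exact_mod_cast hc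
    filter_upwards [key (Ubar x - c) (by linarith)] with k ⟨t, ht, htc⟩
    rw [ht]
    refine hac.trans (EReal.coe_lt_coe_iff.2 ?_)
    linarith [(abs_lt.1 htc).1]
  · intro a ha
    obtain ⟨c, hc, hac⟩ := EReal.lt_iff_exists_real_btwn.1 ha
    have hc' : Ubar x < c := by exact_mod_cast hc
    filter_upwards [key (c - Ubar x) (by linarith)] with k ⟨t, ht, htc⟩
    rw [ht]
    refine lt_trans (EReal.coe_lt_coe_iff.2 ?_) hac
    linarith [(abs_lt.1 htc).2]

/-- The volume of a ball of radius `s`. -/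
noncomputable def ballVol (n : ℕ) (s : ℝ) : ℝ :=
  (volume (Metric.closedBall (0 : Euc n) s)).toReal

lemma volume_closedBall_eq (x : Euc n) (s : ℝ) :
    volume (Metric.closedBall x s) = ENNReal.ofReal (ballVol n s) := by
  rw [ballVol, ENNReal.ofReal_toReal measure_closedBall_lt_top.ne,
    Measure.addHaar_closedBall_center]

lemma ballVol_pos {s : ℝ} (hs : 0 < s) : 0 < ballVol n s :=
  ENNReal.toReal_pos (Metric.measure_closedBall_pos volume 0 hs).ne' measure_closedBall_lt_top.ne

/-- The average of `f` over the ball of radius `s` about `y`. -/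
noncomputable def ballAvg (f : Euc n → ℝ) (s : ℝ) (y : Euc n) : ℝ :=
  (∫ z in Metric.closedBall y s, f z) / ballVol n s

lemma LocallyIntegrable.integrableOn_closedBall' {f : Euc n → ℝ} (hf : LocallyIntegrable f volume)
    (y : Euc n) (s : ℝ) : IntegrableOn f (Metric.closedBall y s) volume :=
  hf.integrableOn_isCompact (isCompact_closedBall y s)

/-- As the centre moves, the indicator of the ball converges off the limiting sphere, a null set;
dominated convergence applies. -/
lemma continuous_ballAvg {f : Euc n → ℝ} (hf : LocallyIntegrable f volume) {s : ℝ} (hs : 0 < s) :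
    Continuous (ballAvg f s) := by
  refine Continuous.div_const ?_ _
  rw [continuous_iff_continuousAt]
  intro y
  have e : ∀ y : Euc n, ∫ z in Metric.closedBall y s, f z =
      ∫ z, (Metric.closedBall y s).indicator f z := fun y =>
    (integral_indicator Metric.isClosed_closedBall.measurableSet).symm
  simp_rw [e]
  have hi : Integrable ((Metric.closedBall y (s + 1)).indicator f) volume :=
    (integrable_indicator_iff Metric.isClosed_closedBall.measurableSet).2
      (LocallyIntegrable.integrableOn_closedBall' hf y (s + 1))
  refine tendsto_integral_filter_of_dominated_convergence
    (fun z => ‖(Metric.closedBall y (s + 1)).indicator f z‖)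
    (Eventually.of_forall fun w =>
      hf.aestronglyMeasurable.indicator Metric.isClosed_closedBall.measurableSet) ?_ hi.norm ?_
  · filter_upwards [Metric.ball_mem_nhds y one_pos] with w hw
    refine Eventually.of_forall fun z => ?_
    refine norm_indicator_le_of_subset (fun z hz => ?_) f z
    rw [Metric.mem_closedBall] at hz ⊢
    rw [Metric.mem_ball] at hw
    linarith [dist_triangle z w y]
  · have h0 : ∀ᵐ z : Euc n, z ∉ Metric.sphere y s :=
      measure_eq_zero_iff_ae_notMem.1 (Measure.addHaar_sphere_of_ne_zero volume y hs.ne')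
    filter_upwards [h0] with z hz
    rw [Metric.mem_sphere] at hz
    have hc : ContinuousAt (fun w => dist z w) y := by fun_prop
    rcases lt_or_gt_of_ne hz with hlt | hgt
    · refine tendsto_const_nhds.congr' ?_
      filter_upwards [hc.eventually (gt_mem_nhds hlt)] with w hw
      rw [indicator_of_mem (Metric.mem_closedBall.2 hlt.le),
        indicator_of_mem (Metric.mem_closedBall.2 (le_of_lt hw))]
    · refine tendsto_const_nhds.congr' ?_
      filter_upwards [hc.eventually (lt_mem_nhds hgt)] with w hw
      rw [indicator_of_notMem (by simpa using hgt), indicator_of_notMem (by simpa using hw)]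

/-- The mean value inequality of `uk k` over the ball, with `uk k` replaced by the limit at the cost
of the L¹ error. -/
lemma IsFastSeq.le_ballAvg (h : IsFastSeq F uk Ubar) (hF : RieszData F p)
    {k : ℕ} {y : Euc n} {s : ℝ} (hs : 0 < s) (hys : ‖y‖ + s ≤ k) :
    uk k y ≤ ((ballAvg Ubar s y + (2⁻¹) ^ k / ballVol n s : ℝ) : EReal) := by
  obtain ⟨m, hm⟩ := exists_isStabMeasure hF.sub.closed
  have hV := ballVol_pos (n := n) hs
  -- The radius k + 1/2 lies between k, within which the averaging ball stays, and k + 1, up to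
  -- which `uk k` is subharmonic. It leaves room for a finite upper bound M.
  have hsub : Metric.closedBall (0 : Euc n) (k + 1 / 2) ⊆ Metric.ball 0 (k + 1) :=
    Metric.closedBall_subset_ball (by linarith)
  obtain ⟨M, hM⟩ := exists_real_bound (isCompact_closedBall (0 : Euc n) (k + 1 / 2))
    ((h.sub k).usc.mono hsub) (fun x hx => (h.sub k).ne_top x (hsub hx))
  set Ω := Metric.ball (0 : Euc n) (k + 1 / 2) with hΩdef
  have hΩ : IsOpen Ω := Metric.isOpen_ball
  have huΩ : IsSubharmonicOn F Ω (uk k) :=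
    (h.sub k).mono (Metric.ball_subset_closedBall.trans hsub)
  have hMΩ : ∀ x ∈ Ω, uk k x ≤ M := fun x hx => hM x (Metric.ball_subset_closedBall hx)
  have hB : Metric.closedBall y s ⊆ Metric.closedBall 0 (k : ℝ) := fun z hz => by
    rw [mem_closedBall_iff_norm] at hz
    rw [mem_closedBall_zero_iff]
    linarith [norm_le_norm_add_norm_sub' z y]
  have hBΩ : Metric.closedBall y s ⊆ Ω :=
    hB.trans (Metric.closedBall_subset_ball (by linarith))
  have hyΩ : y ∈ Ω := hBΩ (Metric.mem_closedBall_self hs.le)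
  have h1 := hF.setLIntegral_pot_le hm hΩ huΩ hMΩ hBΩ
  have h2 : ∫⁻ z in Metric.closedBall y s, ENNReal.ofReal (M - Ubar z) ≤
      ENNReal.ofReal (ballVol n s) * pot Ω M (uk k) y + (2⁻¹ : ℝ≥0∞) ^ k := by
    calc ∫⁻ z in Metric.closedBall y s, ENNReal.ofReal (M - Ubar z)
        ≤ ∫⁻ z in Metric.closedBall y s,
            (pot Ω M (uk k) z + (uk k z - (Ubar z : EReal)).abs) := by
          refine setLIntegral_mono' Metric.isClosed_closedBall.measurableSet fun z hz => ?_
          rw [pot_of_mem (hBΩ hz)]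
          exact ofReal_sub_le_toENNReal_add_abs _
      _ = (∫⁻ z in Metric.closedBall y s, pot Ω M (uk k) z) +
            ∫⁻ z in Metric.closedBall y s, (uk k z - (Ubar z : EReal)).abs :=
          lintegral_add_left (lowerSemicontinuous_pot hΩ M huΩ.usc).measurable _
      _ ≤ _ := by
          rw [← volume_closedBall_eq y s]
          exact add_le_add h1 ((lintegral_mono_set hB).trans (h.close k))
  induction hu : uk k y with
  | bot => exact bot_le
  | top => exact absurd hu (huΩ.ne_top y hyΩ)
  | coe t =>
    have htM : t ≤ M := by have := hMΩ y hyΩ; rw [hu] at this; exact_mod_cast this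
    rw [pot_coe hyΩ hu, ← ENNReal.ofReal_mul hV.le] at h2
    have e2 : (2⁻¹ : ℝ≥0∞) ^ k = ENNReal.ofReal ((2⁻¹ : ℝ) ^ k) := by
      rw [ENNReal.ofReal_pow (by norm_num), ENNReal.ofReal_inv_of_pos (by norm_num)]; simp
    rw [e2, ← ENNReal.ofReal_add (mul_nonneg hV.le (by linarith)) (by positivity)] at h2
    have hint : IntegrableOn Ubar (Metric.closedBall y s) volume :=
      LocallyIntegrable.integrableOn_closedBall' h.loc y s
    have hc : IntegrableOn (fun _ => M) (Metric.closedBall y s) volume :=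
      integrableOn_const measure_closedBall_lt_top.ne
    have h3 : ∫ z in Metric.closedBall y s, (M - Ubar z) ≤
        (∫⁻ z in Metric.closedBall y s, ENNReal.ofReal (M - Ubar z)).toReal := by
      have hci : Integrable (fun z => M - Ubar z) (volume.restrict (Metric.closedBall y s)) :=
        hc.sub hint
      rw [integral_eq_lintegral_pos_part_sub_lintegral_neg_part hci]
      linarith [(ENNReal.toReal_nonneg :
        0 ≤ (∫⁻ z in Metric.closedBall y s, ENNReal.ofReal (-(M - Ubar z))).toReal)]
    have h4 := ENNReal.toReal_mono ENNReal.ofReal_ne_top h2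
    rw [ENNReal.toReal_ofReal (add_nonneg (mul_nonneg hV.le (by linarith)) (by positivity))] at h4
    rw [integral_sub hc hint, setIntegral_const, measureReal_def, volume_closedBall_eq,
      ENNReal.toReal_ofReal hV.le, smul_eq_mul] at h3
    rw [EReal.coe_le_coe_iff, ballAvg, ← add_div, le_div_iff₀ hV]
    linarith

/-! ### The regularised limit and its subharmonicity -/

/-- `U` is the representative `U(x) = lim_{s → 0} ess sup_{B_s(x)} Ubar`. -/
def IsEssRep (Ubar : Euc n → ℝ) (U : Euc n → EReal) : Prop :=
  ∀ x : Euc n, Tendsto (fun s : ℝ =>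
      essSup (fun y => (Ubar y : EReal)) (volume.restrict (Metric.closedBall x s)))
    (𝓝[>] 0) (𝓝 (U x))

variable {U : Euc n → EReal}

lemma IsEssRep.exists_ae_lt (hU : IsEssRep Ubar U) {x : Euc n} {c : EReal} (hc : U x < c) :
    ∃ t > 0, ∀ᵐ y ∂volume.restrict (Metric.closedBall x t), (Ubar y : EReal) < c := by
  obtain ⟨t, ht1, ht⟩ :=
    (((hU x).eventually (gt_mem_nhds hc)).and self_mem_nhdsWithin).exists
  exact ⟨t, ht, ae_lt_of_essSup_lt ht1⟩

lemma IsEssRep.le_of_ae_le (hU : IsEssRep Ubar U) {x : Euc n} {c : EReal} {δ : ℝ} (hδ : 0 < δ)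
    (h : ∀ᵐ y ∂volume.restrict (Metric.closedBall x δ), (Ubar y : EReal) ≤ c) : U x ≤ c := by
  refine le_of_tendsto (hU x) ?_
  filter_upwards [Ioo_mem_nhdsGT hδ] with t ht
  exact essSup_le_of_ae_le c
    (ae_mono (Measure.restrict_mono_set _ (Metric.closedBall_subset_closedBall ht.2.le)) h)

lemma IsEssRep.upperSemicontinuous (hU : IsEssRep Ubar U) : UpperSemicontinuous U := by
  intro x c hc
  obtain ⟨c', hc1, hc2⟩ := exists_between hc
  obtain ⟨t, ht, hlt⟩ := hU.exists_ae_lt hc1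
  filter_upwards [Metric.ball_mem_nhds x (half_pos ht)] with y hy
  refine lt_of_le_of_lt (hU.le_of_ae_le (half_pos ht) ?_) hc2
  refine ae_mono (Measure.restrict_mono_set _ ?_) (hlt.mono fun z hz => hz.le)
  refine Metric.closedBall_subset_closedBall' ?_
  linarith [Metric.mem_ball.1 hy]

lemma tendsto_two_inv_pow_div (c : ℝ) : Tendsto (fun k : ℕ => (2⁻¹ : ℝ) ^ k / c) atTop (𝓝 0) := by
  simpa using (tendsto_pow_atTop_nhds_zero_of_lt_one (by norm_num : (0 : ℝ) ≤ 2⁻¹)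
    (by norm_num)).div_const c

/-- Letting k → ∞ gives the inequality for the limit almost everywhere; continuity of ball averages
in the centre carries it to the essential upper limit at every point. -/
lemma IsFastSeq.le_ballAvg_rep (h : IsFastSeq F uk Ubar) (hF : RieszData F p)
    (hU : IsEssRep Ubar U) (x : Euc n) {s : ℝ} (hs : 0 < s) : U x ≤ (ballAvg Ubar s x : ℝ) := by
  have h1 : ∀ᵐ y, Ubar y ≤ ballAvg Ubar s y := by
    filter_upwards [h.ae_tendsto] with y hy
    have h2 : Tendsto (fun k : ℕ => ((ballAvg Ubar s y + (2⁻¹) ^ k / ballVol n s : ℝ) : EReal)) atTop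
        (𝓝 ((ballAvg Ubar s y : ℝ) : EReal)) := by
      refine (continuous_coe_real_ereal.tendsto _).comp ?_
      simpa using (tendsto_two_inv_pow_div (ballVol n s)).const_add (ballAvg Ubar s y)
    refine EReal.coe_le_coe_iff.1 (le_of_tendsto_of_tendsto hy h2 ?_)
    filter_upwards [eventually_norm_le y s] with k hk using h.le_ballAvg hF hs hk
  refine le_of_forall_gt fun c hc => ?_
  obtain ⟨c', hc1, hc2⟩ := EReal.lt_iff_exists_real_btwn.1 hc
  obtain ⟨δ, hδ, hδc⟩ := Metric.nhds_basis_closedBall.eventually_iff.1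
    ((continuous_ballAvg h.loc hs).continuousAt.eventually
      (gt_mem_nhds (EReal.coe_lt_coe_iff.1 hc1)))
  refine lt_of_le_of_lt (hU.le_of_ae_le hδ ?_) hc2
  filter_upwards [ae_restrict_of_ae h1, ae_restrict_mem Metric.isClosed_closedBall.measurableSet]
    with y hy hyB
  exact EReal.coe_le_coe_iff.2 (hy.trans (hδc hyB).le)

lemma IsFastSeq.ne_top (h : IsFastSeq F uk Ubar) (hF : RieszData F p)
    (hU : IsEssRep Ubar U) (x : Euc n) : U x ≠ ⊤ :=
  ((h.le_ballAvg_rep hF hU x one_pos).trans_lt (EReal.coe_lt_top _)).ne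

/-- Hartogs' lemma for a fast sequence. -/
lemma IsFastSeq.eventually_lt (h : IsFastSeq F uk Ubar) (hF : RieszData F p)
    (hU : IsEssRep Ubar U) {x : Euc n} {c : EReal} (hc : U x < c) :
    ∃ δ > 0, ∀ᶠ k in atTop, ∀ y ∈ Metric.closedBall x δ, uk k y < c := by
  obtain ⟨c₁, hc₁, hc'⟩ := EReal.lt_iff_exists_real_btwn.1 hc
  obtain ⟨c₂, hc₂, hc''⟩ := EReal.lt_iff_exists_real_btwn.1 hc'
  have h12 : c₁ < c₂ := EReal.coe_lt_coe_iff.1 hc₂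
  obtain ⟨t, ht, hlt⟩ := hU.exists_ae_lt hc₁
  have hs : 0 < t / 2 := half_pos ht
  have hV := ballVol_pos (n := n) hs
  -- Balls of radius t/2 centred within t/2 of x stay where the limit is below c₁, so the averages
  -- are at most c₁. The gap c₂ - c₁ absorbs the error term.
  refine ⟨t / 2, hs, ?_⟩
  filter_upwards [(tendsto_two_inv_pow_div (ballVol n (t / 2))).eventually
    (gt_mem_nhds (sub_pos.2 h12)), eventually_norm_le x t] with k hk hkx y hy
  have hyk : ‖y‖ + t / 2 ≤ k := by
    rw [mem_closedBall_iff_norm] at hy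
    linarith [norm_le_norm_add_norm_sub' y x]
  refine (h.le_ballAvg hF hs hyk).trans_lt (lt_trans (EReal.coe_lt_coe_iff.2 ?_) hc'')
  have : ballAvg Ubar (t / 2) y ≤ c₁ := by
    rw [ballAvg, div_le_iff₀ hV]
    have hsub : Metric.closedBall y (t / 2) ⊆ Metric.closedBall x t :=
      Metric.closedBall_subset_closedBall' (by linarith [Metric.mem_closedBall.1 hy])
    calc ∫ z in Metric.closedBall y (t / 2), Ubar z
        ≤ ∫ z in Metric.closedBall y (t / 2), c₁ := by
          refine setIntegral_mono_ae_restrict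
            (LocallyIntegrable.integrableOn_closedBall' h.loc _ _)
            (integrableOn_const measure_closedBall_lt_top.ne) ?_
          filter_upwards [ae_mono (Measure.restrict_mono_set _ hsub) hlt] with z hz
          exact (EReal.coe_lt_coe_iff.1 hz).le
      _ = c₁ * ballVol n (t / 2) := by
          rw [setIntegral_const, measureReal_def, volume_closedBall_eq,
            ENNReal.toReal_ofReal hV.le, smul_eq_mul, mul_comm]
  linarith

lemma IsFastSeq.eventually_lt_of_isCompact (h : IsFastSeq F uk Ubar) (hF : RieszData F p)
    (hU : IsEssRep Ubar U) {K : Set (Euc n)} (hK : IsCompact K) {ψ : Euc n → ℝ}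
    (hψ : ∀ y ∈ K, ContinuousAt ψ y) (hlt : ∀ y ∈ K, U y < ψ y) :
    ∀ᶠ k in atTop, ∀ y ∈ K, uk k y < ψ y := by
  refine hK.induction_on (p := fun S => ∀ᶠ k in atTop, ∀ y ∈ S, uk k y < ψ y) (by simp)
    (fun s t hst ht => ht.mono fun k hk y hy => hk y (hst hy))
    (fun s t hs ht => by
      filter_upwards [hs, ht] with k h1 h2 y hy
      exact hy.elim (h1 y) (h2 y)) fun y hy => ?_
  obtain ⟨c, hc1, hc2⟩ := EReal.lt_iff_exists_real_btwn.1 (hlt y hy)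
  obtain ⟨δ, hδ, hk⟩ := h.eventually_lt hF hU hc1
  refine ⟨Metric.closedBall y δ ∩ {z | c < ψ z}, mem_nhdsWithin_of_mem_nhds (inter_mem
    (Metric.closedBall_mem_nhds y hδ)
    ((hψ y hy).eventually (lt_mem_nhds (EReal.coe_lt_coe_iff.1 hc2)))), ?_⟩
  filter_upwards [hk] with k hk z hz
  exact (hk z hz.1).trans (EReal.coe_lt_coe_iff.2 hz.2)

/-- The upper bound is Lebesgue differentiation applied to the mean value inequality; the lower
bound is Hartogs' lemma at a point where `uk` converges. -/
lemma IsFastSeq.ae_eq (h : IsFastSeq F uk Ubar) (hF : RieszData F p) (hU : IsEssRep Ubar U) :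
    ∀ᵐ x, U x = (Ubar x : EReal) := by
  filter_upwards [h.ae_tendsto, (Besicovitch.vitaliFamily
    (volume : Measure (Euc n))).ae_tendsto_average h.loc] with x hx hav
  refine le_antisymm ?_ ?_
  · have h1 : Tendsto (fun s => ((ballAvg Ubar s x : ℝ) : EReal)) (𝓝[>] 0)
        (𝓝 (Ubar x : EReal)) := by
      refine (continuous_coe_real_ereal.tendsto _).comp ?_
      refine (hav.comp (Besicovitch.tendsto_filterAt volume x)).congr' ?_
      filter_upwards [self_mem_nhdsWithin] with s hs
      simp only [Function.comp_apply, setAverage_eq, measureReal_def, volume_closedBall_eq,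
        ENNReal.toReal_ofReal (ballVol_pos (n := n) hs).le, smul_eq_mul, ballAvg]
      rw [div_eq_inv_mul]
    refine ge_of_tendsto h1 ?_
    filter_upwards [self_mem_nhdsWithin] with s hs using h.le_ballAvg_rep hF hU x hs
  · by_contra! hlt
    obtain ⟨c, hc1, hc2⟩ := exists_between hlt
    obtain ⟨δ, hδ, hk⟩ := h.eventually_lt hF hU hc1
    obtain ⟨k, hk1, hk2⟩ := (hk.and (hx.eventually (lt_mem_nhds hc2))).exists
    exact lt_asymm (hk1 x (Metric.mem_closedBall_self hδ.le)) hk2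

/-- Adding η|y - x|² makes the contact strict. For large k, `uk k` is then well below the test
function on a shell around x but not at some point near x, so a translate touches it from above at
an interior point. -/
lemma IsFastSeq.exists_hessian_mem_near (h : IsFastSeq F uk Ubar) (hF : RieszData F p)
    (hU : IsEssRep Ubar U) {x : Euc n} {φ : Euc n → ℝ} (hφ : ContDiffAt ℝ 2 φ x)
    (hx : U x = φ x) (hle : ∀ᶠ y in 𝓝 x, U y ≤ φ y) {η : ℝ} (hη : 0 < η) :
    ∃ᶠ y in 𝓝 x, hessian φ y + (2 * η) • (1 : Mat n) ∈ F := by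
  rw [frequently_iff]
  intro N hN
  obtain ⟨s, hs, hsN⟩ := Metric.nhds_basis_closedBall.eventually_iff.1
    ((hφ.eventually (by simp)).and (hle.and hN))
  set ψ : Euc n → ℝ := fun y => φ y + η * ‖y - x‖ ^ 2 with hψ
  have hψc : ∀ y ∈ Metric.closedBall x s, ContDiffAt ℝ 2 ψ y := fun y hy =>
    (hsN hy).1.add (contDiffAt_quadratic η x y)
  -- On the shell s/2 ≤ |y - x| ≤ s the strict gap is at least ηs²/4 = 2γ. So uk - ψ < -γ on the
  -- shell, while uk - ψ > -γ at the point y found below; the contact point is therefore off the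
  -- shell.
  set γ := η * (s ^ 2 / 8) with hγ
  have hγ0 : 0 < γ := by positivity
  have hshell : ∀ᶠ k in atTop, ∀ y ∈ Metric.closedBall x s \ Metric.ball x (s / 2),
      uk k y < (ψ y - γ : ℝ) := by
    refine h.eventually_lt_of_isCompact hF hU ((isCompact_closedBall x s).diff Metric.isOpen_ball)
      (fun y hy => (hψc y hy.1).continuousAt.sub continuousAt_const) fun y hy => ?_
    refine (hsN hy.1).2.1.trans_lt (EReal.coe_lt_coe_iff.2 ?_)
    have : s / 2 ≤ ‖y - x‖ := by simpa [dist_eq_norm] using hy.2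
    have : (s / 2) ^ 2 ≤ ‖y - x‖ ^ 2 := by gcongr
    simp only [hψ, hγ]
    nlinarith
  have hψx : ψ x = φ x := by simp [hψ]
  obtain ⟨δ, hδ, hδψ⟩ := Metric.nhds_basis_closedBall.eventually_iff.1
    ((hψc x (Metric.mem_closedBall_self hs.le)).continuousAt.eventually
      (gt_mem_nhds (show ψ x < φ x + γ / 2 by linarith)))
  obtain ⟨y, hyδ, hys, hyU, hyt⟩ : ∃ y ∈ Metric.closedBall x δ, y ∈ Metric.closedBall x s ∧
      ((φ x - γ / 2 : ℝ) : EReal) < Ubar y ∧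
      Tendsto (fun k => uk k y) atTop (𝓝 (Ubar y : EReal)) := by
    by_contra! hcon
    have : U x ≤ ((φ x - γ / 2 : ℝ) : EReal) := by
      refine hU.le_of_ae_le (lt_min hδ hs) ?_
      filter_upwards [ae_restrict_of_ae h.ae_tendsto,
        ae_restrict_mem Metric.isClosed_closedBall.measurableSet] with z hz hzB
      by_contra! hlt
      exact hcon z (Metric.closedBall_subset_closedBall (min_le_left _ _) hzB)
        (Metric.closedBall_subset_closedBall (min_le_right _ _) hzB) hlt hz
    rw [hx, EReal.coe_le_coe_iff] at this
    linarith
  obtain ⟨k, hk1, hk2, hk3⟩ := (hshell.and ((hyt.eventually (lt_mem_nhds hyU)).and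
    (eventually_norm_le x s))).exists
  have hB : Metric.closedBall x s ⊆ Metric.ball 0 (k + 1) := fun z hz => by
    rw [mem_closedBall_iff_norm] at hz
    rw [mem_ball_zero_iff]
    linarith [norm_le_norm_add_norm_sub' z x]
  obtain ⟨y', hy', t, ht, htouch⟩ := exists_touching (isCompact_closedBall x s)
    ((h.sub k).usc.mono hB) (fun z hz => (h.sub k).ne_top z (hB hz))
    (fun z hz => (hψc z hz).continuousAt.continuousWithinAt) hys (ne_bot_of_gt hk2)
  have htψ : ψ y' - γ < t := by
    have h1 := hk2.trans_le (htouch y hys)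
    rw [EReal.coe_lt_coe_iff] at h1
    have h2 : ψ y < φ x + γ / 2 := hδψ hyδ
    linarith
  have hyball : y' ∈ Metric.ball x (s / 2) := by
    by_contra hnot
    have := hk1 y' ⟨hy', hnot⟩
    rw [ht, EReal.coe_lt_coe_iff] at this
    linarith
  have hnear : Metric.closedBall x s ∈ 𝓝 y' :=
    mem_of_superset (Metric.isOpen_ball.mem_nhds hyball)
      (Metric.ball_subset_closedBall.trans (Metric.closedBall_subset_closedBall (by linarith)))
  refine ⟨y', (hsN hy').2.2, ?_⟩
  have := (h.sub k).viscosity y' (hB hy') (fun z => ψ z + (t - ψ y'))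
    ((hψc y' hy').add contDiffAt_const) (by rw [ht]; congr 1; ring)
    (mem_of_superset hnear htouch)
  rw [hessian_add_const, hψ, hessian_add (hsN hy').1 (contDiffAt_quadratic η x y'),
    hessian_quadratic] at this
  exact this

/-- In the perturbed Hessian condition, first y → x and then η → 0, using that F is closed. -/
theorem IsFastSeq.isSubharmonicOn (h : IsFastSeq F uk Ubar) (hF : RieszData F p)
    (hU : IsEssRep Ubar U) : IsSubharmonicOn F univ U := by
  refine ⟨hU.upperSemicontinuous.upperSemicontinuousOn _, fun x _ => h.ne_top hF hU x,
    fun x _ φ hφ hx hle => ?_⟩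
  have h1 : ∀ η : ℝ, 0 < η → hessian φ x + (2 * η) • (1 : Mat n) ∈ F := fun η hη =>
    hF.sub.closed.mem_of_frequently_of_tendsto (h.exists_hessian_mem_near hF hU hφ hx hle hη)
      ((continuousAt_hessian hφ).add continuousAt_const)
  have h2 : Tendsto (fun η : ℝ => hessian φ x + (2 * η) • (1 : Mat n)) (𝓝[>] 0)
      (𝓝 (hessian φ x)) := by
    have : Continuous fun η : ℝ => hessian φ x + (2 * η) • (1 : Mat n) := by fun_prop
    simpa using (this.tendsto 0).mono_left nhdsWithin_le_nhds
  refine hF.sub.closed.mem_of_tendsto h2 ?_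
  filter_upwards [self_mem_nhdsWithin] with η hη using h1 η hη

/-! ### From tangents to rapidly converging sequences -/

lemma EReal.coe_mul_sub_coe {a : ℝ} (ha : 0 < a) (c : ℝ) (x : EReal) :
    (a : EReal) * (x - c) = (a : EReal) * x + (-(a * c) : ℝ) := by
  induction x with
  | bot => simp [EReal.coe_mul_bot_of_pos ha]
  | top => rw [EReal.top_sub_coe, EReal.coe_mul_top_of_pos ha, EReal.top_add_coe]
  | coe t => norm_cast; ring

lemma EReal.sub_bot_eq (x : EReal) : x - ⊥ = ⊥ ∨ x - ⊥ = ⊤ := by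
  induction x <;> simp

/-- For every p the flow is a scaling plus a constant, except where the subtracted quantity is -∞.
The flow is then infinite everywhere, which `hfin` rules out. -/
lemma tangentialFlow_eq {u : Euc n → EReal} {ρ : ℝ} (hρ : 0 < ρ)
    (hu : IsSubharmonicOn F (Metric.ball 0 ρ) u) {r : ℝ} (hr : 0 < r) (hrρ : r < ρ)
    (hfin : ∃ x, tangentialFlow p u r x ≠ ⊥ ∧ tangentialFlow p u r x ≠ ⊤) :
    ∃ b : ℝ, ∀ x, tangentialFlow p u r x = ((r ^ (p - 2) : ℝ) : EReal) * u (r • x) + b := by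
  obtain ⟨x₀, hx₀⟩ := hfin
  have ha : 0 < r ^ (p - 2) := Real.rpow_pos_of_pos hr _
  rcases lt_trichotomy p 2 with hp | rfl | hp
  · have e : 1 / r ^ (2 - p) = r ^ (p - 2) := by
      rw [one_div, ← Real.rpow_neg hr.le, neg_sub]
    have hflow : ∀ x, tangentialFlow p u r x = ((r ^ (p - 2) : ℝ) : EReal) * (u (r • x) - u 0) :=
      fun x => by rw [tangentialFlow, if_neg hp.not_gt, if_pos hp, e]
    induction h0 : u 0 with
    | bot =>
      rw [hflow, h0] at hx₀
      rcases EReal.sub_bot_eq (u (r • x₀)) with h | h <;> rw [h] at hx₀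
      · exact absurd (EReal.coe_mul_bot_of_pos ha) hx₀.1
      · exact absurd (EReal.coe_mul_top_of_pos ha) hx₀.2
    | top => exact absurd h0 (hu.ne_top 0 (Metric.mem_ball_self hρ))
    | coe c => exact ⟨_, fun x => by rw [hflow, h0, EReal.coe_mul_sub_coe ha]⟩
  · have hflow : ∀ x, tangentialFlow 2 u r x = u (r • x) - ballMax u r :=
      fun x => by rw [tangentialFlow, if_neg (lt_irrefl _), if_neg (lt_irrefl _)]
    induction h0 : ballMax u r with
    | bot =>
      rw [hflow, h0] at hx₀
      rcases EReal.sub_bot_eq (u (r • x₀)) with h | h <;> simp [h] at hx₀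
    | top =>
      have hsub : Metric.closedBall (0 : Euc n) r ⊆ Metric.ball 0 ρ :=
        Metric.closedBall_subset_ball hrρ
      obtain ⟨M, hM⟩ := exists_real_bound (isCompact_closedBall (0 : Euc n) r)
        (hu.usc.mono hsub) fun x hx => hu.ne_top x (hsub hx)
      have : ballMax u r ≤ M := iSup₂_le hM
      rw [h0] at this
      exact absurd this (EReal.coe_lt_top M).not_ge
    | coe c =>
      refine ⟨-c, fun x => ?_⟩
      rw [hflow, h0]
      simp [sub_eq_add_neg]
  · exact ⟨0, fun x => by rw [tangentialFlow, if_pos hp]; simp⟩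

theorem exists_isFastSeq (hF : RieszData F p) {u : Euc n → EReal} {ρ : ℝ} (hρ : 0 < ρ)
    (hu : IsSubharmonicOn F (Metric.ball 0 ρ) u) {U : Euc n → EReal}
    (hU : IsTangentAtZero p u U) :
    ∃ (Ubar : Euc n → ℝ) (r b : ℕ → ℝ), IsEssRep Ubar U ∧ (∀ k, 0 < r k) ∧
      Tendsto r atTop (𝓝 0) ∧
      IsFastSeq F (fun k x => ((r k ^ (p - 2) : ℝ) : EReal) * u (r k • x) + b k) Ubar := by
  obtain ⟨r, Ubar, hr, hr0, ⟨hloc, hconv⟩, hrep⟩ := hU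
  -- The first condition makes the rescaled function subharmonic on the ball of radius k + 1; the
  -- last is the rate required of a fast sequence.
  have key : ∀ k : ℕ, ∃ j, r j * (k + 1) < ρ ∧ r j < 1 / (k + 1) ∧
      ∫⁻ x in Metric.closedBall (0 : Euc n) (k + 1 : ℝ),
        (tangentialFlow p u (r j) x - (Ubar x : EReal)).abs < (2⁻¹ : ℝ≥0∞) ^ k := fun k => by
    have h1 : Tendsto (fun j => r j * (k + 1)) atTop (𝓝 0) := by simpa using hr0.mul_const (k + 1 : ℝ)
    have h2 : (0 : ℝ) < 1 / (k + 1) := by positivity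
    have h3 : (0 : ℝ≥0∞) < (2⁻¹ : ℝ≥0∞) ^ k := ENNReal.pow_pos (by simp) k
    exact ((h1.eventually (gt_mem_nhds hρ)).and ((hr0.eventually (gt_mem_nhds h2)).and
      ((hconv (k + 1) (by positivity)).eventually (gt_mem_nhds h3)))).exists
  choose j hj1 hj2 hj3 using key
  have hflow : ∀ k, ∃ b : ℝ, ∀ x, tangentialFlow p u (r (j k)) x =
      ((r (j k) ^ (p - 2) : ℝ) : EReal) * u (r (j k) • x) + b := fun k => by
    refine tangentialFlow_eq hρ hu (hr _) ?_ ?_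
    · refine lt_of_le_of_lt ?_ (hj1 k)
      have : (0 : ℝ) ≤ k := k.cast_nonneg
      nlinarith [hr (j k)]
    -- A flow without finite values is at infinite L¹ distance from the limit on a ball of positive
    -- measure.
    · by_contra! hcon
      have : ∀ x, (tangentialFlow p u (r (j k)) x - (Ubar x : EReal)).abs = ⊤ := fun x => by
        rw [EReal.abs_sub_coe, if_pos]
        by_cases hx : tangentialFlow p u (r (j k)) x = ⊥
        · exact Or.inl hx
        · exact Or.inr (hcon x hx)
      have h3 := hj3 k
      simp_rw [this] at h3
      rw [lintegral_const, Measure.restrict_apply_univ,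
        ENNReal.top_mul (Metric.measure_closedBall_pos volume 0 (by positivity)).ne'] at h3
      exact not_top_lt h3
  choose b hb using hflow
  refine ⟨Ubar, fun k => r (j k), b, hrep, fun k => hr _, ?_, hloc, fun k => ?_, fun k => ?_⟩
  · exact squeeze_zero (fun k => (hr _).le) (fun k => (hj2 k).le)
      tendsto_one_div_add_atTop_nhds_zero_nat
  · have h1 := ((hu.comp_smul_add hF.cone (hr (j k)).ne' 0).mul_add_const hF.cone
      (Real.rpow_pos_of_pos (hr (j k)) (p - 2)) (b k)).mono (Y := Metric.ball 0 (k + 1)) fun x hx => by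
        rw [mem_ball_zero_iff] at hx
        have h2 := hj1 k
        have h3 := mul_lt_mul_of_pos_left hx (hr (j k))
        simp only [add_zero, mem_preimage, mem_ball_zero_iff, norm_smul, Real.norm_eq_abs,
          abs_of_pos (hr (j k))]
        exact h3.trans h2
    simpa using h1
  · simp_rw [← hb]
    exact (lintegral_mono_set (Metric.closedBall_subset_closedBall (by linarith))).trans (hj3 k).le

/-! ### Orbit means of tangents -/

variable {m : Measure (Euc n →L[ℝ] Euc n)}

lemma IsStabMeasure.ae_norm (hm : IsStabMeasure F m) : ∀ᵐ T ∂m, ∀ x, ‖T x‖ = ‖x‖ := by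
  filter_upwards [hm.mem] with T ⟨g, hg, hT⟩ x
  rw [hT, norm_rot hg.1]

lemma IsStabMeasure.ae_ae (hm : IsStabMeasure F m) {P : Euc n → Prop} (h : ∀ᵐ x, P x) :
    ∀ᵐ x, ∀ᵐ T ∂m, P (T x) := by
  have := hm.prob
  exact Measure.ae_ae_of_ae_prod (hm.measurePreserving_act.quasiMeasurePreserving.ae h)

lemma IsStabMeasure.ae_integrable (hm : IsStabMeasure F m) {f : Euc n → ℝ} (hf : Integrable f) :
    ∀ᵐ x, Integrable (fun T => f (T x)) m := by
  have := hm.prob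
  exact (hm.measurePreserving_act.integrable_comp_of_integrable hf).prod_right_ae

lemma IsStabMeasure.ae_integrable_of_locallyIntegrable (hm : IsStabMeasure F m) {f : Euc n → ℝ}
    (hf : LocallyIntegrable f) : ∀ᵐ x, Integrable (fun T => f (T x)) m := by
  have h1 : ∀ᵐ x, ∀ k : ℕ,
      Integrable (fun T => (Metric.closedBall (0 : Euc n) k).indicator f (T x)) m :=
    ae_all_iff.2 fun k => hm.ae_integrable
      ((integrable_indicator_iff Metric.isClosed_closedBall.measurableSet).2
        (LocallyIntegrable.integrableOn_closedBall' hf 0 k))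
  filter_upwards [h1] with x hx
  obtain ⟨k, hk⟩ := exists_nat_ge ‖x‖
  refine (hx k).congr ?_
  filter_upwards [hm.ae_norm] with T hT
  exact indicator_of_mem (by rw [mem_closedBall_zero_iff, hT]; exact hk) f

lemma IsStabMeasure.aemeasurable_orbitAvg (hm : IsStabMeasure F m) {v : Euc n → ℝ≥0∞}
    (hv : AEMeasurable v) : AEMeasurable (orbitAvg m v) := by
  have := hm.prob
  exact (hv.comp_quasiMeasurePreserving
    hm.measurePreserving_act.quasiMeasurePreserving).lintegral_prod_right'

/-- The mean of `f` over the orbit of `x` converges absolutely. -/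
structure HasOrbitMean (m : Measure (Euc n →L[ℝ] Euc n)) (f : Euc n → EReal) (x : Euc n) :
    Prop where
  integrable : Integrable (fun T => (f (T x)).toReal) m
  finite : ∀ᵐ T ∂m, f (T x) ≠ ⊥ ∧ f (T x) ≠ ⊤

/-- The mean of `f` over the orbit of `x`. -/
noncomputable def orbitMean (m : Measure (Euc n →L[ℝ] Euc n)) (f : Euc n → EReal) (x : Euc n) :
    ℝ := ∫ T, (f (T x)).toReal ∂m

/-- Averaging preserves L¹ norms, so the orbit averages of the errors again have summable integrals
and tend to zero almost everywhere. Infinite values of `uk k` form a null set in the ball of radius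
k and are not seen on almost every orbit. -/
lemma IsFastSeq.ae_orbitMean (h : IsFastSeq F uk Ubar) (hm : IsStabMeasure F m) :
    ∀ᵐ x, (∀ᶠ k in atTop, HasOrbitMean m (uk k) x) ∧
      Tendsto (fun k => orbitMean m (uk k) x) atTop (𝓝 (∫ T, Ubar (T x) ∂m)) := by
  set g : ℕ → Euc n → ℝ := fun k =>
    (Metric.closedBall (0 : Euc n) k).indicator fun x => (uk k x).toReal - Ubar x with hg
  have hfin : ∀ k, ∀ᵐ x, seqErr uk Ubar k x < ⊤ := fun k =>
    ae_lt_top' (h.aemeasurable_seqErr k) (ne_top_of_le_ne_top (by simp) (h.lintegral_seqErr_le k))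
  have hfin' : ∀ k : ℕ, ∀ᵐ x, ‖x‖ ≤ k → uk k x ≠ ⊥ ∧ uk k x ≠ ⊤ := fun k => by
    filter_upwards [hfin k] with x hx hxk
    rw [seqErr_of_mem hxk, EReal.abs_sub_coe] at hx
    split_ifs at hx with hc
    · exact absurd hx (lt_irrefl _)
    · exact not_or.1 hc
  have hgerr : ∀ k, (fun x => ‖g k x‖ₑ) =ᵐ[volume] seqErr uk Ubar k := fun k => by
    filter_upwards [hfin' k] with x hx
    by_cases hxk : ‖x‖ ≤ k
    · rw [seqErr_of_mem hxk, EReal.abs_sub_coe, if_neg (not_or.2 (hx hxk)), hg]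
      simp only
      rw [indicator_of_mem (mem_closedBall_zero_iff.2 hxk), Real.enorm_eq_ofReal_abs]
    · have : x ∉ Metric.closedBall (0 : Euc n) k := by rwa [mem_closedBall_zero_iff]
      simp [hg, seqErr, indicator_of_notMem this]
  have hgm : ∀ k, AEMeasurable (g k) := fun k => by
    rw [hg, aemeasurable_indicator_iff Metric.isClosed_closedBall.measurableSet]
    exact ((aemeasurable_of_upperSemicontinuousOn Metric.isOpen_ball (h.sub k).usc).mono_set
      (Metric.closedBall_subset_ball (by linarith))).ereal_toReal.sub
        h.loc.aestronglyMeasurable.aemeasurable.restrict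
  have hgl : ∀ k, ∫⁻ x, ‖g k x‖ₑ ≤ (2⁻¹ : ℝ≥0∞) ^ k := fun k => by
    rw [lintegral_congr_ae (hgerr k)]; exact h.lintegral_seqErr_le k
  have hgi : ∀ k, Integrable (g k) := fun k =>
    ⟨(hgm k).aestronglyMeasurable, (hgl k).trans_lt (lt_top_iff_ne_top.2 (by simp))⟩
  have hsum : ∀ᵐ x, ∑' k, orbitAvg m (fun x => ‖g k x‖ₑ) x < ⊤ := by
    refine ae_lt_top' (AEMeasurable.tsum fun k => hm.aemeasurable_orbitAvg (hgm k).enorm) ?_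
    rw [lintegral_tsum fun k => hm.aemeasurable_orbitAvg (hgm k).enorm]
    refine ne_top_of_le_ne_top tsum_two_inv_pow_ne_top (ENNReal.tsum_le_tsum fun k => ?_)
    rw [hm.lintegral_orbitAvg (hgm k).enorm]
    exact hgl k
  filter_upwards [hsum, hm.ae_integrable_of_locallyIntegrable h.loc,
    ae_all_iff.2 fun k => hm.ae_integrable (hgi k), ae_all_iff.2 fun k => hm.ae_ae (hfin' k)]
    with x hx hUx hgx hfx
  have hEq : ∀ k : ℕ, ‖x‖ ≤ k →
      (fun T => (uk k (T x)).toReal) =ᵐ[m] fun T => g k (T x) + Ubar (T x) := fun k hk => by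
    filter_upwards [hm.ae_norm] with T hT
    have : T x ∈ Metric.closedBall (0 : Euc n) k := by rwa [mem_closedBall_zero_iff, hT]
    simp [hg, indicator_of_mem this]
  have hev : ∀ᶠ k : ℕ in atTop, ‖x‖ ≤ k := by simpa using eventually_norm_le x 0
  constructor
  · filter_upwards [hev] with k hk
    refine ⟨((hgx k).add hUx).congr (hEq k hk).symm, ?_⟩
    filter_upwards [hm.ae_norm, hfx k] with T hT hfT
    exact hfT (by rwa [hT])
  · have h0 : Tendsto (fun k => ∫ T, g k (T x) ∂m) atTop (𝓝 0) := by
      have h1 := ENNReal.tendsto_atTop_zero_of_tsum_ne_top hx.ne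
      rw [tendsto_zero_iff_norm_tendsto_zero]
      refine squeeze_zero (fun k => norm_nonneg _) (fun k => ?_)
        ((ENNReal.tendsto_toReal ENNReal.zero_ne_top).comp h1)
      simp only [Function.comp_apply, orbitAvg]
      refine (norm_integral_le_integral_norm _).trans ?_
      rw [integral_norm_eq_lintegral_enorm (hgx k).aestronglyMeasurable]
    have h2 : Tendsto (fun k => ∫ T, g k (T x) ∂m + ∫ T, Ubar (T x) ∂m) atTop
        (𝓝 (∫ T, Ubar (T x) ∂m)) := by simpa using h0.add_const (∫ T, Ubar (T x) ∂m)
    refine h2.congr' ?_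
    filter_upwards [hev] with k hk
    rw [orbitMean, integral_congr_ae (hEq k hk), integral_add (hgx k) hUx]

/-- Translates between averages in [0, ∞] and real means; the second conclusion ensures that
`ENNReal.ofReal` truncates nothing. -/
lemma HasOrbitMean.orbitAvg_pot {f : Euc n → EReal} {x : Euc n} (hfx : HasOrbitMean m f x)
    (hm : IsStabMeasure F m) {r₁ r₂ M : ℝ} (h₁ : r₁ < ‖x‖) (h₂ : ‖x‖ < r₂)
    (hM : ∀ y ∈ {y : Euc n | r₁ < ‖y‖ ∧ ‖y‖ < r₂}, f y ≤ M) :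
    orbitAvg m (pot {y | r₁ < ‖y‖ ∧ ‖y‖ < r₂} M f) x = ENNReal.ofReal (M - orbitMean m f x) ∧
      orbitMean m f x ≤ M := by
  have := hm.prob
  have hT : ∀ᵐ T ∂m, f (T x) = ((f (T x)).toReal : EReal) ∧ T x ∈ {y | r₁ < ‖y‖ ∧ ‖y‖ < r₂} ∧
      (f (T x)).toReal ≤ M := by
    filter_upwards [hfx.finite, hm.ae_norm] with T hfT hT
    have e := (EReal.coe_toReal hfT.2 hfT.1).symm
    have hmem : T x ∈ {y : Euc n | r₁ < ‖y‖ ∧ ‖y‖ < r₂} := by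
      rw [mem_ofPred_eq, hT]; exact ⟨h₁, h₂⟩
    refine ⟨e, hmem, ?_⟩
    have := hM _ hmem
    rw [e] at this
    exact EReal.coe_le_coe_iff.1 this
  have hint : Integrable (fun T => M - (f (T x)).toReal) m :=
    (integrable_const M).sub hfx.integrable
  have hval : ∫ T, (M - (f (T x)).toReal) ∂m = M - orbitMean m f x := by
    rw [integral_sub (integrable_const M) hfx.integrable, orbitMean]; simp
  have hnn : 0 ≤ᵐ[m] fun T => M - (f (T x)).toReal := by
    filter_upwards [hT] with T hT using sub_nonneg.2 hT.2.2
  refine ⟨?_, ?_⟩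
  · rw [← hval, ofReal_integral_eq_lintegral_ofReal hint hnn]
    refine lintegral_congr_ae ?_
    filter_upwards [hT] with T hT
    exact pot_coe hT.2.1 hT.1
  · have := integral_nonneg_of_ae hnn
    rw [hval] at this
    linarith

/-- This is the concavity for M - u, applied to the affine function with coefficients -α and M - β.
-/
lemma RieszData.orbitMean_convex (h : RieszData F p) (hm : IsStabMeasure F m) {ρ : ℝ}
    {u : Euc n → EReal} (hu : IsSubharmonicOn F (Metric.ball 0 ρ) u) {a x b : Euc n}
    (h0 : a ≠ 0) (hax : ‖a‖ < ‖x‖) (hxb : ‖x‖ < ‖b‖) (hbρ : ‖b‖ < ρ)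
    (ga : HasOrbitMean m u a) (gx : HasOrbitMean m u x) (gb : HasOrbitMean m u b) {α β : ℝ}
    (ha : orbitMean m u a ≤ α * rieszK p ‖a‖ + β) (hb : orbitMean m u b ≤ α * rieszK p ‖b‖ + β) :
    orbitMean m u x ≤ α * rieszK p ‖x‖ + β := by
  obtain ⟨r₂, hr, hrρ⟩ := exists_between hbρ
  have hsub : Metric.closedBall (0 : Euc n) r₂ ⊆ Metric.ball 0 ρ :=
    Metric.closedBall_subset_ball hrρ
  obtain ⟨M, hM⟩ := exists_real_bound (isCompact_closedBall (0 : Euc n) r₂)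
    (hu.usc.mono hsub) fun x hx => hu.ne_top x (hsub hx)
  have hΩ : {y : Euc n | 0 < ‖y‖ ∧ ‖y‖ < r₂} ⊆ Metric.closedBall 0 r₂ := fun y hy =>
    mem_closedBall_zero_iff.2 hy.2.le
  have hMΩ : ∀ y ∈ {y : Euc n | 0 < ‖y‖ ∧ ‖y‖ < r₂}, u y ≤ M := fun y hy => hM y (hΩ hy)
  have h0a := norm_pos_iff.2 h0
  obtain ⟨ea, -⟩ := ga.orbitAvg_pot hm h0a ((hax.trans hxb).trans hr) hMΩ
  obtain ⟨ex, hx⟩ := gx.orbitAvg_pot hm (h0a.trans hax) (hxb.trans hr) hMΩ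
  obtain ⟨eb, -⟩ := gb.orbitAvg_pot hm ((h0a.trans hax).trans hxb) hr hMΩ
  have key := h.orbitAvg_concave hm le_rfl (hu.mono (hΩ.trans hsub)) hMΩ (α := -α) (β := M - β)
    h0a hax hxb hr (by rw [ea]; exact ENNReal.ofReal_le_ofReal (by linarith))
    (by rw [eb]; exact ENNReal.ofReal_le_ofReal (by linarith))
  rw [ex, ENNReal.ofReal_le_ofReal_iff (by linarith)] at key
  linarith

/-- The difference quotient of `A` with respect to `rieszK`. -/
noncomputable def rieszSlope (p : ℝ) (A : Euc n → ℝ) (x y : Euc n) : ℝ :=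
  (A y - A x) / (rieszK p ‖y‖ - rieszK p ‖x‖)

lemma rieszK_sub_pos (p : ℝ) {x y : Euc n} (hx : x ≠ 0) (hxy : ‖x‖ < ‖y‖) :
    0 < rieszK p ‖y‖ - rieszK p ‖x‖ :=
  sub_pos.2 (rieszK_strictMonoOn p (norm_pos_iff.2 hx) ((norm_pos_iff.2 hx).trans hxy) hxy)

/-- Both slopes are compared with that of the chord over the long interval, as for any convex
function of one variable. -/
lemma RieszData.rieszSlope_adjacent (h : RieszData F p) (hm : IsStabMeasure F m) {ρ : ℝ}
    {u : Euc n → EReal} (hu : IsSubharmonicOn F (Metric.ball 0 ρ) u) {a x b : Euc n}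
    (h0 : a ≠ 0) (hax : ‖a‖ < ‖x‖) (hxb : ‖x‖ < ‖b‖) (hbρ : ‖b‖ < ρ)
    (ga : HasOrbitMean m u a) (gx : HasOrbitMean m u x) (gb : HasOrbitMean m u b) :
    rieszSlope p (orbitMean m u) a x ≤ rieszSlope p (orbitMean m u) x b := by
  have hx0 : x ≠ 0 := norm_pos_iff.1 ((norm_pos_iff.2 h0).trans hax)
  have k1 := rieszK_sub_pos p h0 hax
  have k2 := rieszK_sub_pos p hx0 hxb
  have k3 := rieszK_sub_pos p h0 (hax.trans hxb)
  set α := rieszSlope p (orbitMean m u) a b with hα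
  have e : α * (rieszK p ‖b‖ - rieszK p ‖a‖) = orbitMean m u b - orbitMean m u a := by
    rw [hα, rieszSlope, div_mul_cancel₀ _ k3.ne']
  have := h.orbitMean_convex hm hu h0 hax hxb hbρ ga gx gb (α := α)
    (β := orbitMean m u a - α * rieszK p ‖a‖) (by linarith) (by linarith)
  calc rieszSlope p (orbitMean m u) a x ≤ α := by rw [rieszSlope, div_le_iff₀ k1]; linarith
    _ ≤ _ := by rw [rieszSlope, le_div_iff₀ k2]; linarith

lemma RieszData.rieszSlope_le (h : RieszData F p) (hm : IsStabMeasure F m) {ρ : ℝ}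
    {u : Euc n → EReal} (hu : IsSubharmonicOn F (Metric.ball 0 ρ) u) {a b c d : Euc n}
    (h0 : a ≠ 0) (hab : ‖a‖ < ‖b‖) (hbc : ‖b‖ < ‖c‖) (hcd : ‖c‖ < ‖d‖) (hdρ : ‖d‖ < ρ)
    (ga : HasOrbitMean m u a) (gb : HasOrbitMean m u b) (gc : HasOrbitMean m u c)
    (gd : HasOrbitMean m u d) :
    rieszSlope p (orbitMean m u) a b ≤ rieszSlope p (orbitMean m u) c d :=
  (h.rieszSlope_adjacent hm hu h0 hab hbc (hcd.trans hdρ) ga gb gc).trans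
    (h.rieszSlope_adjacent hm hu (norm_pos_iff.1 ((norm_pos_iff.2 h0).trans hab)) hbc hcd hdρ
      gb gc gd)

lemma hasOrbitMean_scale {u : Euc n → EReal} {a b r : ℝ} (ha : 0 < a) {x : Euc n}
    (h : HasOrbitMean m (fun x => (a : EReal) * u (r • x) + b) x) [IsProbabilityMeasure m] :
    HasOrbitMean m u (r • x) ∧
      orbitMean m (fun x => (a : EReal) * u (r • x) + b) x = a * orbitMean m u (r • x) + b := by
  have hfin : ∀ᵐ T ∂m, u (T (r • x)) ≠ ⊥ ∧ u (T (r • x)) ≠ ⊤ := by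
    filter_upwards [h.finite] with T hT
    rw [map_smul]
    constructor <;> intro hc <;> rw [hc] at hT
    · simp [EReal.coe_mul_bot_of_pos ha] at hT
    · simp [EReal.coe_mul_top_of_pos ha] at hT
  have he : (fun T : Euc n →L[ℝ] Euc n => ((a : EReal) * u (r • T x) + b).toReal) =ᵐ[m]
      fun T => a * (u (T (r • x))).toReal + b := by
    filter_upwards [hfin] with T hT
    rw [map_smul] at hT ⊢
    obtain ⟨t, ht⟩ : ∃ t : ℝ, u (r • T x) = t := ⟨_, (EReal.coe_toReal hT.2 hT.1).symm⟩
    rw [ht]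
    norm_cast
  have hi : Integrable (fun T : Euc n →L[ℝ] Euc n => a * (u (T (r • x))).toReal + b) m :=
    h.integrable.congr he
  have hi' : Integrable (fun T : Euc n →L[ℝ] Euc n => (u (T (r • x))).toReal) m := by
    refine ((hi.sub (integrable_const b)).const_mul a⁻¹).congr (Eventually.of_forall fun T => ?_)
    simp only [Pi.sub_apply]
    field_simp
    ring
  refine ⟨⟨hi', hfin⟩, ?_⟩
  rw [orbitMean, integral_congr_ae he, integral_add (hi'.const_mul a) (integrable_const b),
    integral_const_mul, orbitMean]
  simp

lemma rieszSlope_scale {u : Euc n → EReal} {b r : ℝ} (hr : 0 < r) {x y : Euc n}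
    (hx : x ≠ 0) (hy : y ≠ 0)
    (gx : HasOrbitMean m (fun x => ((r ^ (p - 2) : ℝ) : EReal) * u (r • x) + b) x)
    (gy : HasOrbitMean m (fun x => ((r ^ (p - 2) : ℝ) : EReal) * u (r • x) + b) y)
    [IsProbabilityMeasure m] :
    rieszSlope p (orbitMean m (fun x => ((r ^ (p - 2) : ℝ) : EReal) * u (r • x) + b)) x y =
      rieszSlope p (orbitMean m u) (r • x) (r • y) := by
  have ha : 0 < r ^ (p - 2) := Real.rpow_pos_of_pos hr _
  rw [rieszSlope, rieszSlope, (hasOrbitMean_scale ha gx).2, (hasOrbitMean_scale ha gy).2,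
    norm_smul, norm_smul, Real.norm_eq_abs, abs_of_pos hr,
    rieszK_scale p hr (norm_pos_iff.2 hy) (norm_pos_iff.2 hx)]
  have e : r ^ (2 - p) = (r ^ (p - 2))⁻¹ := by rw [← Real.rpow_neg hr.le, neg_sub]
  rw [e]
  field_simp
  ring

/-- The orbit means of a tangent are affine functions of `rieszK`. -/
theorem exists_orbitMean_eq (hF : RieszData F p) (hm : IsStabMeasure F m) {u : Euc n → EReal}
    {ρ : ℝ} (hρ : 0 < ρ) (hu : IsSubharmonicOn F (Metric.ball 0 ρ) u) {r b : ℕ → ℝ}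
    (hr : ∀ k, 0 < r k) (hr0 : Tendsto r atTop (𝓝 0))
    (h : IsFastSeq F (fun k x => ((r k ^ (p - 2) : ℝ) : EReal) * u (r k • x) + b k) Ubar) :
    ∃ Θ c : ℝ, ∀ᵐ x, ∫ T, Ubar (T x) ∂m = Θ * rieszK p ‖x‖ + c := by
  have := hm.prob
  set uk : ℕ → Euc n → EReal := fun k x => ((r k ^ (p - 2) : ℝ) : EReal) * u (r k • x) + b k
    with huk
  set Ψ : Euc n → ℝ := fun x => ∫ T, Ubar (T x) ∂m with hΨ
  set G : Set (Euc n) := {x | (∀ᶠ k in atTop, HasOrbitMean m (uk k) x) ∧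
      Tendsto (fun k => orbitMean m (uk k) x) atTop (𝓝 (Ψ x))} with hG
  have hGae : ∀ᵐ x, x ∈ G := h.ae_orbitMean hm
  have hlim : ∀ x ∈ G, ∀ y ∈ G,
      Tendsto (fun k => rieszSlope p (orbitMean m (uk k)) x y) atTop (𝓝 (rieszSlope p Ψ x y)) :=
    fun x hx y hy => (hy.2.sub hx.2).div_const _
  have hrn : ∀ (k : ℕ) (x : Euc n), ‖r k • x‖ = r k * ‖x‖ := fun k x => by
    rw [norm_smul, Real.norm_eq_abs, abs_of_pos (hr k)]
  -- Both slopes are limits of slopes of u itself, over pairs scaled by r l and r k. With k fixed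
  -- and l large, the first pair lies inside the second, so convexity compares them; then l and k
  -- tend to infinity. No order between the pairs is assumed, so exchanging them gives equality.
  have hle : ∀ a ∈ G, ∀ b ∈ G, ∀ c ∈ G, ∀ d ∈ G, a ≠ 0 → c ≠ 0 → ‖a‖ < ‖b‖ → ‖c‖ < ‖d‖ →
      rieszSlope p Ψ a b ≤ rieszSlope p Ψ c d := by
    intro a ha b' hb c hc d hd ha0 hc0 hab hcd
    have hb0 : b' ≠ 0 := norm_pos_iff.1 ((norm_pos_iff.2 ha0).trans hab)
    have hd0 : d ≠ 0 := norm_pos_iff.1 ((norm_pos_iff.2 hc0).trans hcd)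
    have hsmall : ∀ (z : Euc n) {ε : ℝ}, 0 < ε → ∀ᶠ k in atTop, r k * ‖z‖ < ε := fun z ε hε => by
      have : Tendsto (fun k => r k * ‖z‖) atTop (𝓝 0) := by simpa using hr0.mul_const ‖z‖
      exact this.eventually (gt_mem_nhds hε)
    refine ge_of_tendsto (hlim c hc d hd) ?_
    filter_upwards [hc.1, hd.1, hsmall d hρ] with k gc gd hdρ
    refine le_of_tendsto (hlim a ha b' hb) ?_
    filter_upwards [ha.1, hb.1, hsmall b' (mul_pos (hr k) (norm_pos_iff.2 hc0))] with l ga gb hlk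
    rw [rieszSlope_scale (hr l) ha0 hb0 ga gb, rieszSlope_scale (hr k) hc0 hd0 gc gd]
    have s := fun (k : ℕ) => Real.rpow_pos_of_pos (hr k) (p - 2)
    refine hF.rieszSlope_le hm hu (smul_ne_zero (hr l).ne' ha0) ?_ ?_ ?_ ?_
      (hasOrbitMean_scale (s l) ga).1 (hasOrbitMean_scale (s l) gb).1
      (hasOrbitMean_scale (s k) gc).1 (hasOrbitMean_scale (s k) gd).1
    · rw [hrn, hrn]; exact mul_lt_mul_of_pos_left hab (hr l)
    · rw [hrn, hrn]; exact hlk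
    · rw [hrn, hrn]; exact mul_lt_mul_of_pos_left hcd (hr k)
    · rw [hrn]; exact hdρ
  have hex : ∀ (y : Euc n), ∃ x ∈ G, x ∈ Metric.ball y 1 := fun y => by
    by_contra! hcon
    have h1 : volume (Metric.ball y 1) = 0 := measure_mono_null (fun x hx hxG => hcon x hxG hx) hGae
    exact (Metric.measure_ball_pos volume y one_pos).ne' h1
  obtain ⟨e, he⟩ := exists_unit_vector hF.pos_dim
  -- Two reference points of full regularity, with ‖x₀‖ ≤ 3 < 4 ≤ ‖x₁‖. Their slope is the constant
  -- Θ.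
  obtain ⟨x₀, hx₀, hx₀b⟩ := hex ((2 : ℝ) • e)
  obtain ⟨x₁, hx₁, hx₁b⟩ := hex ((5 : ℝ) • e)
  rw [mem_ball_iff_norm] at hx₀b hx₁b
  have n0 := abs_le.1 ((abs_norm_sub_norm_le x₀ ((2 : ℝ) • e)).trans hx₀b.le)
  have n1 := abs_le.1 ((abs_norm_sub_norm_le x₁ ((5 : ℝ) • e)).trans hx₁b.le)
  rw [norm_smul, he] at n0 n1
  norm_num at n0 n1
  have hx₀0 : x₀ ≠ 0 := norm_pos_iff.1 (by linarith)
  have h01 : ‖x₀‖ < ‖x₁‖ := by linarith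
  refine ⟨rieszSlope p Ψ x₀ x₁, Ψ x₀ - rieszSlope p Ψ x₀ x₁ * rieszK p ‖x₀‖, ?_⟩
  have hs : ∀ᵐ x : Euc n, x ∉ Metric.sphere (0 : Euc n) ‖x₀‖ :=
    measure_eq_zero_iff_ae_notMem.1
      (Measure.addHaar_sphere_of_ne_zero volume 0 (norm_ne_zero_iff.2 hx₀0))
  have hne0 : ∀ᵐ x : Euc n, x ≠ 0 := by
    have : Nontrivial (Euc n) := ⟨⟨x₀, 0, hx₀0⟩⟩
    exact measure_eq_zero_iff_ae_notMem.1 (measure_singleton (0 : Euc n))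
  filter_upwards [hGae, hs, hne0] with x hx hxs hx0
  rw [mem_sphere_zero_iff_norm] at hxs
  change Ψ x = _
  rcases lt_or_gt_of_ne hxs with hlt | hgt
  · have e1 : rieszSlope p Ψ x x₀ = rieszSlope p Ψ x₀ x₁ :=
      le_antisymm (hle _ hx _ hx₀ _ hx₀ _ hx₁ hx0 hx₀0 hlt h01)
        (hle _ hx₀ _ hx₁ _ hx _ hx₀ hx₀0 hx0 h01 hlt)
    have k1 := rieszK_sub_pos p hx0 hlt
    rw [← e1]
    have : rieszSlope p Ψ x x₀ * (rieszK p ‖x₀‖ - rieszK p ‖x‖) = Ψ x₀ - Ψ x := by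
      rw [rieszSlope, div_mul_cancel₀ _ k1.ne']
    linarith
  · have e1 : rieszSlope p Ψ x₀ x = rieszSlope p Ψ x₀ x₁ :=
      le_antisymm (hle _ hx₀ _ hx _ hx₀ _ hx₁ hx₀0 hx₀0 hgt h01)
        (hle _ hx₀ _ hx₁ _ hx₀ _ hx hx₀0 hx₀0 h01 hgt)
    have k1 := rieszK_sub_pos p hx₀0 hgt
    rw [← e1]
    have : rieszSlope p Ψ x₀ x * (rieszK p ‖x‖ - rieszK p ‖x₀‖) = Ψ x - Ψ x₀ := by
      rw [rieszSlope, div_mul_cancel₀ _ k1.ne']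
    linarith

/-! ### Maximality of tangents -/

lemma isOpen_annulus (s t : ℝ) : IsOpen {y : Euc n | s < ‖y‖ ∧ ‖y‖ < t} :=
  (isOpen_lt continuous_const continuous_norm).inter (isOpen_lt continuous_norm continuous_const)

lemma exists_mem_annulus_of_ae (hn : 0 < n) {P : Euc n → Prop} (hP : ∀ᵐ x, P x) {s t : ℝ}
    (hs : 0 ≤ s) (hst : s < t) : ∃ y, P y ∧ s < ‖y‖ ∧ ‖y‖ < t := by
  obtain ⟨e, he⟩ := exists_unit_vector hn
  have hne : {y : Euc n | s < ‖y‖ ∧ ‖y‖ < t}.Nonempty := by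
    refine ⟨((s + t) / 2) • e, ?_⟩
    rw [mem_ofPred_eq, norm_smul, he, Real.norm_eq_abs, abs_of_nonneg (by linarith)]
    constructor <;> linarith
  by_contra! hcon
  have h0 : volume {y : Euc n | s < ‖y‖ ∧ ‖y‖ < t} = 0 :=
    measure_mono_null (fun x hx hPx => (hcon x hPx hx.1).not_gt hx.2) hP
  exact ((isOpen_annulus s t).measure_pos volume hne).ne' h0

lemma IsFastSeq.ae_orbitMean_rep (h : IsFastSeq F uk Ubar) (hF : RieszData F p)
    (hm : IsStabMeasure F m) (hU : IsEssRep Ubar U) :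
    ∀ᵐ x, HasOrbitMean m U x ∧ orbitMean m U x = ∫ T, Ubar (T x) ∂m := by
  filter_upwards [hm.ae_ae (h.ae_eq hF hU), hm.ae_integrable_of_locallyIntegrable h.loc]
    with x hx hi
  have he : (fun T : Euc n →L[ℝ] Euc n => (U (T x)).toReal) =ᵐ[m] fun T => Ubar (T x) := by
    filter_upwards [hx] with T hT
    rw [hT, EReal.toReal_coe]
  refine ⟨⟨hi.congr he.symm, ?_⟩, integral_congr_ae he⟩
  filter_upwards [hx] with T hT
  rw [hT]
  exact ⟨EReal.coe_ne_bot _, EReal.coe_ne_top _⟩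

lemma IsStabMeasure.orbitAvg_indicator (hm : IsStabMeasure F m) (s t : ℝ) (v : Euc n → ℝ≥0∞)
    (x : Euc n) : orbitAvg m ({y : Euc n | s < ‖y‖ ∧ ‖y‖ < t}.indicator v) x =
      {y : Euc n | s < ‖y‖ ∧ ‖y‖ < t}.indicator (orbitAvg m v) x := by
  by_cases hx : x ∈ {y : Euc n | s < ‖y‖ ∧ ‖y‖ < t}
  · rw [indicator_of_mem hx]
    refine lintegral_congr_ae ?_
    filter_upwards [hm.ae_norm] with T hT
    exact indicator_of_mem (by rw [mem_ofPred_eq, hT]; exact hx) v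
  · rw [indicator_of_notMem hx, orbitAvg, ← lintegral_zero (μ := m)]
    refine lintegral_congr_ae ?_
    filter_upwards [hm.ae_norm] with T hT
    exact indicator_of_notMem (by rw [mem_ofPred_eq, hT]; exact hx) v

/-- If U(x) < c < w(x), then U < c near x by semicontinuity, so M - w ≥ M - c almost everywhere near
x. The mean value inequality on a small ball gives w(x) ≤ c. -/
lemma le_of_ae_eq_pot (hF : RieszData F p) {Ω D : Set (Euc n)} (hΩ : IsOpen Ω) (hD : IsOpen D)
    (hDΩ : D ⊆ Ω) {w : Euc n → EReal} (hw : IsSubharmonicOn F Ω w) {M : ℝ}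
    (hM : ∀ x ∈ Ω, w x ≤ M) (hU : UpperSemicontinuousOn U Ω) (hUM : ∀ x ∈ Ω, U x ≤ M)
    (hae : ∀ᵐ x, x ∈ D → pot Ω M w x = pot Ω M U x) {x : Euc n} (hx : x ∈ D) : w x ≤ U x := by
  obtain ⟨m, hm⟩ := exists_isStabMeasure hF.sub.closed
  by_contra! hlt
  obtain ⟨c, hc1, hc2⟩ := EReal.lt_iff_exists_real_btwn.1 hlt
  have hev : ∀ᶠ y in 𝓝 x, U y < c ∧ y ∈ D := by
    have := hU x (hDΩ hx) c hc1
    rw [nhdsWithin_eq_nhds.2 (hΩ.mem_nhds (hDΩ hx))] at this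
    exact this.and (hD.mem_nhds hx)
  obtain ⟨s, hs, hsB⟩ := Metric.nhds_basis_closedBall.eventually_iff.1 hev
  have hV := (Metric.measure_closedBall_pos volume x hs).ne'
  have hV' : volume (Metric.closedBall x s) ≠ ⊤ := measure_closedBall_lt_top.ne
  have h1 := hF.setLIntegral_pot_le hm hΩ hw hM (x := x) (s := s) fun y hy => hDΩ (hsB hy).2
  have h2 : volume (Metric.closedBall x s) * ENNReal.ofReal (M - c) ≤
      ∫⁻ z in Metric.closedBall x s, pot Ω M w z := by
    rw [mul_comm, ← setLIntegral_const]
    refine lintegral_mono_ae ?_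
    filter_upwards [ae_restrict_of_ae hae, ae_restrict_mem Metric.isClosed_closedBall.measurableSet]
      with y hy hyB
    have hyD := (hsB hyB).2
    rw [hy hyD, le_pot_iff (hDΩ hyD) (hUM y (hDΩ hyD)), sub_sub_cancel]
    exact (hsB hyB).1.le
  have h3 := (ENNReal.mul_le_mul_iff_right hV hV').1 (h2.trans h1)
  rw [le_pot_iff (hDΩ hx) (hM x (hDΩ hx)), sub_sub_cancel] at h3
  exact h3.not_gt hc2

/-- Concavity bounds the averages of M - w from below by those of M - U, where w = max(U, v), while
M - w ≤ M - U pointwise. Their integrals over a shell therefore coincide, and so do the functions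
almost everywhere. -/
theorem IsFastSeq.isMaximalOn (h : IsFastSeq F uk Ubar) (hF : RieszData F p)
    (hm : IsStabMeasure F m) (hU : IsEssRep Ubar U) {Θ c : ℝ}
    (hΘ : ∀ᵐ x, ∫ T, Ubar (T x) ∂m = Θ * rieszK p ‖x‖ + c) :
    IsMaximalOn F {(0 : Euc n)}ᶜ U := by
  have := hm.prob
  have hUsub : IsSubharmonicOn F {(0 : Euc n)}ᶜ U := (h.isSubharmonicOn hF hU).mono (subset_univ _)
  refine ⟨hUsub, fun v hv K hK hKX hvU x hx => ?_⟩
  set w : Euc n → EReal := fun x => max (U x) (v x) with hwdef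
  have hw : IsSubharmonicOn F {(0 : Euc n)}ᶜ w := hUsub.sup hv
  have hwU : ∀ y, y ≠ 0 → y ∉ K → w y = U y := fun y hy hyK => max_eq_left (hvU y ⟨hy, hyK⟩)
  suffices hwx : w x ≤ U x from (le_max_right _ _).trans hwx
  -- Adjoining x to K makes the shell cover the point at which the inequality is wanted.
  have hK' : IsCompact (insert x K) := hK.insert x
  obtain ⟨y₀, hy₀, hmin⟩ := hK'.exists_isMinOn ⟨x, mem_insert x K⟩ continuous_norm.continuousOn
  obtain ⟨y₁, hy₁, hmax⟩ := hK'.exists_isMaxOn ⟨x, mem_insert x K⟩ continuous_norm.continuousOn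
  have hy₀0 : 0 < ‖y₀‖ := by
    rcases hy₀ with rfl | hy
    · exact norm_pos_iff.2 hx
    · exact norm_pos_iff.2 (hKX hy)
  have hgood : ∀ᵐ y, HasOrbitMean m U y ∧ orbitMean m U y = Θ * rieszK p ‖y‖ + c := by
    filter_upwards [h.ae_orbitMean_rep hF hm hU, hΘ] with y hy hy'
    exact ⟨hy.1, hy.2.trans hy'⟩
  -- The orbits of a and b lie on either side of `insert x K`, so w = U on them, and the averages of
  -- U there are given by the affine formula.
  obtain ⟨a, ga, ha₁, ha₂⟩ := exists_mem_annulus_of_ae hF.pos_dim hgood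
    (s := ‖y₀‖ / 2) (t := ‖y₀‖) (by positivity) (by linarith)
  obtain ⟨b, gb, hb₁, hb₂⟩ := exists_mem_annulus_of_ae hF.pos_dim hgood
    (s := ‖y₁‖) (t := ‖y₁‖ + 1) (by positivity) (by linarith)
  have hy₀₁ : ‖y₀‖ ≤ ‖y₁‖ := hmin hy₁
  set Ω : Set (Euc n) := {y | ‖y₀‖ / 2 < ‖y‖ ∧ ‖y‖ < ‖y₁‖ + 1} with hΩdef
  set D : Set (Euc n) := {y | ‖a‖ < ‖y‖ ∧ ‖y‖ < ‖b‖} with hDdef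
  have hΩ : IsOpen Ω := isOpen_annulus _ _
  have hD : IsOpen D := isOpen_annulus _ _
  have hDΩ : D ⊆ Ω := fun y hy => ⟨ha₁.trans hy.1, hy.2.trans hb₂⟩
  have hC : IsCompact {y : Euc n | ‖y₀‖ / 2 ≤ ‖y‖ ∧ ‖y‖ ≤ ‖y₁‖ + 1} := by
    refine (isCompact_closedBall (0 : Euc n) (‖y₁‖ + 1)).of_isClosed_subset
      ((isClosed_le continuous_const continuous_norm).inter
        (isClosed_le continuous_norm continuous_const)) fun y hy => ?_
    exact mem_closedBall_zero_iff.2 hy.2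
  have hC0 : {y : Euc n | ‖y₀‖ / 2 ≤ ‖y‖ ∧ ‖y‖ ≤ ‖y₁‖ + 1} ⊆ {(0 : Euc n)}ᶜ := fun y hy =>
    norm_pos_iff.1 (by linarith [hy.1])
  obtain ⟨M, hM⟩ := exists_real_bound hC (hw.usc.mono hC0) fun y hy => hw.ne_top y (hC0 hy)
  have hΩ0 : Ω ⊆ {(0 : Euc n)}ᶜ := fun y hy => hC0 ⟨hy.1.le, hy.2.le⟩
  have hMw : ∀ y ∈ Ω, w y ≤ M := fun y hy => hM y ⟨hy.1.le, hy.2.le⟩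
  have hMU : ∀ y ∈ Ω, U y ≤ M := fun y hy => (le_max_left _ _).trans (hMw y hy)
  have hnotK : ∀ y : Euc n, ‖y‖ < ‖y₀‖ ∨ ‖y₁‖ < ‖y‖ → y ∉ K := by
    rintro y (hy | hy) hyK
    · exact hy.not_ge (hmin (mem_insert_of_mem x hyK))
    · exact hy.not_ge (hmax (mem_insert_of_mem x hyK))
  have hedge : ∀ z : Euc n, z ≠ 0 → (‖z‖ < ‖y₀‖ ∨ ‖y₁‖ < ‖z‖) →
      orbitAvg m (pot Ω M w) z = orbitAvg m (pot Ω M U) z := fun z hz hzK => by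
    refine lintegral_congr_ae ?_
    filter_upwards [hm.ae_norm] with T hT
    have hTz : T z ≠ 0 := norm_pos_iff.1 (by rw [hT]; exact norm_pos_iff.2 hz)
    have e := hwU (T z) hTz (hnotK _ (by rwa [hT]))
    exact le_antisymm (pot_anti fun _ => e.ge) (pot_anti fun _ => e.le)
  have hval : ∀ z, (HasOrbitMean m U z ∧ orbitMean m U z = Θ * rieszK p ‖z‖ + c) → z ∈ Ω →
      orbitAvg m (pot Ω M U) z = ENNReal.ofReal (-Θ * rieszK p ‖z‖ + (M - c)) := fun z hz hzΩ => by
    rw [(hz.1.orbitAvg_pot hm hzΩ.1 hzΩ.2 hMU).1, hz.2]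
    congr 1
    ring
  have haΩ : a ∈ Ω := ⟨ha₁, by linarith⟩
  have hbΩ : b ∈ Ω := ⟨by linarith, hb₂⟩
  have hle : ∀ᵐ z, z ∈ D → orbitAvg m (pot Ω M U) z ≤ orbitAvg m (pot Ω M w) z := by
    filter_upwards [hgood] with z gz hz
    rw [hval z gz (hDΩ hz)]
    refine hF.orbitAvg_concave hm (by positivity) (hw.mono hΩ0) hMw ha₁ hz.1 hz.2 hb₂ ?_ ?_
    · rw [hedge a (hΩ0 haΩ) (Or.inl ha₂), hval a ga haΩ]
    · rw [hedge b (hΩ0 hbΩ) (Or.inr hb₁), hval b gb hbΩ]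
  have hmU : Measurable (pot Ω M U) :=
    (lowerSemicontinuous_pot hΩ M (hUsub.usc.mono hΩ0)).measurable
  have hmw : Measurable (pot Ω M w) :=
    (lowerSemicontinuous_pot hΩ M (hw.usc.mono hΩ0)).measurable
  have hwle : D.indicator (pot Ω M w) ≤ D.indicator (pot Ω M U) := fun y =>
    indicator_le_indicator' fun _ => pot_anti fun _ => le_max_left _ _
  -- Finiteness is what allows equality of integrals of ordered functions to give equality almost
  -- everywhere.
  have hfin : ∫⁻ y, D.indicator (pot Ω M U) y ≠ ⊤ := by
    have hi : IntegrableOn (fun y => M - Ubar y) (Metric.closedBall (0 : Euc n) ‖b‖) volume :=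
      (integrableOn_const measure_closedBall_lt_top.ne).sub
        (LocallyIntegrable.integrableOn_closedBall' h.loc 0 ‖b‖)
    have hDB : D ⊆ Metric.closedBall (0 : Euc n) ‖b‖ := fun y hy =>
      mem_closedBall_zero_iff.2 hy.2.le
    rw [lintegral_indicator hD.measurableSet]
    refine ne_top_of_le_ne_top (hi.mono_set hDB).hasFiniteIntegral.ne (lintegral_mono_ae ?_)
    filter_upwards [ae_restrict_of_ae (h.ae_eq hF hU), ae_restrict_mem hD.measurableSet]
      with y hy hyD
    rw [pot_coe (hDΩ hyD) hy]
    exact Real.ofReal_le_enorm _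
  have heq : D.indicator (pot Ω M w) =ᵐ[volume] D.indicator (pot Ω M U) := by
    refine ae_eq_of_ae_le_of_lintegral_le (Eventually.of_forall hwle)
      (ne_top_of_le_ne_top hfin (lintegral_mono hwle)) (hmU.indicator hD.measurableSet).aemeasurable ?_
    rw [← hm.lintegral_orbitAvg (hmU.indicator hD.measurableSet).aemeasurable,
      ← hm.lintegral_orbitAvg (hmw.indicator hD.measurableSet).aemeasurable]
    refine lintegral_mono_ae ?_
    filter_upwards [hle] with z hz
    rw [hm.orbitAvg_indicator, hm.orbitAvg_indicator]
    by_cases hzD : z ∈ D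
    · rw [indicator_of_mem hzD, indicator_of_mem hzD]
      exact hz hzD
    · rw [indicator_of_notMem hzD, indicator_of_notMem hzD]
  refine le_of_ae_eq_pot hF hΩ hD hDΩ (hw.mono hΩ0) hMw (hUsub.usc.mono hΩ0) hMU ?_
    (x := x) ⟨ha₂.trans_le (hmin (mem_insert x K)), (hmax (mem_insert x K)).trans_lt hb₁⟩
  filter_upwards [heq] with z hz hzD
  rwa [indicator_of_mem hzD, indicator_of_mem hzD] at hz

/-! ### Continuous maximal functions are harmonic -/

/-- A strict lower test function can be perturbed to a competitor. -/
lemma exists_strict_subharmonic (hF : IsSubequation F) {g : Euc n → ℝ} {x : Euc n}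
    (hg : ContDiffAt ℝ 2 g x) (hint : F ∈ 𝓝[symMat n] (hessian g x)) :
    ∃ η > 0, ∀ᶠ s in 𝓝[>] (0 : ℝ), ∀ d : ℝ, IsSubharmonicOn F (Metric.ball x s)
      (fun y => ((g y + -η * ‖y - x‖ ^ 2 + d : ℝ) : EReal)) := by
  obtain ⟨O, hO, hxO, hOF⟩ := mem_nhdsWithin.1 hint
  have h1 : Tendsto (fun η : ℝ => hessian g x + (2 * -η) • (1 : Mat n)) (𝓝[>] 0)
      (𝓝 (hessian g x)) := by
    have : Continuous fun η : ℝ => hessian g x + (2 * -η) • (1 : Mat n) := by fun_prop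
    simpa using (this.tendsto 0).mono_left nhdsWithin_le_nhds
  obtain ⟨η, hηO, hη⟩ := ((h1.eventually (hO.mem_nhds hxO)).and self_mem_nhdsWithin).exists
  refine ⟨η, hη, ?_⟩
  have h2 : ∀ᶠ y in 𝓝 x, ContDiffAt ℝ 2 g y ∧ hessian g y + (2 * -η) • (1 : Mat n) ∈ O :=
    (hg.eventually (by simp)).and
      (((continuousAt_hessian hg).add continuousAt_const).eventually (hO.mem_nhds hηO))
  obtain ⟨s₀, hs₀, hB⟩ := Metric.nhds_basis_ball.eventually_iff.1 h2
  filter_upwards [Ioo_mem_nhdsGT hs₀] with s hs d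
  have hd : ∀ y ∈ Metric.ball x s, ContDiffAt ℝ 2 (fun y => g y + -η * ‖y - x‖ ^ 2 + d) y :=
    fun y hy => ((hB (Metric.ball_subset_ball hs.2.le hy)).1.add
      (contDiffAt_quadratic _ x y)).add contDiffAt_const
  refine isSubharmonicOn_of_hessian_mem hF hd fun y hy => hOF ⟨?_, hessian_isSymm (hd y hy)⟩
  obtain ⟨h3, h4⟩ := hB (Metric.ball_subset_ball hs.2.le hy)
  rwa [hessian_add_const, hessian_add h3 (contDiffAt_quadratic _ x y), hessian_quadratic]

/-- If the dual condition failed at x, -φ would touch U from below with Hessian interior to F.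
Bending it down quadratically and raising it by ε keeps it subharmonic; its maximum with U near x
exceeds U at x but equals U off a compact ball. -/
theorem IsMaximalOn.isHarmonicOn (hF : IsSubequation F) {X : Set (Euc n)} (hX : IsOpen X)
    (h : IsMaximalOn F X U) (hbot : ∀ x ∈ X, U x ≠ ⊥) (hc : ContinuousOn U X) :
    IsHarmonicOn F X U := by
  refine ⟨h.1, (continuous_neg.comp_continuousOn hc).upperSemicontinuousOn, fun x hx => ?_,
    fun x hx φ hφ hxφ hle => ⟨hessian_isSymm hφ, fun hint => ?_⟩⟩
  · simpa [EReal.neg_eq_top_iff] using hbot x hx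
  rw [← hessian_neg] at hint
  obtain ⟨η, hη, hs⟩ := exists_strict_subharmonic hF hφ.neg hint
  have hle' : ∀ᶠ y in 𝓝 x, ((-φ y : ℝ) : EReal) ≤ U y ∧ y ∈ X := by
    refine (hle.mono fun y hy => ?_).and (hX.mem_nhds hx)
    rw [EReal.coe_neg]
    exact EReal.neg_le.1 hy
  obtain ⟨s₀, hs₀, hB⟩ := Metric.nhds_basis_ball.eventually_iff.1 hle'
  obtain ⟨s, hsub, hs0, hss₀⟩ := (hs.and (Ioo_mem_nhdsGT hs₀)).exists
  have hBs : ∀ y ∈ Metric.ball x s, ((-φ y : ℝ) : EReal) ≤ U y ∧ y ∈ X := fun y hy =>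
    hB (Metric.ball_subset_ball hss₀.le hy)
  -- Less than the quadratic drop ηs²/4 beyond radius s/2, so the competitor agrees with U there and
  -- gluing is harmless.
  set ε := η * (s ^ 2 / 8) with hε
  have hε0 : 0 < ε := by positivity
  set ψ : Euc n → EReal := fun y => ((-φ y + -η * ‖y - x‖ ^ 2 + ε : ℝ) : EReal) with hψe
  classical
  set v : Euc n → EReal := fun y => if y ∈ Metric.ball x s then max (U y) (ψ y) else U y with hv
  have hvU : ∀ y, s / 2 < ‖y - x‖ → v y = U y := fun y hy => by
    simp only [hv]
    split_ifs with hyB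
    · refine max_eq_left (le_trans ?_ (hBs y hyB).1)
      rw [EReal.coe_le_coe_iff]
      have : (s / 2) ^ 2 ≤ ‖y - x‖ ^ 2 := by gcongr
      nlinarith
    · rfl
  have hvsub : IsSubharmonicOn F X v := by
    refine IsSubharmonicOn.of_locally fun y hy => ?_
    by_cases hyB : y ∈ Metric.ball x s
    · have hnear : Metric.ball x s ∈ 𝓝 y := Metric.isOpen_ball.mem_nhds hyB
      refine ⟨fun z => max (U z) (ψ z), _, hnear,
        (h.1.mono fun z hz => (hBs z hz).2).sup (hsub ε), ?_⟩
      filter_upwards [hnear] with z hz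
      simp only [hv]
      rw [if_pos hz]
    · refine ⟨U, X, hX.mem_nhds hy, h.1, ?_⟩
      have hy' : s / 2 < ‖y - x‖ := by
        rw [mem_ball_iff_norm, not_lt] at hyB
        linarith
      have hcn : ContinuousAt (fun z : Euc n => ‖z - x‖) y := by fun_prop
      filter_upwards [hcn.eventually (lt_mem_nhds hy')] with z hz using hvU z hz
  have hmax := h.2 v hvsub (Metric.closedBall x (s / 2)) (isCompact_closedBall _ _)
    (fun y hy => (hBs y (Metric.closedBall_subset_ball (by linarith) hy)).2)
    (fun y hy => (hvU y (by simpa [dist_eq_norm] using hy.2)).le) x hx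
  have hvx : ψ x ≤ v x := by
    simp only [hv]
    rw [if_pos (Metric.mem_ball_self hs0)]
    exact le_max_right _ _
  have hUx : U x = ((-φ x : ℝ) : EReal) := by rw [EReal.coe_neg, ← hxφ, neg_neg]
  have := hvx.trans hmax
  rw [hUx, EReal.coe_le_coe_iff] at this
  simp only [sub_self, norm_zero] at this
  linarith

/-! ### Barriers and continuity for p < 2 -/

lemma kap_eq {q : ℝ} (hq : q < 2) (t : ℝ) : kap q t = t ^ (1 - q / 2) / (1 - q / 2) := by
  rw [kap, if_neg hq.ne]

lemma continuous_kap {q : ℝ} (hq : q < 2) : Continuous (kap q) := by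
  simp_rw [funext (kap_eq hq)]
  exact (Real.continuous_rpow_const (by linarith)).div_const _

lemma kap_zero {q : ℝ} (hq : q < 2) : kap q 0 = 0 := by
  rw [kap_eq hq, Real.zero_rpow (by linarith), zero_div]

lemma kap_pos {q t : ℝ} (hq : q < 2) (ht : 0 < t) : 0 < kap q t := by
  rw [kap_eq hq]
  exact div_pos (Real.rpow_pos_of_pos ht _) (by linarith)

/-- Away from the pole this Hessian is a positive multiple of `rieszMat e q`, with e the direction
from the pole; q exceeds p and F is a cone. -/
lemma RieszData.hessian_kap_notMem (h : RieszData F p) {q C : ℝ} (hpq : p < q) (hC : 0 < C)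
    {x y : Euc n} (hxy : x ≠ y) :
    hessian (fun z => C * kap q (‖z - y‖ ^ 2)) x ∉ F := by
  intro hmem
  have hpos : 0 < ‖x - y‖ := norm_pos_iff.2 (sub_ne_zero.2 hxy)
  have hpos2 : 0 < ‖x - y‖ ^ 2 := by positivity
  set θ := (‖x - y‖ ^ 2) ^ (-(q / 2)) with hθ
  have hθ0 : 0 < θ := Real.rpow_pos_of_pos hpos2 _
  have h1 := hessian_normSq (k := kap q) (k₁ := fun t => t ^ (-(q / 2)))
    (k₂ := -(q / 2) * (‖x - y‖ ^ 2) ^ (-(q / 2) - 1)) (c := y) (x := x)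
    (by filter_upwards [lt_mem_nhds hpos2] with t ht using hasDerivAt_kap q ht)
    (Real.hasDerivAt_rpow_const (Or.inl hpos2.ne'))
  rw [hessian_const_mul (contDiffAt_normSq (contDiffAt_kap q hpos2)), h1] at hmem
  set e : Euc n := ‖x - y‖⁻¹ • (x - y) with he
  have he1 : ‖e‖ = 1 := by rw [he, norm_smul]; simp [hpos.ne']
  have hxe : x - y = ‖x - y‖ • e := by rw [he, smul_smul, mul_inv_cancel₀ hpos.ne', one_smul]
  have h3 : projLine (x - y) = ‖x - y‖ ^ 2 • projLine e := by
    conv_lhs => rw [hxe]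
    exact projLine_smul _ _
  have h4 : (‖x - y‖ ^ 2) ^ (-(q / 2) - 1) * ‖x - y‖ ^ 2 = θ := by
    rw [Real.rpow_sub_one hpos2.ne', div_mul_cancel₀ _ hpos2.ne']
  have h5 : C • ((2 * θ) • (1 : Mat n) +
      (4 * (-(q / 2) * (‖x - y‖ ^ 2) ^ (-(q / 2) - 1))) • projLine (x - y)) =
      (2 * C * θ) • rieszMat e q := by
    rw [h3, rieszMat_eq, smul_smul (4 * _)]
    have : 4 * (-(q / 2) * (‖x - y‖ ^ 2) ^ (-(q / 2) - 1)) * ‖x - y‖ ^ 2 = -2 * q * θ := by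
      rw [← h4]; ring
    rw [this]
    module
  rw [h5] at hmem
  have := h.cone (2 * C * θ)⁻¹ (by positivity) _ hmem
  rw [smul_smul, inv_mul_cancel₀ (by positivity), one_smul] at this
  exact h.riesz_notMem q hpq e he1 this

/-- If the bound failed, a translate of the kernel at a level above N would touch U from above.
Contact cannot occur at the pole, where the kernel vanishes and U ≤ N, nor on the sphere, by `hMN`;
elsewhere the Hessian of the kernel is not in F. -/
lemma RieszData.le_add_kap (h : RieszData F p) {q : ℝ} (hpq : p < q) (hq : q < 2)
    (hU : IsSubharmonicOn F univ U) {y : Euc n} {R M N C : ℝ} (hC : 0 < C)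
    (hM : ∀ x ∈ Metric.closedBall y R, U x ≤ M) (hy : U y ≤ N) (hMN : M - N < C * kap q (R ^ 2))
    {x : Euc n} (hx : x ∈ Metric.closedBall y R) :
    U x ≤ ((N + C * kap q (‖x - y‖ ^ 2) : ℝ) : EReal) := by
  by_contra! hlt
  set ψ : Euc n → ℝ := fun z => C * kap q (‖z - y‖ ^ 2) with hψ
  have hψc : Continuous ψ := by
    have := continuous_kap hq
    fun_prop
  obtain ⟨y', hy', t, ht, htouch⟩ := exists_touching (isCompact_closedBall y R)
    (hU.usc.mono (subset_univ _)) (fun z _ => hU.ne_top z (mem_univ z)) hψc.continuousOn hx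
    (ne_bot_of_gt hlt)
  have h1 := hlt.trans_le (htouch x hx)
  rw [EReal.coe_lt_coe_iff] at h1
  have hNt : N < t - ψ y' := by linarith
  have hyy : y' ≠ y := by
    rintro rfl
    rw [ht, EReal.coe_le_coe_iff] at hy
    have : ψ y' = 0 := by simp [hψ, kap_zero hq]
    linarith
  have hyB : y' ∈ Metric.ball y R := by
    rw [mem_closedBall_iff_norm] at hy'
    rw [mem_ball_iff_norm]
    refine lt_of_le_of_ne hy' fun hR => ?_
    have h2 := hM y' (mem_closedBall_iff_norm.2 hy')
    rw [ht, EReal.coe_le_coe_iff] at h2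
    have : ψ y' = C * kap q (R ^ 2) := by simp only [hψ]; rw [hR]
    linarith
  have hpos : 0 < ‖y' - y‖ ^ 2 := by
    have := norm_pos_iff.2 (sub_ne_zero.2 hyy)
    positivity
  have hψd : ContDiffAt ℝ 2 ψ y' := contDiffAt_const.mul (contDiffAt_normSq (contDiffAt_kap q hpos))
  have := hU.viscosity y' (mem_univ y') (fun z => ψ z + (t - ψ y')) (hψd.add contDiffAt_const)
    (by rw [ht]; congr 1; ring)
    (mem_of_superset (Metric.isOpen_ball.mem_nhds hyB)
      fun z hz => htouch z (Metric.ball_subset_closedBall hz))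
  rw [hessian_add_const] at this
  exact h.hessian_kap_notMem hpq hC hyy this

lemma tendsto_kap_normSq {q : ℝ} (hq : q < 2) (x : Euc n) (C : ℝ) :
    Tendsto (fun y => C * kap q (‖x - y‖ ^ 2)) (𝓝 x) (𝓝 0) := by
  have hc := continuous_kap hq
  have : Continuous fun y => C * kap q (‖x - y‖ ^ 2) := by fun_prop
  simpa [kap_zero hq] using this.tendsto x

/-- Only lower semicontinuity is at stake. A low value at y near x, fed into the barrier with pole
y, would make U(x) too small; the constant C depends only on the level c₁ and an upper bound for U
near x, so it is uniform in y. -/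
theorem RieszData.continuous_of_isSubharmonicOn (h : RieszData F p) (hp : p < 2)
    (hU : IsSubharmonicOn F univ U) : Continuous U := by
  obtain ⟨q, hpq, hq⟩ := exists_between hp
  rw [continuous_iff_continuousAt]
  intro x
  refine tendsto_order.2 ⟨fun c hc => ?_, fun c hc => ?_⟩
  · obtain ⟨c₁, hc₁, hc'⟩ := EReal.lt_iff_exists_real_btwn.1 hc
    obtain ⟨c₂, hc₂, hc₂x⟩ := EReal.lt_iff_exists_real_btwn.1 hc'
    rw [EReal.coe_lt_coe_iff] at hc₂
    obtain ⟨M, hM⟩ := exists_real_bound (isCompact_closedBall x 2) (hU.usc.mono (subset_univ _))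
      fun y _ => hU.ne_top y (mem_univ y)
    have hcM : c₁ < M := EReal.coe_lt_coe_iff.1
      (hc'.trans_le (hM x (Metric.mem_closedBall_self (by norm_num))))
    have hk := kap_pos hq one_pos
    set C := (M - c₁ + 1) / kap q 1 with hCdef
    have hC : 0 < C := div_pos (by linarith) hk
    filter_upwards [(tendsto_kap_normSq hq x C).eventually (gt_mem_nhds (sub_pos.2 hc₂)),
      Metric.ball_mem_nhds x one_pos] with y hy hyB
    by_contra! hcy
    rw [Metric.mem_ball'] at hyB
    have := h.le_add_kap hpq hq hU (y := y) (R := 1) hC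
      (fun z hz => hM z (by
        rw [Metric.mem_closedBall] at hz ⊢
        rw [dist_comm] at hyB
        linarith [dist_triangle z y x])) (hcy.trans hc₁.le)
      (by rw [one_pow, hCdef, div_mul_cancel₀ _ hk.ne']; linarith)
      (Metric.mem_closedBall.2 hyB.le)
    have h2 := hc₂x.trans_le this
    rw [EReal.coe_lt_coe_iff] at h2
    linarith
  · have := hU.usc x (mem_univ x) c hc
    rwa [nhdsWithin_univ] at this

/-- When U(y) = -∞ the barrier applies with every level N. Where the normalised kernel is below 1/4,
the resulting bound is at most N + (M - N + 1)/4, which tends to -∞ with N. -/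
lemma RieszData.eventually_eq_bot (h : RieszData F p) (hp : p < 2)
    (hU : IsSubharmonicOn F univ U) {y : Euc n} (hy : U y = ⊥) : ∀ᶠ x in 𝓝 y, U x = ⊥ := by
  obtain ⟨q, hpq, hq⟩ := exists_between hp
  obtain ⟨M, hM⟩ := exists_real_bound (isCompact_closedBall y 1) (hU.usc.mono (subset_univ _))
    fun y _ => hU.ne_top y (mem_univ y)
  have hk := kap_pos hq one_pos
  filter_upwards [(tendsto_kap_normSq hq y (kap q 1)⁻¹).eventually
    (gt_mem_nhds (show (0 : ℝ) < 1 / 4 by norm_num)), Metric.ball_mem_nhds y one_pos] with x hx hxB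
  refine (EReal.eq_bot_iff_forall_lt _).2 fun d => ?_
  -- The second entry solves 3N/4 + (M + 1)/4 = d - 1, and N ≤ M keeps the coefficient of the
  -- barrier positive.
  set N := min M (4 / 3 * (d - 1 - (M + 1) / 4)) with hN
  have hNM : N ≤ M := min_le_left _ _
  have hNd : N ≤ 4 / 3 * (d - 1 - (M + 1) / 4) := min_le_right _ _
  have := h.le_add_kap hpq hq hU (y := y) (R := 1) (N := N) (C := (M - N + 1) * (kap q 1)⁻¹)
    (mul_pos (by linarith) (inv_pos.2 hk)) hM (by rw [hy]; exact bot_le)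
    (by rw [one_pow, mul_assoc, inv_mul_cancel₀ hk.ne']; linarith) (Metric.ball_subset_closedBall hxB)
  refine this.trans_lt (EReal.coe_lt_coe_iff.2 ?_)
  rw [norm_sub_rev] at hx
  rw [mul_assoc]
  nlinarith

theorem theorem10p2 {n : ℕ} (F : Set (Mat n)) (hF : IsSubequation F) (hcone : IsConeSet F)
    (hST : IsSTInvariant F) (hconv : Convex ℝ F)
    (p : ℝ) (hp : rieszChar F = (p : EReal))
    (ρ : ℝ) (hρ : 0 < ρ) (u : Euc n → EReal)
    (hu : IsSubharmonicOn F (Metric.ball (0 : Euc n) ρ) u)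
    (U : Euc n → EReal) (hU : IsTangentAtZero p u U) :
    IsMaximalOn F {(0 : Euc n)}ᶜ U ∧
    ((∀ x : Euc n, x ≠ 0 → U x ≠ ⊥) → ContinuousOn U {(0 : Euc n)}ᶜ →
      IsHarmonicOn F {(0 : Euc n)}ᶜ U) ∧
    (p < 2 → ContinuousOn U {(0 : Euc n)}ᶜ ∧ IsHarmonicOn F {(0 : Euc n)}ᶜ U) := by
  have h := RieszData.mk' hF hcone hST hconv p hp
  obtain ⟨m, hm⟩ := exists_isStabMeasure hF.closed
  obtain ⟨Ubar, r, b, hrep, hr, hr0, hfast⟩ := exists_isFastSeq h hρ hu hU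
  obtain ⟨Θ, c, hΘ⟩ := exists_orbitMean_eq h hm hρ hu hr hr0 hfast
  have hmax := hfast.isMaximalOn h hm hrep hΘ
  have hharm : (∀ x : Euc n, x ≠ 0 → U x ≠ ⊥) → ContinuousOn U {(0 : Euc n)}ᶜ →
      IsHarmonicOn F {(0 : Euc n)}ᶜ U := fun hbot hc =>
    hmax.isHarmonicOn hF isOpen_compl_singleton hbot hc
  refine ⟨hmax, hharm, fun hp2 => ?_⟩
  have hsub := hfast.isSubharmonicOn h hrep
  have hc : ContinuousOn U {(0 : Euc n)}ᶜ :=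
    (h.continuous_of_isSubharmonicOn hp2 hsub).continuousOn
  refine ⟨hc, hharm (fun x _ hx => ?_) hc⟩
  -- A single value -∞ would spread to a ball, a set of positive measure, but U agrees almost
  -- everywhere with the real-valued limit.
  obtain ⟨s, hs, hB⟩ := Metric.nhds_basis_ball.eventually_iff.1 (h.eventually_eq_bot hp2 hsub hx)
  have h0 : volume (Metric.ball x s) = 0 := measure_eq_zero_iff_ae_notMem.2 <| by
    filter_upwards [hfast.ae_eq h hrep] with y hy hyB
    exact EReal.coe_ne_bot (Ubar y) (hy.symm.trans (hB hyB))
  exact (Metric.measure_ball_pos volume x hs).ne' h0
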